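/- Let $\delta > 0$ be a real number and let $k \ge \frac{25(1+\delta)^2}{\delta^2}$ and $\Delta \ge 2$ be integers such that $\Delta \le \frac{1}{100k^3}\, 2^{k/(1+\delta)}$. Then there is a (deterministic) fully polynomial-time approximation scheme (FPTAS) for the number of independent sets in $k$-uniform linear hypergraphs with maximum degree at most $\Delta$. Here a finite hypergraph $H=(V,\mathcal E)$ is $k$-uniform if every hyperedge has exactly $k$ vertices, and linear if any two distinct hyperedges intersect in at most one vertex; its maximum degree is the largest number of hyperedges containing a common vertex. A set $S \subseteq V$ is independent if $S\cap e\ne e$ for all $e \in \mathcal E$; let $Z_H$ be the number of independent sets of $H$. That there is an FPTAS means: for every fixed $\delta,k,\Delta$ as above there are one deterministic algorithm (a program for a unit-cost random-access machine with addition and subtraction) and one polynomial such that, given any such hypergraph $H$ (vertices $0,\dots,n-1$, hyperedges given as a list of vertex lists) and any rational $\varepsilon > 0$ (given as a numerator and a denominator), the algorithm halts after a number of steps bounded by that polynomial in $n=|V|$ and $1/\varepsilon$ and outputs a rational number $\widehat Z$ with $|\widehat Z - Z_H| \le \varepsilon Z_H$. -/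

import Mathlib

/-! ### Random-access machine

Deterministic structured programs over registers and an indirectly addressed memory, all cells
holding natural numbers. Every elementary operation and every test costs one unit of time.
The only arithmetic is addition and truncated subtraction, so that the bit length of the largest
number in the machine grows by at most one per unit of time; this is the usual unit-cost RAM,
polynomially equivalent to Turing machines. -/

namespace RAM

/-- Programs. Register names are constants of the program. -/
inductive Prog : Type
  /-- Do nothing. -/
  | skip : Prog
  /-- `reg a := c`. -/
  | const (a c : ℕ) : Prog
  /-- `reg a := reg b + reg c`. -/
  | plus (a b c : ℕ) : Prog
  /-- `reg a := reg b - reg c` (truncated at zero). -/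
  | minus (a b c : ℕ) : Prog
  /-- `reg a := mem (reg b)`. -/
  | load (a b : ℕ) : Prog
  /-- `mem (reg a) := reg b`. -/
  | store (a b : ℕ) : Prog
  /-- Run the first program, then the second. -/
  | seq (P Q : Prog) : Prog
  /-- If `reg a ≠ 0` run `P`, otherwise run `Q`. -/
  | ite (a : ℕ) (P Q : Prog) : Prog
  /-- While `reg a ≠ 0` run `P`. -/
  | loop (a : ℕ) (P : Prog) : Prog

/-- A machine state: the contents of the registers and of the memory. -/
@[ext]
structure State : Type where
  reg : ℕ → ℕ
  mem : ℕ → ℕ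

/-- Write the value `x` into register `a`. -/
def State.setReg (s : State) (a x : ℕ) : State :=
  { s with reg := Function.update s.reg a x }

/-- Write the value `x` into the memory cell with address `i`. -/
def State.setMem (s : State) (i x : ℕ) : State :=
  { s with mem := Function.update s.mem i x }

/-- `Exec P s t s'`: started in state `s`, the program `P` halts in state `s'` after exactly `t`
units of time. -/
inductive Exec : Prog → State → ℕ → State → Prop
  | skip (s : State) : Exec .skip s 1 s
  | const (a c : ℕ) (s : State) : Exec (.const a c) s 1 (s.setReg a c)
  | plus (a b c : ℕ) (s : State) :
      Exec (.plus a b c) s 1 (s.setReg a (s.reg b + s.reg c))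
  | minus (a b c : ℕ) (s : State) :
      Exec (.minus a b c) s 1 (s.setReg a (s.reg b - s.reg c))
  | load (a b : ℕ) (s : State) : Exec (.load a b) s 1 (s.setReg a (s.mem (s.reg b)))
  | store (a b : ℕ) (s : State) : Exec (.store a b) s 1 (s.setMem (s.reg a) (s.reg b))
  | seq {P Q : Prog} {s s₁ s₂ : State} {t₁ t₂ : ℕ} :
      Exec P s t₁ s₁ → Exec Q s₁ t₂ s₂ → Exec (.seq P Q) s (t₁ + t₂) s₂
  | iteThen {a : ℕ} {P Q : Prog} {s s' : State} {t : ℕ} :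
      s.reg a ≠ 0 → Exec P s t s' → Exec (.ite a P Q) s (t + 1) s'
  | iteElse {a : ℕ} {P Q : Prog} {s s' : State} {t : ℕ} :
      s.reg a = 0 → Exec Q s t s' → Exec (.ite a P Q) s (t + 1) s'
  | loopStop {a : ℕ} {P : Prog} {s : State} :
      s.reg a = 0 → Exec (.loop a P) s 1 s
  | loopStep {a : ℕ} {P : Prog} {s s₁ s₂ : State} {t₁ t₂ : ℕ} :
      s.reg a ≠ 0 → Exec P s t₁ s₁ → Exec (.loop a P) s₁ t₂ s₂ →
      Exec (.loop a P) s (t₁ + t₂ + 1) s₂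

/-- The machine is deterministic: running time and final state are determined by the program and
the initial state. -/
theorem Exec.det {P : Prog} {s s₁ s₂ : State} {t₁ t₂ : ℕ}
    (h₁ : Exec P s t₁ s₁) (h₂ : Exec P s t₂ s₂) : t₁ = t₂ ∧ s₁ = s₂ := by
  induction h₁ generalizing t₂ s₂ with
  | skip | const | plus | minus | load | store => cases h₂; exact ⟨rfl, rfl⟩
  | seq _ _ ih₁ ih₂ =>
    cases h₂ with
    | seq g₁ g₂ =>
      obtain ⟨rfl, rfl⟩ := ih₁ g₁
      obtain ⟨rfl, rfl⟩ := ih₂ g₂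
      exact ⟨rfl, rfl⟩
  | iteThen h _ ih =>
    cases h₂ with
    | iteThen _ g => obtain ⟨rfl, rfl⟩ := ih g; exact ⟨rfl, rfl⟩
    | iteElse h' _ => exact absurd h' h
  | iteElse h _ ih =>
    cases h₂ with
    | iteThen h' _ => exact absurd h h'
    | iteElse _ g => obtain ⟨rfl, rfl⟩ := ih g; exact ⟨rfl, rfl⟩
  | loopStop h =>
    cases h₂ with
    | loopStop _ => exact ⟨rfl, rfl⟩
    | loopStep h' _ _ => exact absurd h h'
  | loopStep h _ _ ih₁ ih₂ =>
    cases h₂ with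
    | loopStop h' => exact absurd h' h
    | loopStep _ g₁ g₂ =>
      obtain ⟨rfl, rfl⟩ := ih₁ g₁
      obtain ⟨rfl, rfl⟩ := ih₂ g₂
      exact ⟨rfl, rfl⟩

/-- The initial state on input `w`: the word `w` is written in the memory from address `0` on, and
every other memory cell and every register holds `0`. -/
def State.init (w : List ℕ) : State where
  reg := fun _ => 0
  mem := fun i => w.getD i 0

end RAM

namespace Hypergraph

/-- Every hyperedge has exactly `k` vertices. -/
def IsUniform {α : Type*} (H : Hypergraph α) (k : ℕ) : Prop :=
  ∀ e ∈ H.edgeSet, e.encard = k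

/-- Any two distinct hyperedges meet in at most one vertex. -/
def IsLinear {α : Type*} (H : Hypergraph α) : Prop :=
  ∀ e ∈ H.edgeSet, ∀ f ∈ H.edgeSet, e ≠ f → (e ∩ f).encard ≤ 1

/-- Every vertex lies in at most `Δ` hyperedges. -/
def MaxDegreeLE {α : Type*} (H : Hypergraph α) (Δ : ℕ) : Prop :=
  ∀ v ∈ H.vertexSet, {e | e ∈ H.edgeSet ∧ v ∈ e}.encard ≤ Δ

/-- `S` is a (weak) independent set: a set of vertices that contains no hyperedge. -/
def IsIndepSet {α : Type*} (H : Hypergraph α) (S : Set α) : Prop :=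
  S ⊆ H.vertexSet ∧ ∀ e ∈ H.edgeSet, S ∩ e ≠ e

/-- The number of independent sets (used for hypergraphs with finite vertex set). -/
noncomputable def numIndepSets {α : Type*} (H : Hypergraph α) : ℕ :=
  {S | H.IsIndepSet S}.ncard

/-- `H.Encodes n w`: the hypergraph `H` has vertex set `{0, …, n - 1}`, and the word `w` lists, in
this order, the number `n`, the number of hyperedges, and then every hyperedge exactly once, each
as its number of vertices followed by its vertices. The order of the hyperedges, and of the
vertices within a hyperedge, is arbitrary. -/
def Encodes (H : Hypergraph ℕ) (n : ℕ) (w : List ℕ) : Prop :=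
  H.vertexSet = Set.Iio n ∧
  ∃ L : List (List ℕ),
    (∀ l ∈ L, l.Nodup) ∧
    (L.map fun l => {v | v ∈ l}).Nodup ∧
    (∀ e : Set ℕ, e ∈ H.edgeSet ↔ ∃ l ∈ L, {v | v ∈ l} = e) ∧
    w = n :: L.length :: L.flatMap fun l => l.length :: l

/-- There is a (deterministic) fully polynomial-time approximation scheme for the quantity `Z` on
the class `𝒢` of finite hypergraphs (with vertices named `0, …, n - 1`): one program which, on
input positive integers `p`, `q` and any encoding of an `n`-vertex hypergraph `H` in `𝒢`, halts
within time polynomial in `n` and `1 / ε`, where `ε = p / q`, and outputs a rational number,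
as numerator and denominator, that approximates `Z H` with relative error at most `ε`. -/
def HasFPTAS (𝒢 : Set (Hypergraph ℕ)) (Z : Hypergraph ℕ → ℕ) : Prop :=
  ∃ (P : RAM.Prog) (C : ℕ),
    ∀ H ∈ 𝒢, ∀ (n : ℕ) (w : List ℕ), H.Encodes n w →
    ∀ p q : ℕ, 0 < p → 0 < q →
    ∃ (t : ℕ) (s : RAM.State),
      RAM.Exec P (RAM.State.init (p :: q :: w)) t s ∧
      (t : ℝ) ≤ C * ((n : ℝ) + 1 / ((p : ℝ) / q) + 1) ^ C ∧
      s.reg 1 ≠ 0 ∧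
      |(s.reg 0 : ℝ) / s.reg 1 - Z H| ≤ (p : ℝ) / q * Z H

end Hypergraph

/-! Counting reduces to marginals. Let `i` run through the vertices and delete the hyperedges
through `i` one vertex after the other. For a set that avoids `i` these hyperedges are no
constraint, and after their deletion `i` is free. Hence the marginal probabilities that `i` is
unoccupied, taken in the hypergraph of the hyperedges inside `{i, …, n - 1}`, telescope to the
inverse of the number of independent sets (`prod_marginal`). Each marginal is at least `1/2`, so
additive errors of order `ε / n` are harmless (`abs_prod_div_sub_one_le`).

A marginal is read off the systematic scan Glauber dynamics, for which the uniform distribution is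
stationary (`sum_conf`), by tracing one final update backwards in time. An update with bit `0`
leaves its vertex unoccupied whatever happened before. A hyperedge can therefore matter at time `t`
only if the bits of the last updates of all its vertices are `1`. The exploration continues only
through such open windows. If it reveals few bits, it ends before reaching the initial times, and
the revealed bits determine the outcome independently of the initial state
(`Explored.mem_conf_iff`).

A long exploration contains a large connected set of pairs (hyperedge, time) with open windows
(`Explored.exists_isCluster`). Windows of different hyperedges share at most one time by linearity;
windows of the same hyperedge may share many, so the set is first thinned to one without such
conflicts (`LinearEdges.exists_conflictFree`). In it there are `l` mutually separated blocks of `θ =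
⌊√k⌋` pairs (`exists_separated_blocks`). A block covers at least `θ(k - θ)` times, all of which must
carry the bit `1`, while the number of placements per block is at most `(7k⁶Δ)^(θ+1)` by a bound on
the number of connected sets (`card_grow_le`). The assumption on `Δ` makes the product of the two at
most `1/2` (`Sparse.block`). The failure probability thus decays like `2^(-l)`, and the number of
revealed bits allowed is affine in `l`.

With `l` logarithmic in `n / ε`, all strings of `s = O(log (n / ε))` bits can be enumerated, each
string supplying the bits in the order of their discovery (`card_filter_digits`). For fixed `k` and
`Δ` there are polynomially many strings. The remainder implements this enumeration on the machine,
with statements `Runs` that give correctness and time together. -/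

namespace Percolation

/-! ### Connected sets and separated blocks in graphs of bounded degree. -/

variable {α : Type*} [DecidableEq α]

/-- Finite sets that can be grown from the root `a` by adding neighbours one at a time. -/
inductive Grow (adj : α → α → Prop) (a : α) : Finset α → Prop
  | single : Grow adj a {a}
  | insert {S : Finset α} {x y : α} :
      Grow adj a S → y ∈ S → adj y x → Grow adj a (insert x S)

theorem Grow.root_mem {adj : α → α → Prop} {a : α} {S : Finset α} (h : Grow adj a S) :
    a ∈ S := by
  induction h with
  | single => simp
  | insert _ _ _ ih => exact Finset.mem_insert_of_mem ih

theorem Grow.union {adj : α → α → Prop} {a z y : α} {S B : Finset α} (hS : Grow adj a S)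
    (hy : y ∈ S) (hyz : adj y z) (hB : Grow adj z B) : Grow adj a (S ∪ B) := by
  induction hB with
  | single =>
    have := Grow.insert hS hy hyz
    rwa [Finset.insert_eq, Finset.union_comm] at this
  | insert _ hw hadj ih =>
    rw [Finset.union_insert]
    exact Grow.insert ih (Finset.mem_union_right _ hw) hadj

/-- Vertices of `Ω` outside `S` with a neighbour in `S`. -/
noncomputable def boundary (adj : α → α → Prop) (Ω S : Finset α) : Finset α := by
  classical exact Ω.filter fun y => y ∉ S ∧ ∃ x ∈ S, adj x y

theorem card_boundary_le {adj : α → α → Prop} {Ω S : Finset α} {D : ℕ} (hS : S ⊆ Ω)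
    (hD : ∀ x ∈ Ω, ∃ N : Finset α, N.card ≤ D ∧ ∀ y ∈ Ω, adj x y → y ∈ N) :
    (boundary adj Ω S).card ≤ S.card * D := by
  classical
  choose! N hN hN' using hD
  calc (boundary adj Ω S).card ≤ (S.biUnion N).card := by
        apply Finset.card_le_card
        intro y hy
        simp only [boundary, Finset.mem_filter] at hy
        obtain ⟨hy, _, x, hx, hxy⟩ := hy
        exact Finset.mem_biUnion.2 ⟨x, hx, hN' x (hS hx) y hy hxy⟩
    _ ≤ S.card * D := Finset.card_biUnion_le_card_mul _ _ _ fun x hx => hN x (hS hx)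

/-- While `S'` grows inside `ω`, the first vertex to leave `S` would lie in the boundary of `S`,
which `ω` avoids. So the configuration `ω` determines a connected set it contains and whose boundary
it avoids, namely the cluster of `a`. -/
theorem Grow.subset_of_compatible {adj : α → α → Prop} {a : α} {Ω S S' ω : Finset α}
    (hS : Grow adj a S) (hS' : Grow adj a S') (hΩ' : S' ⊆ Ω)
    (hω : Disjoint ω (boundary adj Ω S)) (hω' : S' ⊆ ω) : S' ⊆ S := by
  induction hS' with
  | single => simpa using hS.root_mem
  | @insert T x y hT hy hadj ih =>
    rw [Finset.insert_subset_iff] at hω' hΩ' ⊢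
    have hTS := ih hΩ'.2 hω'.2
    refine ⟨?_, hTS⟩
    by_contra hx
    refine Finset.disjoint_left.1 hω hω'.1 ?_
    simp only [boundary, Finset.mem_filter]
    exact ⟨hΩ'.1, hx, y, hTS hy, hadj⟩

/-- This is the probability, in site percolation of density `p` on `Ω`, that `S` is open and `B` is
closed; the other sites contribute a factor `1` by the binomial theorem. -/
theorem sum_compatible (Ω S B : Finset α) (p : ℝ) (hS : S ⊆ Ω) (hB : B ⊆ Ω)
    (hSB : Disjoint S B) :
    ∑ ω ∈ ((Ω \ (S ∪ B)).powerset).image (S ∪ ·), p ^ ω.card * (1 - p) ^ (Ω.card - ω.card)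
      = p ^ S.card * (1 - p) ^ B.card := by
  have hdis : ∀ τ ∈ (Ω \ (S ∪ B)).powerset, Disjoint S τ := by
    intro τ hτ
    rw [Finset.mem_powerset] at hτ
    exact Finset.disjoint_left.2 fun x hx hx' => by
      have := hτ hx'
      simp [hx] at this
  have hcard : Ω.card = S.card + B.card + (Ω \ (S ∪ B)).card := by
    rw [← Finset.card_union_of_disjoint hSB, add_comm,
      Finset.card_sdiff_add_card_eq_card (Finset.union_subset hS hB)]
  rw [Finset.sum_image]
  · have : ∀ τ ∈ (Ω \ (S ∪ B)).powerset,
        p ^ (S ∪ τ).card * (1 - p) ^ (Ω.card - (S ∪ τ).card) =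
        p ^ S.card * (1 - p) ^ B.card *
          (p ^ τ.card * (1 - p) ^ ((Ω \ (S ∪ B)).card - τ.card)) := by
      intro τ hτ
      have h1 := Finset.card_le_card (Finset.mem_powerset.1 hτ)
      rw [Finset.card_union_of_disjoint (hdis τ hτ),
        show Ω.card - (S.card + τ.card) = B.card + ((Ω \ (S ∪ B)).card - τ.card) by omega,
        pow_add, pow_add]
      ring
    rw [Finset.sum_congr rfl this, ← Finset.mul_sum, Finset.sum_pow_mul_eq_add_pow]
    simp
  · intro τ hτ τ' hτ' h
    have h1 := hdis τ hτ
    have h2 := hdis τ' hτ'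
    simp only at h
    rw [← Finset.union_sdiff_cancel_left h1, h, Finset.union_sdiff_cancel_left h2]

theorem one_add_inv_pow_le_three (D : ℕ) : ((D : ℝ) + 1) ^ D ≤ 3 * (D : ℝ) ^ D := by
  rcases Nat.eq_zero_or_pos D with rfl | hD
  · norm_num
  have hD' : (0 : ℝ) < D := by exact_mod_cast hD
  have h1 : (1 + 1 / (D : ℝ)) ^ D ≤ 3 := by
    calc (1 + 1 / (D : ℝ)) ^ D ≤ (Real.exp (1 / (D : ℝ))) ^ D := by
          gcongr
          rw [add_comm]; exact Real.add_one_le_exp _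
      _ = Real.exp 1 := by
          rw [← Real.exp_nat_mul]; congr 1; field_simp
      _ ≤ 3 := Real.exp_one_lt_three.le
  calc ((D : ℝ) + 1) ^ D = (1 + 1 / (D : ℝ)) ^ D * (D : ℝ) ^ D := by
        rw [← mul_pow]; congr 1; field_simp
    _ ≤ 3 * (D : ℝ) ^ D := by gcongr

/-- The number of connected sets of at most `m` vertices containing a given root in a graph of
maximum degree `D`. -/
theorem card_grow_le {adj : α → α → Prop} {a : α} {Ω : Finset α} {D m : ℕ}
    (hD : ∀ x ∈ Ω, ∃ N : Finset α, N.card ≤ D ∧ ∀ y ∈ Ω, adj x y → y ∈ N)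
    (F : Finset (Finset α)) (hF : ∀ S ∈ F, Grow adj a S ∧ S ⊆ Ω ∧ S.card ≤ m) :
    F.card ≤ (3 * (D + 1)) ^ m := by
  classical
  -- Site percolation with the density that maximizes `p (1 - p) ^ D`, a lower bound per vertex for
  -- the probability that a given set is the cluster of `a`.
  set p : ℝ := 1 / (D + 1) with hp
  have hD0 : (0 : ℝ) < (D : ℝ) + 1 := by positivity
  have hp0 : 0 < p := by positivity
  have hp1 : p ≤ 1 := by
    rw [hp, div_le_one hD0]; simp
  have hq : 1 - p = D / (D + 1) := by rw [hp]; field_simp; ring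
  have hbase : 1 / (3 * ((D : ℝ) + 1)) ≤ p * (1 - p) ^ D := by
    rw [hq, hp, div_pow, div_mul_div_comm, one_mul, div_le_div_iff₀ (by positivity) (by positivity)]
    have := one_add_inv_pow_le_three D
    nlinarith
  -- The event that `S` is the open cluster of `a`. These events are disjoint, so their
  -- probabilities sum to at most `1`, and each is at least `(3 (D + 1)) ^ (-m)`.
  set E : Finset α → Finset (Finset α) :=
    fun S => ((Ω \ (S ∪ boundary adj Ω S)).powerset).image (S ∪ ·) with hE
  have hbsub : ∀ S, boundary adj Ω S ⊆ Ω := fun S => by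
    simp only [boundary]; exact Finset.filter_subset _ _
  have hbdis : ∀ S, Disjoint S (boundary adj Ω S) := fun S => by
    simp only [boundary]
    exact Finset.disjoint_left.2 fun x hx hx' => (Finset.mem_filter.1 hx').2.1 hx
  have hEmem : ∀ S ∈ F, ∀ ω ∈ E S, S ⊆ ω ∧ ω ⊆ Ω ∧ Disjoint ω (boundary adj Ω S) := by
    intro S hS ω hω
    simp only [hE, Finset.mem_image, Finset.mem_powerset] at hω
    obtain ⟨τ, hτ, rfl⟩ := hω
    refine ⟨Finset.subset_union_left, Finset.union_subset (hF S hS).2.1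
      (hτ.trans Finset.sdiff_subset), ?_⟩
    rw [Finset.disjoint_union_left]
    refine ⟨hbdis S, Finset.disjoint_left.2 fun x hx hx' => ?_⟩
    have := hτ hx
    simp [hx'] at this
  have hdisj : (F : Set (Finset α)).PairwiseDisjoint E := by
    intro S hS S' hS' hne
    refine Finset.disjoint_left.2 fun ω hω hω' => hne ?_
    obtain ⟨h1, _, h3⟩ := hEmem S hS ω hω
    obtain ⟨h1', _, h3'⟩ := hEmem S' hS' ω hω'
    exact Finset.Subset.antisymm
      ((hF S' hS').1.subset_of_compatible (hF S hS).1 (hF S hS).2.1 h3' h1)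
      ((hF S hS).1.subset_of_compatible (hF S' hS').1 (hF S' hS').2.1 h3 h1')
  have hsum : ∑ S ∈ F, p ^ S.card * (1 - p) ^ (boundary adj Ω S).card ≤ 1 := by
    calc ∑ S ∈ F, p ^ S.card * (1 - p) ^ (boundary adj Ω S).card
        = ∑ S ∈ F, ∑ ω ∈ E S, p ^ ω.card * (1 - p) ^ (Ω.card - ω.card) :=
          Finset.sum_congr rfl fun S hS =>
            (sum_compatible Ω S _ p (hF S hS).2.1 (hbsub S) (hbdis S)).symm
      _ = ∑ ω ∈ F.biUnion E, p ^ ω.card * (1 - p) ^ (Ω.card - ω.card) :=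
          (Finset.sum_biUnion hdisj).symm
      _ ≤ ∑ ω ∈ Ω.powerset, p ^ ω.card * (1 - p) ^ (Ω.card - ω.card) := by
          apply Finset.sum_le_sum_of_subset_of_nonneg
          · intro ω hω
            obtain ⟨S, hS, hω⟩ := Finset.mem_biUnion.1 hω
            exact Finset.mem_powerset.2 (hEmem S hS ω hω).2.1
          · intro ω _ _
            have : 0 ≤ 1 - p := by linarith
            positivity
      _ = 1 := by rw [Finset.sum_pow_mul_eq_add_pow]; simp
  have hterm : ∀ S ∈ F, (1 / (3 * ((D : ℝ) + 1))) ^ m ≤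
      p ^ S.card * (1 - p) ^ (boundary adj Ω S).card := by
    intro S hS
    have h1 : 0 ≤ 1 - p := by linarith
    calc (1 / (3 * ((D : ℝ) + 1))) ^ m ≤ (1 / (3 * ((D : ℝ) + 1))) ^ S.card := by
          apply pow_le_pow_of_le_one (by positivity) _ (hF S hS).2.2
          rw [div_le_one (by positivity)]; nlinarith [(Nat.cast_nonneg D : (0 : ℝ) ≤ D)]
      _ ≤ (p * (1 - p) ^ D) ^ S.card := by gcongr
      _ = p ^ S.card * (1 - p) ^ (S.card * D) := by rw [mul_pow, ← pow_mul, mul_comm D]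
      _ ≤ p ^ S.card * (1 - p) ^ (boundary adj Ω S).card := by
          apply mul_le_mul_of_nonneg_left _ (by positivity)
          exact pow_le_pow_of_le_one h1 (by linarith) (card_boundary_le (hF S hS).2.1 hD)
  have h2 : (F.card : ℝ) * (1 / (3 * ((D : ℝ) + 1))) ^ m ≤ 1 := by
    have := (Finset.card_nsmul_le_sum F _ _ hterm).trans hsum
    rwa [nsmul_eq_mul] at this
  rw [div_pow, one_pow, mul_one_div, div_le_one (by positivity)] at h2
  exact_mod_cast h2

/-- Unions of `l` sets of size `θ`, each having neither common elements with nor neighbours in the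
previous ones. -/
inductive Sep (adj : α → α → Prop) (θ : ℕ) : ℕ → Finset α → Prop
  | zero : Sep adj θ 0 ∅
  | succ {l : ℕ} {S B : Finset α} : Sep adj θ l S → B.card = θ →
      (∀ x ∈ S, ∀ y ∈ B, x ≠ y ∧ ¬ adj x y) → Sep adj θ (l + 1) (S ∪ B)

theorem Sep.card_le {adj : α → α → Prop} {θ l : ℕ} {S : Finset α} (h : Sep adj θ l S) :
    S.card ≤ l * θ := by
  induction h with
  | zero => simp
  | succ _ hB _ ih => exact (Finset.card_union_le _ _).trans (by rw [hB, add_mul, one_mul]; omega)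

theorem exists_exit {r : α → α → Prop} {a x : α} {S : Finset α} (h : Relation.ReflTransGen r a x)
    (ha : a ∈ S) (hx : x ∉ S) : ∃ y ∈ S, ∃ z ∉ S, r y z ∧ Relation.ReflTransGen r a z := by
  induction h with
  | refl => exact absurd ha hx
  | @tail b c hab hbc ih =>
    by_cases hb : b ∈ S
    · exact ⟨b, hb, c, hx, hbc, hab.tail hbc⟩
    · exact ih hb

theorem exists_last_exit {r : α → α → Prop} {a x : α} {S : Finset α}
    (h : Relation.ReflTransGen r a x) (ha : a ∈ S) (hx : x ∉ S) :
    ∃ y ∈ S, ∃ z ∉ S, r y z ∧ Relation.ReflTransGen (fun u v => r u v ∧ v ∉ S) z x := by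
  induction h with
  | refl => exact absurd ha hx
  | @tail b c hab hbc ih =>
    by_cases hb : b ∈ S
    · exact ⟨b, hb, c, hx, hbc, .refl⟩
    · obtain ⟨y, hy, z, hz, hyz, hzb⟩ := ih hb
      exact ⟨y, hy, z, hz, hyz, hzb.tail ⟨hbc, hx⟩⟩

/-- A finite set reachable from `z` contains connected sets around `z` of all sizes. -/
theorem exists_grow_card {adj : α → α → Prop} {z : α} {K : Finset α} (hz : z ∈ K)
    (hK : ∀ x ∈ K, Relation.ReflTransGen (fun u v => adj u v ∧ v ∈ K) z x) (m : ℕ)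
    (hm : m + 1 ≤ K.card) : ∃ B ⊆ K, Grow adj z B ∧ B.card = m + 1 := by
  induction m with
  | zero => exact ⟨{z}, by simpa using hz, .single, by simp⟩
  | succ m ih =>
    obtain ⟨B, hBK, hB, hc⟩ := ih (by omega)
    obtain ⟨x, hxK, hxB⟩ := Finset.exists_mem_notMem_of_card_lt_card (s := B) (t := K) (by omega)
    obtain ⟨y, hy, w, hw, ⟨hyw, hwK⟩, -⟩ := exists_exit (hK x hxK) hB.root_mem hxB
    exact ⟨insert w B, Finset.insert_subset hwK hBK, .insert hB hy hyw,
      by rw [Finset.card_insert_of_notMem hw, hc]⟩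

/-- A large connected set contains a connected set consisting of many pairwise separated blocks
and of few other elements. -/
theorem exists_separated_blocks {adj : α → α → Prop} {a : α} {C : Finset α} {D θ : ℕ}
    (hθ : 0 < θ) (ha : a ∈ C)
    (hD : ∀ x ∈ C, ∃ N : Finset α, N.card ≤ D ∧ ∀ y ∈ C, adj x y → y ∈ N)
    (hC : ∀ x ∈ C, Relation.ReflTransGen (fun u v => adj u v ∧ v ∈ C) a x) (l : ℕ)
    (hcard : (1 + D * θ) * (1 + l * θ * (D + 1)) < C.card) :
    ∃ T S : Finset α, S ⊆ T ∧ T ⊆ C ∧ Grow adj a T ∧ T.card ≤ l * (θ + 1) + 1 ∧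
      Sep adj θ l S := by
  classical
  induction l with
  | zero => exact ⟨{a}, ∅, by simp, by simpa using ha, .single, by simp, .zero⟩
  | succ l ih =>
    obtain ⟨T, S, hST, hTC, hT, hTc, hS⟩ := ih (lt_of_le_of_lt (by gcongr; omega) hcard)
    have hSC := hST.trans hTC
    -- A new block must avoid `S` and all neighbours of `S`. The root is included so that every path
    -- from `a` to the complement of `M` has a last exit from `M`.
    set M := insert a (S ∪ boundary adj C S) with hM
    have hMcard : M.card ≤ 1 + l * θ * (D + 1) := by
      have h1 := Finset.card_insert_le a (S ∪ boundary adj C S)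
      have h2 := Finset.card_union_le S (boundary adj C S)
      have h3 := card_boundary_le hSC hD
      have h4 := hS.card_le
      have h5 : S.card * D ≤ l * θ * D := by gcongr
      have h6 : l * θ * (D + 1) = l * θ * D + l * θ := by ring
      linarith
    have hMC : M ⊆ C := by
      refine Finset.insert_subset ha (Finset.union_subset hSC ?_)
      simp only [boundary]; exact Finset.filter_subset _ _
    have haM : a ∈ M := Finset.mem_insert_self _ _
    set R := C \ M with hR
    let comp : α → Finset α := fun z =>
      R.filter fun x => Relation.ReflTransGen (fun u v => adj u v ∧ v ∈ R) z x
    have hex : ∃ z ∈ boundary adj C M, θ ≤ (comp z).card := by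
      -- Every vertex outside `M` lies in a component hanging at one of the at most `D * M.card`
      -- boundary vertices. If all components had fewer than `θ` vertices, then `C.card ≤ (1 + D *
      -- θ) * M.card`, against `hcard`.
      by_contra! hcon
      have hRsub : R ⊆ (boundary adj C M).biUnion comp := by
        intro x hx
        have hxC := (Finset.mem_sdiff.1 hx).1
        have hxM := (Finset.mem_sdiff.1 hx).2
        obtain ⟨y, hy, z, hz, ⟨hyz, hzC⟩, hzx⟩ := exists_last_exit (hC x hxC) haM hxM
        refine Finset.mem_biUnion.2 ⟨z, ?_, ?_⟩
        · simp only [boundary, Finset.mem_filter]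
          exact ⟨hzC, hz, y, hy, hyz⟩
        · exact Finset.mem_filter.2 ⟨hx, Relation.ReflTransGen.mono
            (fun u v h => ⟨h.1.1, Finset.mem_sdiff.2 ⟨h.1.2, h.2⟩⟩) _ _ hzx⟩
      have h1 := (Finset.card_le_card hRsub).trans
        (Finset.card_biUnion_le_card_mul _ _ θ fun z hz => (hcon z hz).le)
      have h2 := card_boundary_le hMC hD
      have h3 : R.card + M.card = C.card := Finset.card_sdiff_add_card_eq_card hMC
      have h4 : (boundary adj C M).card * θ ≤ M.card * D * θ := by gcongr
      have h5 : C.card ≤ (1 + D * θ) * M.card := by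
        calc C.card ≤ M.card * D * θ + M.card := by omega
          _ = _ := by ring
      have h6 : (1 + D * θ) * M.card ≤ (1 + D * θ) * (1 + (l + 1) * θ * (D + 1)) := by
        gcongr
        exact hMcard.trans (by gcongr; omega)
      omega
    obtain ⟨z, hz, hzc⟩ := hex
    simp only [boundary, Finset.mem_filter] at hz
    obtain ⟨hzC, hzM, y, hyM, hyz⟩ := hz
    have hzR : z ∈ R := Finset.mem_sdiff.2 ⟨hzC, hzM⟩
    have hzcomp : z ∈ comp z := Finset.mem_filter.2 ⟨hzR, .refl⟩
    have hreach : ∀ x ∈ comp z,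
        Relation.ReflTransGen (fun u v => adj u v ∧ v ∈ comp z) z x := by
      intro x hx
      have h := (Finset.mem_filter.1 hx).2
      induction h with
      | refl => exact .refl
      | @tail b c hab hbc ih =>
        have hb : b ∈ comp z := by
          refine Finset.mem_filter.2 ⟨?_, hab⟩
          rcases hab.cases_tail with h | ⟨_, _, h⟩
          · rwa [h]
          · exact h.2
        exact (ih hb).tail ⟨hbc.1, hx⟩
    obtain ⟨B, hBK, hB, hBc⟩ := exists_grow_card hzcomp hreach (θ - 1) (by omega)
    have hBR : B ⊆ R := hBK.trans (Finset.filter_subset _ _)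
    -- The exit vertex `y` may be missing from `T` only if it is a neighbour of `S`. Adding it is
    -- the extra vertex per block in the bound `l * (θ + 1) + 1`.
    have hyT : ∃ T' , Grow adj a T' ∧ T'.card ≤ T.card + 1 ∧ T ⊆ T' ∧ T' ⊆ C ∧ y ∈ T' := by
      by_cases hy : y ∈ T
      · exact ⟨T, hT, by omega, subset_rfl, hTC, hy⟩
      · have hyS : y ∈ boundary adj C S := by
          rw [hM, Finset.mem_insert, Finset.mem_union] at hyM
          rcases hyM with rfl | h | h
          · exact absurd hT.root_mem hy
          · exact absurd (hST h) hy
          · exact h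
        simp only [boundary, Finset.mem_filter] at hyS
        obtain ⟨hyC, _, w, hw, hwy⟩ := hyS
        exact ⟨insert y T, hT.insert (hST hw) hwy, Finset.card_insert_le _ _,
          Finset.subset_insert _ _, Finset.insert_subset hyC hTC, Finset.mem_insert_self _ _⟩
    obtain ⟨T', hT', hT'c, hTT', hT'C, hyT'⟩ := hyT
    refine ⟨T' ∪ B, S ∪ B, Finset.union_subset_union (hST.trans hTT') subset_rfl,
      Finset.union_subset hT'C (hBR.trans Finset.sdiff_subset), hT'.union hyT' hyz hB, ?_,
      .succ hS (by omega) ?_⟩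
    · have := Finset.card_union_le T' B
      rw [add_mul, one_mul]; omega
    · intro x hx w hw
      have hwR := Finset.mem_sdiff.1 (hBR hw)
      constructor
      · rintro rfl
        exact hwR.2 (by simp [hM, hx])
      · intro hadj
        refine hwR.2 ?_
        rw [hM, Finset.mem_insert, Finset.mem_union]
        by_cases hwS : w ∈ S
        · exact .inr (.inl hwS)
        · refine .inr (.inr ?_)
          simp only [boundary, Finset.mem_filter]
          exact ⟨hwR.1, hwS, x, hx, hadj⟩

end Percolation

/-! ### Windows of timed hyperedges and the rarity of large open clusters. -/

namespace Percolation

/-- `L` lists the hyperedges of a `k`-uniform linear hypergraph of maximum degree at most `Δ` on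
the vertices `0, …, n - 1`. -/
structure LinearEdges (n k Δ : ℕ) (L : List (List ℕ)) : Prop where
  edge_nodup : ∀ l ∈ L, l.Nodup
  length : ∀ l ∈ L, l.length = k
  lt : ∀ l ∈ L, ∀ u ∈ l, u < n
  linear : ∀ l ∈ L, ∀ l' ∈ L, l ≠ l' → ∀ u ∈ l, u ∈ l' → ∀ v ∈ l, v ∈ l' → u = v
  degree : ∀ u, (L.toFinset.filter (u ∈ ·)).card ≤ Δ

/-- The last time up to `t` at which the vertex `u` is updated by the systematic scan. -/
def lastUpdate (n t u : ℕ) : ℕ := t - (t + n - u) % n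

/-- The first time from `x` on at which the vertex `u` is updated by the systematic scan. -/
def nextUpdate (n x u : ℕ) : ℕ := x + (u + n - x % n) % n

/-- The condition `n ≤ t` keeps the outer subtraction in `lastUpdate` from being truncated: every
vertex has been updated in the preceding `n` steps. -/
theorem lastUpdate_spec {n t u : ℕ} (hu : u < n) (ht : n ≤ t) :
    lastUpdate n t u % n = u ∧ lastUpdate n t u ≤ t ∧ t < lastUpdate n t u + n := by
  have hn : 0 < n := by omega
  have h1 : (t + n - u) % n < n := Nat.mod_lt _ hn
  refine ⟨?_, Nat.sub_le _ _, by unfold lastUpdate; omega⟩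
  have h2 := Nat.div_add_mod (t + n - u) n
  set q := (t + n - u) / n
  have h3 : lastUpdate n t u + n = u + n * q := by unfold lastUpdate; omega
  have h4 : (lastUpdate n t u + n) % n = (u + n * q) % n := by rw [h3]
  rwa [Nat.add_mod_right, Nat.add_mul_mod_self_left, Nat.mod_eq_of_lt hu] at h4

theorem eq_of_mod_eq_of_window {n t x y : ℕ} (h : x % n = y % n) (hx : x ≤ t) (hx' : t < x + n)
    (hy : y ≤ t) (hy' : t < y + n) : x = y := by
  have h1 := Nat.div_add_mod x n
  have h2 := Nat.div_add_mod y n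
  rcases lt_trichotomy (x / n) (y / n) with h3 | h3 | h3
  · have : n * (x / n + 1) ≤ n * (y / n) := Nat.mul_le_mul_left _ h3
    rw [mul_add] at this; omega
  · rw [h3] at h1; omega
  · have : n * (y / n + 1) ≤ n * (x / n) := Nat.mul_le_mul_left _ h3
    rw [mul_add] at this; omega

theorem eq_lastUpdate {n t x : ℕ} (hn : 0 < n) (ht : n ≤ t) (hx : x ≤ t) (hx' : t < x + n) :
    lastUpdate n t (x % n) = x := by
  obtain ⟨h1, h2, h3⟩ := lastUpdate_spec (Nat.mod_lt x hn) ht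
  exact eq_of_mod_eq_of_window h1 h2 h3 hx hx'

theorem eq_nextUpdate {n x t : ℕ} (hx : x ≤ t) (hx' : t < x + n) :
    t = nextUpdate n x (t % n) := by
  have hn : 0 < n := by omega
  have hxn := Nat.mod_lt x hn
  have htn := Nat.mod_lt t hn
  have h1 := Nat.div_add_mod x n
  have h2 := Nat.div_add_mod t n
  have h3 : x / n ≤ t / n := Nat.div_le_div_right hx
  have h4 : t / n ≤ x / n + 1 := by
    by_contra! h
    have : n * (x / n + 2) ≤ n * (t / n) := Nat.mul_le_mul_left _ h
    rw [mul_add] at this; omega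
  unfold nextUpdate
  rcases (show t / n = x / n ∨ t / n = x / n + 1 by omega) with h | h
  · rw [h] at h2
    rw [show t % n + n - x % n = (t % n - x % n) + n by omega, Nat.add_mod_right,
      Nat.mod_eq_of_lt (by omega)]
    omega
  · rw [h, mul_add] at h2
    rw [Nat.mod_eq_of_lt (by omega)]
    omega

/-- The times of the last updates of the vertices of the hyperedge `a.1` up to time `a.2`. -/
def window (n : ℕ) (a : List ℕ × ℕ) : Finset ℕ := a.1.toFinset.image (lastUpdate n a.2)

/-- Hyperedges together with a time at which one of their vertices is updated. -/
def timedEdges (n : ℕ) (L : List (List ℕ)) (N : ℕ) : Finset (List ℕ × ℕ) :=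
  (L.toFinset ×ˢ Finset.range N).filter fun a => n ≤ a.2 ∧ a.2 % n ∈ a.1

/-- The windows of two timed hyperedges intersect. -/
def Overlap (n : ℕ) (a b : List ℕ × ℕ) : Prop := ∃ x, x ∈ window n a ∧ x ∈ window n b

/-- Two intersecting windows of the same hyperedge. -/
def Conflict (n : ℕ) (a b : List ℕ × ℕ) : Prop := a.1 = b.1 ∧ Overlap n a b

/-- Timed hyperedges that intersect up to replacing each by a conflicting one. -/
def Linked (n : ℕ) (Ω : Finset (List ℕ × ℕ)) (a b : List ℕ × ℕ) : Prop :=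
  ∃ c ∈ Ω, ∃ d ∈ Ω, Conflict n a c ∧ Overlap n c d ∧ Conflict n d b

section

variable {n k Δ : ℕ} {L : List (List ℕ)} {N : ℕ}

theorem mem_timedEdges {a : List ℕ × ℕ} :
    a ∈ timedEdges n L N ↔ a.1 ∈ L ∧ a.2 < N ∧ n ≤ a.2 ∧ a.2 % n ∈ a.1 := by
  simp [timedEdges, and_assoc]

theorem LinearEdges.mem_window (hL : LinearEdges n k Δ L) {a : List ℕ × ℕ}
    (ha : a.1 ∈ L) (ht : n ≤ a.2) {x : ℕ} :
    x ∈ window n a ↔ x % n ∈ a.1 ∧ x ≤ a.2 ∧ a.2 < x + n := by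
  simp only [window, Finset.mem_image, List.mem_toFinset]
  constructor
  · rintro ⟨u, hu, rfl⟩
    obtain ⟨h1, h2⟩ := lastUpdate_spec (hL.lt _ ha u hu) ht
    exact ⟨by rwa [h1], h2⟩
  · rintro ⟨h1, h2, h3⟩
    exact ⟨_, h1, eq_lastUpdate (by have := hL.lt _ ha _ h1; omega) ht h2 h3⟩

theorem LinearEdges.card_window (hL : LinearEdges n k Δ L) {a : List ℕ × ℕ}
    (ha : a.1 ∈ L) (ht : n ≤ a.2) : (window n a).card = k := by
  rw [window, Finset.card_image_of_injOn, List.toFinset_card_of_nodup (hL.edge_nodup _ ha),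
    hL.length _ ha]
  intro u hu v hv h
  simp only [List.coe_toFinset, Set.mem_ofPred_eq] at hu hv
  rw [← (lastUpdate_spec (hL.lt _ ha u hu) ht).1, h, (lastUpdate_spec (hL.lt _ ha v hv) ht).1]

theorem card_window_le {a : List ℕ × ℕ} (ha : a.1.length = k) : (window n a).card ≤ k :=
  Finset.card_image_le.trans ((List.toFinset_card_le _).trans ha.le)

/-- Linearity forces two common times to have the same residue modulo `n`, and a window contains
each residue at most once. -/
theorem LinearEdges.card_inter_le (hL : LinearEdges n k Δ L) {a b : List ℕ × ℕ}
    (ha : a.1 ∈ L) (ht : n ≤ a.2) (hb : b.1 ∈ L) (ht' : n ≤ b.2) (hne : a.1 ≠ b.1) :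
    (window n a ∩ window n b).card ≤ 1 := by
  rw [Finset.card_le_one]
  intro x hx y hy
  rw [Finset.mem_inter, hL.mem_window ha ht, hL.mem_window hb ht'] at hx hy
  exact eq_of_mod_eq_of_window
    (hL.linear _ ha _ hb hne _ hx.1.1 hx.2.1 _ hy.1.1 hy.2.1) hx.1.2.1 hx.1.2.2 hy.1.2.1 hy.1.2.2

theorem LinearEdges.overlap_self (hL : LinearEdges n k Δ L) {a : List ℕ × ℕ}
    (ha : a ∈ timedEdges n L N) : Overlap n a a := by
  rw [mem_timedEdges] at ha
  have h : a.2 ∈ window n a := (hL.mem_window ha.1 ha.2.2.1).2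
    ⟨ha.2.2.2, le_rfl, by have := hL.lt _ ha.1 _ ha.2.2.2; omega⟩
  exact ⟨_, h, h⟩

/-- The timed versions of the hyperedge `l` whose window contains `x`. -/
def timedThrough (n x : ℕ) (l : List ℕ) : Finset (List ℕ × ℕ) :=
  l.toFinset.image fun u => (l, nextUpdate n x u)

theorem card_timedThrough_le {x : ℕ} {l : List ℕ} (h : l.length = k) :
    (timedThrough n x l).card ≤ k :=
  Finset.card_image_le.trans ((List.toFinset_card_le _).trans h.le)

/-- A time `t` whose window contains `x` satisfies `x ≤ t < x + n`. It is therefore determined by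
the vertex `t % n` of the hyperedge, which leaves at most `k` timed versions of each hyperedge. -/
theorem LinearEdges.mem_timedThrough (hL : LinearEdges n k Δ L) {a : List ℕ × ℕ}
    (ha : a ∈ timedEdges n L N) {x : ℕ} (hx : x ∈ window n a) : a ∈ timedThrough n x a.1 := by
  rw [mem_timedEdges] at ha
  rw [hL.mem_window ha.1 ha.2.2.1] at hx
  simp only [timedThrough, Finset.mem_image, List.mem_toFinset]
  exact ⟨a.2 % n, ha.2.2.2, by rw [← eq_nextUpdate hx.2.1 hx.2.2]⟩

theorem LinearEdges.exists_conflict_finset (hL : LinearEdges n k Δ L) {a : List ℕ × ℕ}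
    (ha : a ∈ timedEdges n L N) :
    ∃ M : Finset (List ℕ × ℕ), M.card ≤ k ^ 2 ∧ ∀ b ∈ timedEdges n L N, Conflict n a b → b ∈ M := by
  have ha' := mem_timedEdges.1 ha
  refine ⟨(window n a).biUnion fun x => timedThrough n x a.1, ?_, ?_⟩
  · rw [sq]
    refine (Finset.card_biUnion_le_card_mul _ _ k fun x _ =>
      card_timedThrough_le (hL.length _ ha'.1)).trans ?_
    gcongr
    exact card_window_le (hL.length _ ha'.1)
  · rintro b hb ⟨h1, x, hxa, hxb⟩
    refine Finset.mem_biUnion.2 ⟨x, hxa, ?_⟩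
    rw [h1]
    exact hL.mem_timedThrough hb hxb

theorem LinearEdges.exists_overlap_finset (hL : LinearEdges n k Δ L) {a : List ℕ × ℕ}
    (ha : a ∈ timedEdges n L N) :
    ∃ M : Finset (List ℕ × ℕ), M.card ≤ k ^ 2 * Δ ∧
      ∀ b ∈ timedEdges n L N, Overlap n a b → b ∈ M := by
  have ha' := mem_timedEdges.1 ha
  refine ⟨(window n a).biUnion fun x =>
    (L.toFinset.filter (x % n ∈ ·)).biUnion fun l => timedThrough n x l, ?_, ?_⟩
  · rw [show k ^ 2 * Δ = k * (Δ * k) by ring]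
    refine (Finset.card_biUnion_le_card_mul _ _ (Δ * k) fun x _ => ?_).trans ?_
    · refine (Finset.card_biUnion_le_card_mul _ _ k fun l hl => ?_).trans ?_
      · exact card_timedThrough_le (hL.length _ (by simpa using (Finset.mem_filter.1 hl).1))
      · gcongr
        exact hL.degree _
    · gcongr
      exact card_window_le (hL.length _ ha'.1)
  · rintro b hb ⟨x, hxa, hxb⟩
    have hb' := mem_timedEdges.1 hb
    refine Finset.mem_biUnion.2 ⟨x, hxa, Finset.mem_biUnion.2 ⟨b.1, ?_, hL.mem_timedThrough hb hxb⟩⟩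
    simp [hb'.1, ((hL.mem_window hb'.1 hb'.2.2.1).1 hxb).1]

/-- The three relations composed in `Linked` have degrees `k ^ 2`, `k ^ 2 * Δ` and `k ^ 2`. -/
theorem LinearEdges.exists_linked_finset (hL : LinearEdges n k Δ L) {a : List ℕ × ℕ}
    (ha : a ∈ timedEdges n L N) :
    ∃ M : Finset (List ℕ × ℕ), M.card ≤ k ^ 6 * Δ ∧
      ∀ b ∈ timedEdges n L N, Linked n (timedEdges n L N) a b → b ∈ M := by
  classical
  choose! P hP hP' using fun (a : List ℕ × ℕ) (ha : a ∈ timedEdges n L N) =>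
    hL.exists_conflict_finset ha
  choose! Q hQ hQ' using fun (a : List ℕ × ℕ) (ha : a ∈ timedEdges n L N) =>
    hL.exists_overlap_finset ha
  refine ⟨((P a).filter (· ∈ timedEdges n L N)).biUnion fun c =>
    ((Q c).filter (· ∈ timedEdges n L N)).biUnion fun d => P d, ?_, ?_⟩
  · rw [show k ^ 6 * Δ = k ^ 2 * (k ^ 2 * Δ * k ^ 2) by ring]
    refine (Finset.card_biUnion_le_card_mul _ _ (k ^ 2 * Δ * k ^ 2) fun c hc => ?_).trans ?_
    · refine (Finset.card_biUnion_le_card_mul _ _ (k ^ 2) fun d hd => ?_).trans ?_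
      · exact hP _ (Finset.mem_filter.1 hd).2
      · gcongr
        exact (Finset.card_filter_le _ _).trans (hQ _ (Finset.mem_filter.1 hc).2)
    · gcongr
      exact (Finset.card_filter_le _ _).trans (hP _ ha)
  · rintro b hb ⟨c, hc, d, hd, h1, h2, h3⟩
    exact Finset.mem_biUnion.2 ⟨c, Finset.mem_filter.2 ⟨hP' _ ha _ hc h1, hc⟩,
      Finset.mem_biUnion.2 ⟨d, Finset.mem_filter.2 ⟨hQ' _ hc _ hd h2, hd⟩, hP' _ hd _ hb h3⟩⟩

end

/-- When the sets are added one by one, a new set loses at most one element to each earlier one, and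
the total loss is at most the square of their number. The loss stands on the right to avoid
truncated subtraction. -/
theorem card_biUnion_ge {α β : Type*} [DecidableEq α] [DecidableEq β] {W : α → Finset β} {k : ℕ}
    (B : Finset α) (hk : ∀ a ∈ B, (W a).card = k)
    (hinter : ∀ a ∈ B, ∀ b ∈ B, a ≠ b → (W a ∩ W b).card ≤ 1) :
    k * B.card ≤ (B.biUnion W).card + B.card * B.card := by
  induction B using Finset.induction_on with
  | empty => simp
  | @insert b B hb ih =>
    have ih' := ih (fun a ha => hk a (by simp [ha]))
      (fun a ha c hc => hinter a (by simp [ha]) c (by simp [hc]))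
    rw [Finset.biUnion_insert, Finset.card_insert_of_notMem hb]
    have h1 : (W b ∩ B.biUnion W).card ≤ B.card := by
      rw [Finset.inter_biUnion]
      refine (Finset.card_biUnion_le_card_mul _ _ 1 fun a ha => ?_).trans (by simp)
      exact hinter b (by simp) a (by simp [ha]) (by rintro rfl; exact hb ha)
    have h2 := Finset.card_union_add_card_inter (W b) (B.biUnion W)
    rw [hk b (by simp)] at h2
    nlinarith

section

variable {n k Δ : ℕ} {L : List (List ℕ)} {N : ℕ}

/-- No two different elements of `C` are intersecting windows of the same hyperedge. -/
def ConflictFree (n : ℕ) (C : Finset (List ℕ × ℕ)) : Prop :=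
  ∀ a ∈ C, ∀ b ∈ C, Conflict n a b → a = b

/-- Overlapping pairs are linked, because every pair conflicts with itself; so windows from
different blocks are disjoint. Inside a block, conflict-freeness and linearity leave at most one
common time for any two windows. -/
theorem LinearEdges.card_biUnion_window_ge (hL : LinearEdges n k Δ L) {C : Finset (List ℕ × ℕ)}
    (hC : C ⊆ timedEdges n L N) (hcf : ConflictFree n C) {θ l : ℕ} {S : Finset (List ℕ × ℕ)}
    (hS : Sep (Linked n (timedEdges n L N)) θ l S) (hSC : S ⊆ C) :
    l * (θ * (k - θ)) ≤ (S.biUnion (window n)).card := by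
  induction hS with
  | zero => simp
  | @succ l S B hS hB hsep ih =>
    rw [Finset.union_subset_iff] at hSC
    have ih := ih hSC.1
    have hdisj : Disjoint (S.biUnion (window n)) (B.biUnion (window n)) := by
      rw [Finset.disjoint_biUnion_left]
      intro x hx
      rw [Finset.disjoint_biUnion_right]
      intro y hy
      rw [Finset.disjoint_left]
      intro z hzx hzy
      have hx' := hC (hSC.1 hx)
      have hy' := hC (hSC.2 hy)
      exact (hsep x hx y hy).2 ⟨x, hx', y, hy', ⟨rfl, hL.overlap_self hx'⟩, ⟨z, hzx, hzy⟩,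
        ⟨rfl, hL.overlap_self hy'⟩⟩
    have hBcard : θ * (k - θ) ≤ (B.biUnion (window n)).card := by
      have h := card_biUnion_ge (W := window n) (k := k) B
        (fun a ha => by
          have := mem_timedEdges.1 (hC (hSC.2 ha))
          exact hL.card_window this.1 this.2.2.1)
        (fun a ha b hb hab => by
          have ha' := mem_timedEdges.1 (hC (hSC.2 ha))
          have hb' := mem_timedEdges.1 (hC (hSC.2 hb))
          by_cases h : a.1 = b.1
          · rw [Finset.card_le_one]
            intro x hx
            rw [Finset.mem_inter] at hx
            exact absurd (hcf a (hSC.2 ha) b (hSC.2 hb) ⟨h, x, hx⟩) hab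
          · exact hL.card_inter_le ha'.1 ha'.2.2.1 hb'.1 hb'.2.2.1 h)
      rw [hB] at h
      rw [Nat.mul_sub, mul_comm θ k]
      omega
    rw [Finset.union_biUnion, Finset.card_union_of_disjoint hdisj, add_mul, one_mul]
    omega

/-- `C` is a connected set of timed hyperedges containing `a` all of whose windows are contained
in `r`. -/
structure IsCluster (n : ℕ) (L : List (List ℕ)) (N : ℕ) (r : Finset ℕ) (a : List ℕ × ℕ)
    (C : Finset (List ℕ × ℕ)) : Prop where
  subset : C ⊆ timedEdges n L N
  root_mem : a ∈ C
  isOpen : ∀ c ∈ C, window n c ⊆ r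
  connected : ∀ c ∈ C, Relation.ReflTransGen (fun u v => Overlap n u v ∧ v ∈ C) a c

/-- Take a maximal conflict-free subset containing the root. Every discarded pair conflicts with a
kept one, and a kept pair represents at most `k ^ 2` pairs. An overlap of two pairs becomes a link
of their representatives, which is why `Linked` allows a conflict at both ends. -/
theorem LinearEdges.exists_conflictFree (hL : LinearEdges n k Δ L) {r : Finset ℕ}
    {a : List ℕ × ℕ} {C : Finset (List ℕ × ℕ)} (hC : IsCluster n L N r a C) :
    ∃ C' ⊆ C, a ∈ C' ∧ ConflictFree n C' ∧ C.card ≤ C'.card * k ^ 2 ∧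
      ∀ x ∈ C', Relation.ReflTransGen
        (fun u v => Linked n (timedEdges n L N) u v ∧ v ∈ C') a x := by
  classical
  have hself : ∀ {c}, c ∈ C → Conflict n c c := fun hc => ⟨rfl, hL.overlap_self (hC.subset hc)⟩
  have hsymm : ∀ {c d}, Conflict n c d → Conflict n d c :=
    fun ⟨h, x, h1, h2⟩ => ⟨h.symm, x, h2, h1⟩
  obtain ⟨C', -, hmax⟩ := (C.powerset.filter fun S => a ∈ S ∧ ConflictFree n S).exists_le_maximal
    (a := {a}) (by
      simp only [Finset.mem_filter, Finset.mem_powerset, Finset.singleton_subset_iff,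
        Finset.mem_singleton, true_and]
      refine ⟨hC.root_mem, fun b hb c hc _ => ?_⟩
      rw [Finset.mem_singleton.1 hb, Finset.mem_singleton.1 hc])
  have hC' := hmax.prop
  simp only [Finset.mem_filter, Finset.mem_powerset] at hC'
  obtain ⟨hsub, haC', hcf⟩ := hC'
  have hrep : ∀ c ∈ C, ∃ c' ∈ C', Conflict n c' c := by
    intro c hc
    by_contra! hno
    have hins : insert c C' ∈ C.powerset.filter fun S => a ∈ S ∧ ConflictFree n S := by
      simp only [Finset.mem_filter, Finset.mem_powerset]
      refine ⟨Finset.insert_subset hc hsub, Finset.mem_insert_of_mem haC', ?_⟩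
      intro x hx y hy hxy
      rw [Finset.mem_insert] at hx hy
      rcases hx with rfl | hx <;> rcases hy with rfl | hy
      · rfl
      · exact absurd (hsymm hxy) (hno _ hy)
      · exact absurd hxy (hno _ hx)
      · exact hcf _ hx _ hy hxy
    have := hmax.le_of_ge hins (Finset.subset_insert _ _) (Finset.mem_insert_self c C')
    exact hno c this (hself hc)
  refine ⟨C', hsub, haC', hcf, ?_, ?_⟩
  · choose! P hP hP' using fun (a : List ℕ × ℕ) (ha : a ∈ timedEdges n L N) =>
      hL.exists_conflict_finset ha
    refine (Finset.card_le_card (t := C'.biUnion P) fun c hc => ?_).trans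
      (Finset.card_biUnion_le_card_mul _ _ _ fun c hc => hP _ (hC.subset (hsub hc)))
    obtain ⟨c', hc', h⟩ := hrep c hc
    exact Finset.mem_biUnion.2 ⟨c', hc', hP' _ (hC.subset (hsub hc')) _ (hC.subset hc) h⟩
  -- All representatives `c'` of `c` have to be treated, since consecutive steps may meet different
  -- ones. The only representative of the root is the root itself.
  · have key : ∀ c, Relation.ReflTransGen (fun u v => Overlap n u v ∧ v ∈ C) a c → ∀ c' ∈ C',
        Conflict n c' c → Relation.ReflTransGen
          (fun u v => Linked n (timedEdges n L N) u v ∧ v ∈ C') a c' := by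
      intro c hc
      induction hc with
      | refl =>
        intro c' hc' h
        rw [hcf c' hc' a haC' h]
      | @tail b c hab hbc ih =>
        intro c' hc' h
        have hb : b ∈ C := by
          rcases hab.cases_tail with h | ⟨_, _, h⟩
          · rw [h]; exact hC.root_mem
          · exact h.2
        obtain ⟨b', hb', hbb⟩ := hrep b hb
        exact (ih b' hb' hbb).tail ⟨⟨b, hC.subset hb, c, hC.subset hbc.2, hbb, hbc.1, hsymm h⟩, hc'⟩
    exact fun x hx => key x (hC.connected x (hsub hx)) x hx (hself (hsub hx))

/-- With fair bits, all bits in `U` are `1` with probability at most `2 ^ (-U.card)`; the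
probability is zero if `U` leaves the range. -/
theorem card_superset_mul {M : ℕ} (U : Finset ℕ) :
    ((Finset.range M).powerset.filter (U ⊆ ·)).card * 2 ^ U.card ≤ 2 ^ M := by
  by_cases hU : U ⊆ Finset.range M
  · have : (Finset.range M).powerset.filter (U ⊆ ·) = Finset.Icc U (Finset.range M) := by
      ext r; simp [and_comm]
    rw [this, Finset.card_Icc_finset hU, ← pow_add, Finset.card_range]
    have := Finset.card_le_card hU
    rw [Finset.card_range] at this
    rw [Nat.sub_add_cancel this]
  · rw [Finset.filter_false_of_mem]
    · simp
    · intro r hr h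
      exact hU (h.trans (Finset.mem_powerset.1 hr))

/-- The number of bits choices with a large open cluster at a given root. -/
theorem LinearEdges.card_cluster_root (hL : LinearEdges n k Δ L) {θ : ℕ} (hθ : 0 < θ) (l : ℕ)
    (a : List ℕ × ℕ) (bad : Finset (Finset ℕ)) (hbad : ∀ r ∈ bad, r ⊆ Finset.range N ∧
      ∃ C, IsCluster n L N r a C ∧
        k ^ 2 * ((1 + k ^ 6 * Δ * θ) * (1 + l * θ * (k ^ 6 * Δ + 1))) < C.card) :
    bad.card * 2 ^ (l * (θ * (k - θ))) ≤
      (3 * (k ^ 6 * Δ + 1)) ^ (l * (θ + 1) + 1) * 2 ^ (l * (θ + 1) + 1) * 2 ^ N := by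
  classical
  set Ω := timedEdges n L N
  set F := Ω.powerset.filter fun T =>
    Grow (Linked n Ω) a T ∧ T.card ≤ l * (θ + 1) + 1 with hF
  -- The blocks `S` alone need not be connected. They are counted as subsets of a connected set `T`,
  -- which costs only the factor `2 ^ T.card`.
  set G : Finset (Finset (List ℕ × ℕ)) := F.biUnion fun T => T.powerset.filter fun S =>
    l * (θ * (k - θ)) ≤ (S.biUnion (window n)).card with hG
  have hFcard : F.card ≤ (3 * (k ^ 6 * Δ + 1)) ^ (l * (θ + 1) + 1) := by
    refine card_grow_le (adj := Linked n Ω) (a := a) (Ω := Ω)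
      (fun x hx => hL.exists_linked_finset hx) F fun S hS => ?_
    simp only [hF, Finset.mem_filter, Finset.mem_powerset] at hS
    exact ⟨hS.2.1, hS.1, hS.2.2⟩
  have hGcard : G.card ≤ (3 * (k ^ 6 * Δ + 1)) ^ (l * (θ + 1) + 1) * 2 ^ (l * (θ + 1) + 1) := by
    refine (Finset.card_biUnion_le_card_mul _ _ (2 ^ (l * (θ + 1) + 1)) fun T hT => ?_).trans
      (Nat.mul_le_mul_right _ hFcard)
    simp only [hF, Finset.mem_filter] at hT
    refine (Finset.card_filter_le _ _).trans ?_
    rw [Finset.card_powerset]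
    exact Nat.pow_le_pow_right (by norm_num) hT.2.2
  -- Union bound: every exceptional assignment of bits has only ones on the windows of some family
  -- `S` in `G`.
  have hcover : bad ⊆ G.biUnion fun S =>
      (Finset.range N).powerset.filter (S.biUnion (window n) ⊆ ·) := by
    intro r hr
    obtain ⟨hrN, C, hC, hCcard⟩ := hbad r hr
    obtain ⟨C', hsub, haC', hcf, hcard, hconn⟩ := hL.exists_conflictFree hC
    have hCΩ : C' ⊆ Ω := hsub.trans hC.subset
    have hC'card : (1 + k ^ 6 * Δ * θ) * (1 + l * θ * (k ^ 6 * Δ + 1)) < C'.card := by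
      have h := lt_of_lt_of_le hCcard hcard
      rw [mul_comm (C'.card)] at h
      exact lt_of_mul_lt_mul_left h (Nat.zero_le _)
    obtain ⟨T, S, hST, hTC, hT, hTcard, hS⟩ := exists_separated_blocks hθ haC'
      (fun x hx => by
        obtain ⟨M, hM, hM'⟩ := hL.exists_linked_finset (hCΩ hx)
        exact ⟨M, hM, fun y hy => hM' y (hCΩ hy)⟩) hconn l hC'card
    refine Finset.mem_biUnion.2 ⟨S, Finset.mem_biUnion.2 ⟨T, ?_, ?_⟩, ?_⟩
    · simp only [hF, Finset.mem_filter, Finset.mem_powerset]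
      exact ⟨hTC.trans hCΩ, hT, hTcard⟩
    · simp only [Finset.mem_filter, Finset.mem_powerset]
      exact ⟨hST, hL.card_biUnion_window_ge hCΩ hcf hS (hST.trans hTC)⟩
    · simp only [Finset.mem_filter, Finset.mem_powerset]
      exact ⟨hrN, Finset.biUnion_subset.2 fun c hc => hC.isOpen c (hsub (hTC (hST hc)))⟩
  have hterm : ∀ S ∈ G, ((Finset.range N).powerset.filter (S.biUnion (window n) ⊆ ·)).card *
      2 ^ (l * (θ * (k - θ))) ≤ 2 ^ N := by
    intro S hS
    simp only [hG, Finset.mem_biUnion, Finset.mem_filter] at hS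
    obtain ⟨T, _, _, h⟩ := hS
    refine le_trans ?_ (card_superset_mul (M := N) (S.biUnion (window n)))
    gcongr
    norm_num
  calc bad.card * 2 ^ (l * (θ * (k - θ)))
      ≤ (∑ S ∈ G, ((Finset.range N).powerset.filter (S.biUnion (window n) ⊆ ·)).card) *
          2 ^ (l * (θ * (k - θ))) := by
        gcongr
        exact (Finset.card_le_card hcover).trans Finset.card_biUnion_le
    _ = ∑ S ∈ G, ((Finset.range N).powerset.filter (S.biUnion (window n) ⊆ ·)).card *
          2 ^ (l * (θ * (k - θ))) := Finset.sum_mul _ _ _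
    _ ≤ G.card * 2 ^ N := by
        rw [← smul_eq_mul]
        exact Finset.sum_le_card_nsmul _ _ _ hterm
    _ ≤ _ := by gcongr

/-- The number of bits choices with a large open cluster at the time `t₀`. -/
theorem LinearEdges.card_cluster (hL : LinearEdges n k Δ L) {θ : ℕ} (hθ : 0 < θ) (l t₀ : ℕ)
    (bad : Finset (Finset ℕ)) (hbad : ∀ r ∈ bad, r ⊆ Finset.range N ∧
      ∃ a C, a.2 = t₀ ∧ IsCluster n L N r a C ∧
        k ^ 2 * ((1 + k ^ 6 * Δ * θ) * (1 + l * θ * (k ^ 6 * Δ + 1))) < C.card) :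
    bad.card * 2 ^ (l * (θ * (k - θ))) ≤ Δ *
      ((3 * (k ^ 6 * Δ + 1)) ^ (l * (θ + 1) + 1) * 2 ^ (l * (θ + 1) + 1) * 2 ^ N) := by
  classical
  set R := L.toFinset.filter (t₀ % n ∈ ·)
  let B : List ℕ → Finset (Finset ℕ) := fun e => bad.filter fun r =>
    ∃ C, IsCluster n L N r (e, t₀) C ∧
        k ^ 2 * ((1 + k ^ 6 * Δ * θ) * (1 + l * θ * (k ^ 6 * Δ + 1))) < C.card
  have hcover : bad ⊆ R.biUnion B := by
    intro r hr
    obtain ⟨_, a, C, rfl, hC, hcard⟩ := hbad r hr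
    have ha := mem_timedEdges.1 (hC.subset hC.root_mem)
    refine Finset.mem_biUnion.2 ⟨a.1, by simp [R, ha.1, ha.2.2.2], ?_⟩
    exact Finset.mem_filter.2 ⟨hr, C, hC, hcard⟩
  calc bad.card * 2 ^ (l * (θ * (k - θ)))
      ≤ (∑ e ∈ R, (B e).card) * 2 ^ (l * (θ * (k - θ))) := by
        gcongr
        exact (Finset.card_le_card hcover).trans Finset.card_biUnion_le
    _ = ∑ e ∈ R, (B e).card * 2 ^ (l * (θ * (k - θ))) := Finset.sum_mul _ _ _
    _ ≤ R.card * ((3 * (k ^ 6 * Δ + 1)) ^ (l * (θ + 1) + 1) * 2 ^ (l * (θ + 1) + 1) * 2 ^ N) := by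
        rw [← smul_eq_mul R.card]
        refine Finset.sum_le_card_nsmul _ _ _ fun e _ => ?_
        refine hL.card_cluster_root hθ l (e, t₀) (B e) fun r hr => ?_
        have hr := Finset.mem_filter.1 hr
        exact ⟨(hbad r hr.1).1, hr.2⟩
    _ ≤ _ := by
        gcongr
        exact hL.degree _

end

end Percolation

/-! ### The systematic scan: stationarity and dependence on the past. -/

namespace Glauber

open Percolation

/-- `X` contains no hyperedge of the list `L`. -/
def Indep (L : List (List ℕ)) (X : Finset ℕ) : Prop := ∀ l ∈ L, ∃ w ∈ l, w ∉ X

instance (L : List (List ℕ)) (X : Finset ℕ) : Decidable (Indep L X) := by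
  unfold Indep; infer_instance

/-- The independent sets of the hypergraph on `0, …, n - 1` with hyperedges `L`. -/
def indepSets (n : ℕ) (L : List (List ℕ)) : Finset (Finset ℕ) :=
  (Finset.range n).powerset.filter (Indep L)

/-- One heat-bath update at the vertex `u` with the random bit `b`. -/
def step (L : List (List ℕ)) (X : Finset ℕ) (u : ℕ) (b : Bool) : Finset ℕ :=
  if b = true ∧ Indep L (insert u X) then insert u X else X.erase u

/-- The systematic scan started in `X`: the update at time `t` concerns the vertex `t % n` and uses
the bit `t ∈ r`. -/
def conf (n : ℕ) (L : List (List ℕ)) (X r : Finset ℕ) : ℕ → Finset ℕ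
  | 0 => X
  | t + 1 => step L (conf n L X r t) (t % n) (decide (t ∈ r))

variable {n : ℕ} {L : List (List ℕ)}

theorem mem_indepSets {X : Finset ℕ} :
    X ∈ indepSets n L ↔ X ⊆ Finset.range n ∧ Indep L X := by
  simp [indepSets]

theorem Indep.mono {X Y : Finset ℕ} (hY : Indep L Y) (h : X ⊆ Y) : Indep L X := fun l hl => by
  obtain ⟨w, hw, hwY⟩ := hY l hl
  exact ⟨w, hw, fun hwX => hwY (h hwX)⟩

theorem Indep.step {X : Finset ℕ} (hX : Indep L X) (u : ℕ) (b : Bool) :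
    Indep L (step L X u b) := by
  unfold Glauber.step
  split_ifs with h
  · exact h.2
  · exact hX.mono (Finset.erase_subset _ _)

theorem Indep.conf {X : Finset ℕ} (hX : Indep L X) (r : Finset ℕ) (t : ℕ) :
    Indep L (conf n L X r t) := by
  induction t with
  | zero => exact hX
  | succ t ih => exact ih.step _ _

theorem conf_congr {X r r' : Finset ℕ} {t : ℕ} (h : ∀ x < t, x ∈ r ↔ x ∈ r') :
    conf n L X r t = conf n L X r' t := by
  induction t with
  | zero => rfl
  | succ t ih =>
    simp only [conf]
    rw [ih fun x hx => h x (by omega)]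
    simp only [h t (by omega)]

/-- Resampling the vertex `u` with the complementary bit. -/
def toggle (L : List (List ℕ)) (u : ℕ) (X : Finset ℕ) : Finset ℕ :=
  if u ∈ X then X.erase u else if Indep L (insert u X) then insert u X else X

theorem toggle_mem {X : Finset ℕ} {u : ℕ} (hu : u < n) (hX : X ∈ indepSets n L) :
    toggle L u X ∈ indepSets n L := by
  rw [mem_indepSets] at hX ⊢
  unfold toggle
  split_ifs with h1 h2
  · exact ⟨(Finset.erase_subset _ _).trans hX.1, hX.2.mono (Finset.erase_subset _ _)⟩
  · exact ⟨Finset.insert_subset (Finset.mem_range.2 hu) hX.1, h2⟩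
  · exact hX

theorem toggle_toggle {X : Finset ℕ} {u : ℕ} (hX : X ∈ indepSets n L) :
    toggle L u (toggle L u X) = X := by
  rw [mem_indepSets] at hX
  by_cases h1 : u ∈ X
  · have : toggle L u X = X.erase u := by simp [toggle, h1]
    rw [this, toggle, if_neg (by simp), Finset.insert_erase h1, if_pos hX.2]
  · by_cases h2 : Indep L (insert u X)
    · have : toggle L u X = insert u X := by simp [toggle, h1, h2]
      rw [this, toggle, if_pos (by simp), Finset.erase_insert h1]
    · have : toggle L u X = X := by simp [toggle, h1, h2]
      rw [this, this]

/-- The two bits lead to `X` and to `toggle L u X`, in one order or the other. As `toggle L u` is an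
involution of the independent sets, stationarity follows. -/
theorem step_add_step (g : Finset ℕ → ℕ) {X : Finset ℕ} (u : ℕ) (hX : Indep L X) :
    g (step L X u false) + g (step L X u true) = g X + g (toggle L u X) := by
  by_cases h1 : u ∈ X
  · simp [step, toggle, h1, hX, Finset.insert_eq_of_mem, add_comm]
  · by_cases h2 : Indep L (insert u X) <;> simp [step, toggle, h1, h2]

/-- The uniform distribution on the independent sets is stationary. -/
theorem sum_conf (hn : 0 < n) (t : ℕ) (g : Finset ℕ → ℕ) :
    ∑ X ∈ indepSets n L, ∑ r ∈ (Finset.range t).powerset, g (conf n L X r t) =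
      2 ^ t * ∑ Y ∈ indepSets n L, g Y := by
  induction t generalizing g with
  | zero => simp [conf]
  | succ t ih =>
    have h1 : ∀ X ∈ indepSets n L,
        ∑ r ∈ (Finset.range (t + 1)).powerset, g (conf n L X r (t + 1)) =
        ∑ r ∈ (Finset.range t).powerset, (fun Y => g Y + g (toggle L (t % n) Y))
          (conf n L X r t) := by
      intro X hX
      rw [Finset.range_add_one, Finset.sum_powerset_insert (by simp), ← Finset.sum_add_distrib]
      refine Finset.sum_congr rfl fun r hr => ?_
      have ht : t ∉ r := fun h => by simpa using Finset.mem_powerset.1 hr h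
      have h3 := step_add_step g (t % n) ((mem_indepSets.1 hX).2.conf (n := n) r t)
      have h2 : conf n L X (insert t r) t = conf n L X r t :=
        conf_congr fun x hx => by simp [hx.ne]
      simpa [conf, ht, h2] using h3
    rw [Finset.sum_congr rfl h1, ih fun Y => g Y + g (toggle L (t % n) Y),
      Finset.sum_add_distrib]
    have h2 : ∑ Y ∈ indepSets n L, g (toggle L (t % n) Y) = ∑ Y ∈ indepSets n L, g Y :=
      Finset.sum_nbij' (toggle L (t % n)) (toggle L (t % n))
        (fun X hX => toggle_mem (Nat.mod_lt _ hn) hX) (fun X hX => toggle_mem (Nat.mod_lt _ hn) hX)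
        (fun X hX => toggle_toggle hX) (fun X hX => toggle_toggle hX) (fun X hX => rfl)
    rw [h2]; ring

theorem mem_step_self {X : Finset ℕ} {u : ℕ} {b : Bool} :
    u ∈ step L X u b ↔ b = true ∧ Indep L (insert u X) := by
  unfold step
  split_ifs with h <;> simp [h]

theorem mem_step_of_ne {X : Finset ℕ} {u w : ℕ} {b : Bool} (h : w ≠ u) :
    w ∈ step L X u b ↔ w ∈ X := by
  unfold step
  split_ifs <;> simp [h]

theorem mem_conf_succ_self {X r : Finset ℕ} {t : ℕ} :
    t % n ∈ conf n L X r (t + 1) ↔ t ∈ r ∧ Indep L (insert (t % n) (conf n L X r t)) := by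
  rw [conf, mem_step_self]; simp

theorem mem_conf_iff {X r : Finset ℕ} {x t : ℕ} (hxt : x < t) (htx : t ≤ x + n) :
    x % n ∈ conf n L X r t ↔ x % n ∈ conf n L X r (x + 1) := by
  induction t, (show x + 1 ≤ t from hxt) using Nat.le_induction with
  | base => rfl
  | succ t ht ih =>
    rw [conf, mem_step_of_ne, ih (by omega) (by omega)]
    intro h
    have := eq_of_mod_eq_of_window (t := t) h (by omega) (by omega) le_rfl (by omega)
    omega

theorem indep_insert_iff {X : Finset ℕ} {u : ℕ} (hX : Indep L X) :
    Indep L (insert u X) ↔ ∀ l ∈ L, u ∈ l → ∃ w ∈ l, w ≠ u ∧ w ∉ X := by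
  constructor
  · intro h l hl _
    obtain ⟨w, hw, hwX⟩ := h l hl
    rw [Finset.mem_insert, not_or] at hwX
    exact ⟨w, hw, hwX⟩
  · intro h l hl
    by_cases hu : u ∈ l
    · obtain ⟨w, hw, hwX⟩ := h l hl hu
      exact ⟨w, hw, by rwa [Finset.mem_insert, not_or]⟩
    · obtain ⟨w, hw, hwX⟩ := hX l hl
      refine ⟨w, hw, ?_⟩
      rw [Finset.mem_insert, not_or]
      exact ⟨by rintro rfl; exact hu hw, hwX⟩

/-- Two runs of the scan agree at the active times if the active times are closed under the
dependencies that are not cut off by a zero bit. -/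
theorem mem_conf_congr {k Δ : ℕ} (hL : LinearEdges n k Δ L) {X Y r r' act : Finset ℕ}
    (hX : Indep L X) (hY : Indep L Y) (hact : ∀ t ∈ act, n ≤ t ∧ t ∈ r ∧ t ∈ r')
    (hclosed : ∀ t ∈ act, ∀ l ∈ L, t % n ∈ l → window n (l, t) ⊆ act ∨
      ∃ x ∈ window n (l, t), x ∉ r ∧ x ∉ r') {t : ℕ} (ht : t ∈ act) :
    t % n ∈ conf n L X r (t + 1) ↔ t % n ∈ conf n L Y r' (t + 1) := by
  induction t using Nat.strong_induction_on with
  | _ t ih =>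
    obtain ⟨hnt, htr, htr'⟩ := hact t ht
    rw [mem_conf_succ_self, mem_conf_succ_self, indep_insert_iff (hX.conf r t),
      indep_insert_iff (hY.conf r' t)]
    simp only [htr, htr', true_and]
    refine forall₃_congr fun l hl htl => ?_
    have hmem : ∀ x, x ∈ window n (l, t) ↔ x % n ∈ l ∧ x ≤ t ∧ t < x + n :=
      fun x => hL.mem_window (a := (l, t)) hl hnt
    -- If the whole window is active, the states of the other vertices agree by induction, as they
    -- were last updated at earlier active times. Otherwise the common zero bit at `x` leaves `x %
    -- n` unoccupied in both runs, and `l` blocks neither update.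
    rcases hclosed t ht l hl htl with h | ⟨x, hx, hxr, hxr'⟩
    · refine exists_congr fun w => and_congr_right fun hw => and_congr_right fun hwt => ?_
      obtain ⟨h1, h2, h3⟩ := lastUpdate_spec (hL.lt l hl w hw) hnt
      set x := lastUpdate n t w
      have hxt : x < t := lt_of_le_of_ne h2 (by rintro h; rw [h] at h1; exact hwt h1.symm)
      have hxa : x ∈ act := h ((hmem x).2 ⟨by rwa [h1], h2, h3⟩)
      rw [← h1, mem_conf_iff hxt (by omega), mem_conf_iff hxt (by omega), ih x hxt hxa]
    · have hx' := (hmem x).1 hx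
      have hxt : x < t := lt_of_le_of_ne hx'.2.1 (by rintro rfl; exact hxr htr)
      have hne : x % n ≠ t % n := fun h => hxt.ne
        (eq_of_mod_eq_of_window h hx'.2.1 hx'.2.2 le_rfl (by omega))
      refine iff_of_true ⟨x % n, hx'.1, hne, ?_⟩ ⟨x % n, hx'.1, hne, ?_⟩
      · rw [mem_conf_iff hxt (by omega), mem_conf_succ_self]; simp [hxr]
      · rw [mem_conf_iff hxt (by omega), mem_conf_succ_self]; simp [hxr']

/-- Replacing the stationary initial state and masking bits changes the marginal of a vertex by at
most the fraction of exceptional bits. -/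
theorem abs_sub_le_of_agree (hn : 0 < n) (i T : ℕ) (bad : Finset (Finset ℕ))
    (mask : Finset ℕ → Finset ℕ)
    (h : ∀ r ∈ (Finset.range T).powerset, r ∉ bad → ∀ X ∈ indepSets n L,
      (i ∈ conf n L X r T ↔ i ∈ conf n L ∅ (mask r) T)) :
    |(2 : ℝ) ^ T * ((indepSets n L).filter (i ∉ ·)).card -
      (indepSets n L).card *
        ((Finset.range T).powerset.filter fun r => i ∉ conf n L ∅ (mask r) T).card| ≤
      (indepSets n L).card * bad.card := by
  have h1 := sum_conf (L := L) hn T fun Y => if i ∉ Y then 1 else 0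
  rw [← Finset.card_filter] at h1
  have h2 : (2 : ℝ) ^ T * ((indepSets n L).filter (i ∉ ·)).card =
      ∑ X ∈ indepSets n L, ∑ r ∈ (Finset.range T).powerset,
        if i ∉ conf n L X r T then (1 : ℝ) else 0 := by
    have := congrArg (Nat.cast (R := ℝ)) h1
    push_cast at this
    exact this.symm
  have h3 : ((indepSets n L).card : ℝ) *
        ((Finset.range T).powerset.filter fun r => i ∉ conf n L ∅ (mask r) T).card =
      ∑ X ∈ indepSets n L, ∑ r ∈ (Finset.range T).powerset,
        if i ∉ conf n L ∅ (mask r) T then (1 : ℝ) else 0 := by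
    rw [Finset.sum_const, nsmul_eq_mul, Finset.card_filter]
    push_cast
    rfl
  rw [h2, h3, ← Finset.sum_sub_distrib]
  refine (Finset.abs_sum_le_sum_abs _ _).trans ?_
  rw [← nsmul_eq_mul]
  refine Finset.sum_le_card_nsmul _ _ _ fun X hX => ?_
  rw [← Finset.sum_sub_distrib]
  refine (Finset.abs_sum_le_sum_abs _ _).trans ?_
  calc ∑ r ∈ (Finset.range T).powerset, |(if i ∉ conf n L X r T then (1 : ℝ) else 0) -
        if i ∉ conf n L ∅ (mask r) T then (1 : ℝ) else 0|
      ≤ ∑ r ∈ (Finset.range T).powerset, if r ∈ bad then (1 : ℝ) else 0 := by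
        refine Finset.sum_le_sum fun r hr => ?_
        by_cases hb : r ∈ bad
        · rw [if_pos hb]; split_ifs <;> simp
        · rw [if_neg hb]
          have := h r hr hb X hX
          simp only [this, sub_self, abs_zero, le_refl]
    _ = (((Finset.range T).powerset.filter (· ∈ bad)).card : ℝ) := by
        rw [Finset.card_filter]; push_cast; rfl
    _ ≤ bad.card := by
        exact_mod_cast Finset.card_le_card fun r hr => (Finset.mem_filter.1 hr).2

end Glauber

/-! ### The backward exploration of the dependencies and its invariants. -/

namespace Exploration

open Percolation Glauber

/-- A partially revealed assignment of bits to times: `K x` is `0` if `x` is unknown, `1` or `2` if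
the bit of `x` is known to be `0` or `1`, and `3` if `x` is moreover active. The list `ord` contains
the known times, the last one first. -/
structure Known where
  K : ℕ → ℕ
  ord : List ℕ

/-- Answers queries of bits; it is given the list of previous queries. -/
abbrev Oracle := List ℕ → ℕ → Bool

/-- Reveal the bit of `x` unless it is known. -/
def reveal (f : Oracle) (σ : Known) (x : ℕ) : Known :=
  if σ.K x = 0 then ⟨Function.update σ.K x ((f σ.ord x).toNat + 1), x :: σ.ord⟩ else σ

/-- Make all times in `xs` active if all their bits are known to be `1`. -/
def activate (xs : List ℕ) (σ : Known) : Known :=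
  if ∀ x ∈ xs, 2 ≤ σ.K x then ⟨fun y => if y ∈ xs then 3 else σ.K y, σ.ord⟩ else σ

/-- Reveal the window of the hyperedge `l` at the time `t`. -/
def expandEdge (f : Oracle) (n t : ℕ) (σ : Known) (l : List ℕ) : Known :=
  if t % n ∈ l then
    activate (l.map (lastUpdate n t)) ((l.map (lastUpdate n t)).foldl (reveal f) σ)
  else σ

/-- Reveal all windows at an active time. -/
def expand (f : Oracle) (n : ℕ) (L : List (List ℕ)) (σ : Known) (t : ℕ) : Known :=
  if σ.K t = 3 then L.foldl (expandEdge f n t) σ else σ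

/-- Expand the times `n + m - 1, …, n` in this order. -/
def sweep (f : Oracle) (n : ℕ) (L : List (List ℕ)) : ℕ → Known → Known
  | 0, σ => σ
  | m + 1, σ => sweep f n L m (expand f n L σ (n + m))

/-- Reveal the root `t₀`, which becomes active if its bit is `1`. -/
def start (f : Oracle) (t₀ : ℕ) : Known := activate [t₀] (reveal f ⟨fun _ => 0, []⟩ t₀)

/-- The exploration of the dependencies of the update at the time `t₀`. -/
def explore (f : Oracle) (n : ℕ) (L : List (List ℕ)) (t₀ : ℕ) : Known :=
  sweep f n L (t₀ + 1 - n) (start f t₀)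

/-! ### Dependence on the oracle -/

/-- Two oracles give the same answers to the queries in the list. -/
def Agree (f g : Oracle) (ord : List ℕ) : Prop :=
  ∀ x rest, (x :: rest) <:+ ord → f rest x = g rest x

theorem Agree.mono {f g : Oracle} {o o' : List ℕ} (h : Agree f g o') (ho : o <:+ o') :
    Agree f g o := fun x rest hx => h x rest (hx.trans ho)

/-- An operation that uses the oracle only through the queries it records. -/
structure Faithful (O : Oracle → Known → Known) : Prop where
  suffix : ∀ f σ, σ.ord <:+ (O f σ).ord
  congr : ∀ f g σ, Agree f g (O f σ).ord → O g σ = O f σ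

theorem faithful_reveal (x : ℕ) : Faithful fun f σ => reveal f σ x where
  suffix f σ := by
    unfold reveal; split_ifs
    · exact List.suffix_cons _ _
    · exact List.suffix_rfl
  congr f g σ h := by
    simp only [reveal] at h ⊢
    split_ifs at h ⊢ with h1
    · rw [h x σ.ord List.suffix_rfl]
    · rfl

theorem faithful_const (A : Known → Known) (hA : ∀ σ, (A σ).ord = σ.ord) :
    Faithful fun _ σ => A σ where
  suffix _ σ := by rw [hA]
  congr _ _ _ _ := rfl

theorem Faithful.comp {O O' : Oracle → Known → Known} (hO : Faithful O) (hO' : Faithful O') :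
    Faithful fun f σ => O' f (O f σ) where
  suffix f σ := (hO.suffix f σ).trans (hO'.suffix f _)
  congr f g σ h := by
    rw [hO.congr f g σ (h.mono (hO'.suffix _ _))]
    exact hO'.congr f g _ h

theorem Faithful.foldl {ι : Type*} {O : ι → Oracle → Known → Known} (hO : ∀ i, Faithful (O i))
    (xs : List ι) : Faithful fun f σ => xs.foldl (fun σ i => O i f σ) σ := by
  induction xs with
  | nil => exact faithful_const id fun _ => rfl
  | cons x xs ih => exact (hO x).comp ih

theorem Faithful.ite {O : Oracle → Known → Known} (p : Known → Prop) [DecidablePred p]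
    (hO : Faithful O) : Faithful fun f σ => if p σ then O f σ else σ where
  suffix f σ := by
    split_ifs
    · exact hO.suffix f σ
    · exact List.suffix_rfl
  congr f g σ h := by
    split_ifs at h ⊢ with h1
    · exact hO.congr f g σ h
    · rfl

theorem activate_ord (xs : List ℕ) (σ : Known) : (activate xs σ).ord = σ.ord := by
  unfold activate; split_ifs <;> rfl

theorem faithful_expand (n : ℕ) (L : List (List ℕ)) (t : ℕ) :
    Faithful fun f σ => expand f n L σ t := by
  refine Faithful.ite (fun σ => σ.K t = 3) (Faithful.foldl (O := fun l f σ => expandEdge f n t σ l)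
    (fun l => Faithful.ite (fun _ => t % n ∈ l) (Faithful.comp ?_
      (faithful_const _ (activate_ord _)))) L)
  exact Faithful.foldl (O := fun x f σ => reveal f σ x) faithful_reveal _

theorem faithful_sweep (n : ℕ) (L : List (List ℕ)) (m : ℕ) :
    Faithful fun f σ => sweep f n L m σ := by
  induction m with
  | zero => exact faithful_const id fun _ => rfl
  | succ m ih => exact (faithful_expand n L (n + m)).comp ih

theorem faithful_explore (n : ℕ) (L : List (List ℕ)) (t₀ : ℕ) :
    Faithful fun f σ => sweep f n L (t₀ + 1 - n) (activate [t₀] (reveal f σ t₀)) :=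
  ((faithful_reveal t₀).comp (faithful_const _ (activate_ord _))).comp (faithful_sweep n L _)

theorem explore_congr {f g : Oracle} {n : ℕ} {L : List (List ℕ)} {t₀ : ℕ}
    (h : Agree f g (explore f n L t₀).ord) : explore g n L t₀ = explore f n L t₀ :=
  (faithful_explore n L t₀).congr f g _ h

/-! ### Invariants -/

/-- The basic consistency of a state with bits `r` and the times up to `t₀`. -/
structure Consistent (r : Finset ℕ) (t₀ : ℕ) (σ : Known) : Prop where
  nodup : σ.ord.Nodup
  mem_ord : ∀ x, x ∈ σ.ord ↔ σ.K x ≠ 0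
  bit : ∀ x, σ.K x ≠ 0 → (2 ≤ σ.K x ↔ x ∈ r)
  le : ∀ x, σ.K x ≠ 0 → x ≤ t₀

/-- The oracle answering according to `r`. -/
def ofSet (r : Finset ℕ) : Oracle := fun _ x => decide (x ∈ r)

variable {r : Finset ℕ} {t₀ : ℕ}

theorem Consistent.reveal {σ : Known} (h : Consistent r t₀ σ) {x : ℕ} (hx : x ≤ t₀) :
    Consistent r t₀ (reveal (ofSet r) σ x) := by
  unfold Exploration.reveal
  split_ifs with h0
  · refine ⟨List.nodup_cons.2 ⟨fun h1 => (h.mem_ord x).1 h1 h0, h.nodup⟩, fun y => ?_, fun y => ?_,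
      fun y => ?_⟩ <;> by_cases hy : y = x
    · subst hy; simp
    · simp [hy, h.mem_ord]
    · subst hy; by_cases hr : y ∈ r <;> simp [ofSet, hr]
    · simpa [hy] using h.bit y
    · subst hy; intro _; exact hx
    · simpa [hy] using h.le y
  · exact h

theorem Consistent.activate {σ : Known} (h : Consistent r t₀ σ) (xs : List ℕ) :
    Consistent r t₀ (activate xs σ) := by
  unfold Exploration.activate
  split_ifs with h0
  · refine ⟨h.nodup, fun y => ?_, fun y => ?_, fun y => ?_⟩ <;> by_cases hy : y ∈ xs
    · have := h0 y hy
      simp only [h.mem_ord, hy, if_true]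
      exact iff_of_true (by omega) (by omega)
    · simp [hy, h.mem_ord]
    · have := h0 y hy
      simp only [hy, if_true]
      intro _
      exact iff_of_true (by omega) ((h.bit y (by omega)).1 this)
    · simpa [hy] using h.bit y
    · have := h0 y hy
      intro _; exact h.le y (by omega)
    · simpa [hy] using h.le y
  · exact h

theorem Consistent.foldl_reveal {σ : Known} (h : Consistent r t₀ σ) (xs : List ℕ)
    (hxs : ∀ x ∈ xs, x ≤ t₀) : Consistent r t₀ (xs.foldl (Exploration.reveal (ofSet r)) σ) := by
  induction xs generalizing σ with
  | nil => exact h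
  | cons x xs ih =>
    exact ih (h.reveal (hxs x (by simp))) fun y hy => hxs y (by simp [hy])

/-- Known times stay known and active times stay active. -/
def Known.LE (σ σ' : Known) : Prop :=
  ∀ x, (σ.K x ≠ 0 → σ'.K x ≠ 0) ∧ (σ.K x = 3 → σ'.K x = 3)

theorem Known.LE.refl (σ : Known) : σ.LE σ := fun _ => ⟨id, id⟩

theorem Known.LE.trans {σ σ' σ'' : Known} (h : σ.LE σ') (h' : σ'.LE σ'') : σ.LE σ'' :=
  fun x => ⟨fun hx => (h' x).1 ((h x).1 hx), fun hx => (h' x).2 ((h x).2 hx)⟩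

theorem reveal_ge (f : Oracle) (σ : Known) (x : ℕ) : σ.LE (reveal f σ x) := by
  intro y
  unfold reveal
  split_ifs with h
  · by_cases hy : y = x
    · subst hy; simp [h]
    · simp [hy]
  · exact ⟨id, id⟩

theorem activate_ge (xs : List ℕ) (σ : Known) : σ.LE (activate xs σ) := by
  intro y
  unfold activate
  split_ifs with h
  · by_cases hy : y ∈ xs <;> simp [hy]
  · exact ⟨id, id⟩

theorem foldl_ge {ι : Type*} {O : Known → ι → Known} (hO : ∀ (σ : Known) i, σ.LE (O σ i))
    (xs : List ι)
    (σ : Known) : σ.LE (xs.foldl O σ) := by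
  induction xs generalizing σ with
  | nil => exact .refl _
  | cons x xs ih => exact (hO σ x).trans (ih _)

theorem expandEdge_ge (f : Oracle) (n t : ℕ) (σ : Known) (l : List ℕ) :
    σ.LE (expandEdge f n t σ l) := by
  unfold expandEdge
  split_ifs
  · exact (foldl_ge (reveal_ge f) _ σ).trans (activate_ge _ _)
  · exact .refl _

theorem reveal_K_ne_zero (f : Oracle) (σ : Known) (x : ℕ) : (reveal f σ x).K x ≠ 0 := by
  unfold reveal
  split_ifs with h
  · simp
  · exact h

theorem foldl_reveal_K_ne_zero (f : Oracle) (xs : List ℕ) (σ : Known) {x : ℕ} (hx : x ∈ xs) :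
    (xs.foldl (reveal f) σ).K x ≠ 0 := by
  induction xs generalizing σ with
  | nil => simp at hx
  | cons y xs ih =>
    rcases List.mem_cons.1 hx with rfl | hx
    · exact ((foldl_ge (reveal_ge f) xs _) x).1 (reveal_K_ne_zero f σ x)
    · exact ih _ hx

theorem reveal_K_of_ne (f : Oracle) (σ : Known) {x y : ℕ} (h : y ≠ x) :
    (reveal f σ x).K y = σ.K y := by
  unfold reveal; split_ifs <;> simp [h]

theorem foldl_reveal_K (f : Oracle) (xs : List ℕ) (σ : Known) {y : ℕ} (hy : y ∉ xs) :
    (xs.foldl (reveal f) σ).K y = σ.K y := by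
  induction xs generalizing σ with
  | nil => rfl
  | cons x xs ih =>
    rw [List.mem_cons, not_or] at hy
    rw [List.foldl_cons, ih _ hy.2, reveal_K_of_ne f σ hy.1]

theorem activate_K_of_notMem (xs : List ℕ) (σ : Known) {y : ℕ} (hy : y ∉ xs) :
    (activate xs σ).K y = σ.K y := by
  unfold activate; split_ifs <;> simp [hy]

theorem reveal_K_eq_three (f : Oracle) (σ : Known) {x y : ℕ} :
    (reveal f σ x).K y = 3 ↔ σ.K y = 3 := by
  by_cases h : y = x
  · subst h
    unfold reveal
    split_ifs with h0
    · have := Bool.toNat_le (f σ.ord y)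
      simp [h0]; omega
    · rfl
  · rw [reveal_K_of_ne f σ h]

theorem foldl_reveal_K_eq_three (f : Oracle) (xs : List ℕ) (σ : Known) {y : ℕ} :
    (xs.foldl (reveal f) σ).K y = 3 ↔ σ.K y = 3 := by
  induction xs generalizing σ with
  | nil => rfl
  | cons x xs ih => rw [List.foldl_cons, ih, reveal_K_eq_three]

variable {n k Δ : ℕ} {L : List (List ℕ)}

theorem mem_window_iff_mem_map {l : List ℕ} {t x : ℕ} :
    x ∈ window n (l, t) ↔ x ∈ l.map (lastUpdate n t) := by
  simp [window]

/-- `x` lies in the window at the active time `t` of a hyperedge through the vertex updated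
then. -/
structure Touches (n : ℕ) (L : List (List ℕ)) (σ : Known) (t : ℕ) (l : List ℕ) (x : ℕ) :
    Prop where
  active : σ.K t = 3
  le : n ≤ t
  mem : l ∈ L
  mem_edge : t % n ∈ l
  mem_window : x ∈ window n (l, t)

/-- Known and active times have a reason to be so. -/
structure Justified (n : ℕ) (L : List (List ℕ)) (r : Finset ℕ) (t₀ : ℕ) (σ : Known) : Prop where
  known : ∀ x, σ.K x ≠ 0 → x = t₀ ∨ ∃ t l, Touches n L σ t l x
  active : ∀ x, σ.K x = 3 → x = t₀ ∨ ∃ t l, Touches n L σ t l x ∧ x < t ∧ window n (l, t) ⊆ r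

theorem Touches.mono {σ σ' : Known} (h : σ.LE σ') {t x : ℕ} {l : List ℕ}
    (ht : Touches n L σ t l x) : Touches n L σ' t l x :=
  { ht with active := (h t).2 ht.active }

theorem expandEdge_consistent (hL : LinearEdges n k Δ L) {σ : Known} {t : ℕ} {l : List ℕ}
    (hl : l ∈ L) (hnt : n ≤ t) (htt : t ≤ t₀) (hσ : Consistent r t₀ σ) :
    Consistent r t₀ (expandEdge (ofSet r) n t σ l) := by
  unfold expandEdge
  split_ifs
  · refine (hσ.foldl_reveal _ fun x hx => ?_).activate _
    exact ((hL.mem_window (a := (l, t)) hl hnt).1 (mem_window_iff_mem_map.2 hx)).2.1.trans htt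
  · exact hσ

theorem expandEdge_justified (hL : LinearEdges n k Δ L) {σ : Known} {t : ℕ} {l : List ℕ}
    (hl : l ∈ L) (hnt : n ≤ t) (htt : t ≤ t₀) (ht3 : σ.K t = 3) (hσ : Consistent r t₀ σ)
    (hJ : Justified n L r t₀ σ) : Justified n L r t₀ (expandEdge (ofSet r) n t σ l) := by
  have hge := expandEdge_ge (ofSet r) n t σ l
  have hcons := expandEdge_consistent hL hl hnt htt hσ
  by_cases htl : t % n ∈ l
  swap
  · have : expandEdge (ofSet r) n t σ l = σ := by simp [expandEdge, htl]
    rwa [this]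
  have hnew : ∀ x, x ∈ window n (l, t) → Touches n L (expandEdge (ofSet r) n t σ l) t l x :=
    fun x hx => ⟨(hge t).2 ht3, hnt, hl, htl, hx⟩
  have hold : ∀ x, x ∉ window n (l, t) → (expandEdge (ofSet r) n t σ l).K x = σ.K x := by
    intro x hx
    rw [mem_window_iff_mem_map] at hx
    rw [expandEdge, if_pos htl, activate_K_of_notMem _ _ hx, foldl_reveal_K _ _ _ hx]
  constructor
  · intro x hx
    by_cases hxw : x ∈ window n (l, t)
    · exact .inr ⟨t, l, hnew x hxw⟩
    · rw [hold x hxw] at hx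
      exact (hJ.known x hx).imp_right fun ⟨t', l', h⟩ => ⟨t', l', h.mono hge⟩
  · intro x hx
    by_cases hxσ : σ.K x = 3
    · exact (hJ.active x hxσ).imp_right fun ⟨t', l', h, h'⟩ => ⟨t', l', h.mono hge, h'⟩
    · have hxw : x ∈ window n (l, t) := by
        by_contra hxw
        rw [hold x hxw] at hx
        exact hxσ hx
      have hall : ∀ y ∈ l.map (lastUpdate n t),
          2 ≤ ((l.map (lastUpdate n t)).foldl (reveal (ofSet r)) σ).K y := by
        by_contra hno
        rw [expandEdge, if_pos htl, activate, if_neg hno, foldl_reveal_K_eq_three] at hx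
        exact hxσ hx
      -- The time `t` itself was active before this expansion, so a newly active time of its window
      -- is strictly earlier.
      have hxt : x < t := by
        refine lt_of_le_of_ne ((hL.mem_window (a := (l, t)) hl hnt).1 hxw).2.1 ?_
        rintro rfl
        exact hxσ ht3
      refine .inr ⟨t, l, hnew x hxw, hxt, fun y hy => ?_⟩
      rw [mem_window_iff_mem_map] at hy
      have hy2 := hall y hy
      have h3 : 2 ≤ (expandEdge (ofSet r) n t σ l).K y := by
        rw [expandEdge, if_pos htl, activate, if_pos hall]
        simp [hy]
      exact (hcons.bit y (by omega)).1 h3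

/-- All dependencies of the time `t` have been explored. -/
def Complete (n : ℕ) (r : Finset ℕ) (σ : Known) (t : ℕ) (l : List ℕ) : Prop :=
  t % n ∈ l → (∀ x ∈ window n (l, t), σ.K x ≠ 0) ∧
    (window n (l, t) ⊆ r → ∀ x ∈ window n (l, t), σ.K x = 3)

theorem Complete.mono {σ σ' : Known} (h : σ.LE σ') {t : ℕ} {l : List ℕ}
    (hc : Complete n r σ t l) : Complete n r σ' t l := fun htl =>
  ⟨fun x hx => (h x).1 ((hc htl).1 x hx), fun hw x hx => (h x).2 ((hc htl).2 hw x hx)⟩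

theorem expandEdge_complete (hL : LinearEdges n k Δ L) {σ : Known} {t : ℕ} {l : List ℕ}
    (hl : l ∈ L) (hnt : n ≤ t) (htt : t ≤ t₀) (hσ : Consistent r t₀ σ) :
    Complete n r (expandEdge (ofSet r) n t σ l) t l := by
  intro htl
  have hcons : Consistent r t₀ ((l.map (lastUpdate n t)).foldl (reveal (ofSet r)) σ) :=
    hσ.foldl_reveal _ fun x hx =>
      ((hL.mem_window (a := (l, t)) hl hnt).1 (mem_window_iff_mem_map.2 hx)).2.1.trans htt
  simp only [mem_window_iff_mem_map]
  rw [expandEdge, if_pos htl]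
  constructor
  · intro x hx
    exact (activate_ge _ _ x).1 (foldl_reveal_K_ne_zero _ _ _ hx)
  · intro hw x hx
    rw [activate, if_pos]
    · simp [hx]
    · intro y hy
      exact (hcons.bit y (foldl_reveal_K_ne_zero _ _ _ hy)).2 (hw (mem_window_iff_mem_map.2 hy))

theorem foldl_expandEdge (hL : LinearEdges n k Δ L) {t : ℕ} (hnt : n ≤ t) (htt : t ≤ t₀)
    (M : List (List ℕ)) (hM : ∀ l ∈ M, l ∈ L) {σ : Known} (ht3 : σ.K t = 3)
    (hσ : Consistent r t₀ σ) (hJ : Justified n L r t₀ σ) :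
    Consistent r t₀ (M.foldl (expandEdge (ofSet r) n t) σ) ∧
    Justified n L r t₀ (M.foldl (expandEdge (ofSet r) n t) σ) ∧
    (∀ y, t < y → (M.foldl (expandEdge (ofSet r) n t) σ).K y = σ.K y) ∧
    ∀ l ∈ M, Complete n r (M.foldl (expandEdge (ofSet r) n t) σ) t l := by
  induction M generalizing σ with
  | nil => exact ⟨hσ, hJ, fun _ _ => rfl, by simp⟩
  | cons l M ih =>
    have hl := hM l (by simp)
    have h3 := (expandEdge_ge (ofSet r) n t σ l t).2 ht3
    have hc := expandEdge_consistent hL hl hnt htt hσ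
    have hj := expandEdge_justified hL hl hnt htt ht3 hσ hJ
    obtain ⟨h4, h5, h6, h7⟩ := ih (fun l' hl' => hM l' (by simp [hl'])) h3 hc hj
    refine ⟨h4, h5, fun y hy => ?_, ?_⟩
    · rw [List.foldl_cons, h6 y hy]
      have hyw : y ∉ l.map (lastUpdate n t) := by
        rw [← mem_window_iff_mem_map, hL.mem_window (a := (l, t)) hl hnt]
        simp only; omega
      unfold expandEdge
      split_ifs
      · rw [activate_K_of_notMem _ _ hyw, foldl_reveal_K _ _ _ hyw]
      · rfl
    · intro l' hl'
      rcases List.mem_cons.1 hl' with rfl | hl'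
      · exact (expandEdge_complete hL hl hnt htt hσ).mono (foldl_ge (expandEdge_ge _ n t) M _)
      · exact h7 l' hl'

theorem expand_ge (f : Oracle) (σ : Known) (t : ℕ) : σ.LE (expand f n L σ t) := by
  unfold expand
  split_ifs
  · exact foldl_ge (expandEdge_ge _ n t) _ _
  · exact .refl _

theorem sweep_ge (f : Oracle) (m : ℕ) (σ : Known) : σ.LE (sweep f n L m σ) := by
  induction m generalizing σ with
  | zero => exact .refl _
  | succ m ih => exact (expand_ge f σ _).trans (ih _)

/-- One pass from late to early times suffices: expanding `t` changes nothing at times after `t`.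
Hence the times already passed stay complete and no time behind the sweep becomes active. -/
theorem sweep_spec (hL : LinearEdges n k Δ L) (m : ℕ) (hm : n + m ≤ t₀ + 1) {σ : Known}
    (hσ : Consistent r t₀ σ) (hJ : Justified n L r t₀ σ)
    (hdone : ∀ t, n + m ≤ t → σ.K t = 3 → ∀ l ∈ L, Complete n r σ t l) :
    Consistent r t₀ (sweep (ofSet r) n L m σ) ∧ Justified n L r t₀ (sweep (ofSet r) n L m σ) ∧
    ∀ t, n ≤ t → (sweep (ofSet r) n L m σ).K t = 3 →
      ∀ l ∈ L, Complete n r (sweep (ofSet r) n L m σ) t l := by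
  induction m generalizing σ with
  | zero => exact ⟨hσ, hJ, hdone⟩
  | succ m ih =>
    have key : Consistent r t₀ (expand (ofSet r) n L σ (n + m)) ∧
        Justified n L r t₀ (expand (ofSet r) n L σ (n + m)) ∧
        ∀ t, n + m ≤ t → (expand (ofSet r) n L σ (n + m)).K t = 3 →
          ∀ l ∈ L, Complete n r (expand (ofSet r) n L σ (n + m)) t l := by
      have hge := expand_ge (n := n) (L := L) (ofSet r) σ (n + m)
      by_cases h3 : σ.K (n + m) = 3
      · have h := foldl_expandEdge hL (t := n + m) (by omega) (by omega) L (fun _ h => h) h3 hσ hJ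
        rw [expand, if_pos h3] at hge ⊢
        refine ⟨h.1, h.2.1, fun t ht h3' l hl => ?_⟩
        rcases ht.eq_or_lt with rfl | ht
        · exact h.2.2.2 l hl
        · rw [h.2.2.1 t ht] at h3'
          exact (hdone t (by omega) h3' l hl).mono hge
      · rw [expand, if_neg h3]
        refine ⟨hσ, hJ, fun t ht h3' l hl => ?_⟩
        rcases ht.eq_or_lt with rfl | ht
        · exact absurd h3' h3
        · exact hdone t (by omega) h3' l hl
    exact ih (by omega) key.1 key.2.1 key.2.2

theorem start_spec :
    Consistent r t₀ (start (ofSet r) t₀) ∧ Justified n L r t₀ (start (ofSet r) t₀) ∧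
    (start (ofSet r) t₀).K t₀ ≠ 0 ∧ (t₀ ∈ r → (start (ofSet r) t₀).K t₀ = 3) := by
  have h0 : Consistent r t₀ ⟨fun _ => 0, []⟩ := ⟨by simp, by simp, by simp, by simp⟩
  have hc : Consistent r t₀ (start (ofSet r) t₀) := (h0.reveal le_rfl).activate _
  have hx : ∀ x, (start (ofSet r) t₀).K x ≠ 0 → x = t₀ := by
    intro x hx
    by_contra hne
    rw [start, activate_K_of_notMem _ _ (by simpa using hne), reveal_K_of_ne _ _ hne] at hx
    exact hx rfl
  refine ⟨hc, ⟨fun x h => .inl (hx x h), fun x h => .inl (hx x (by omega))⟩, ?_, ?_⟩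
  · exact (activate_ge _ _ _).1 (reveal_K_ne_zero _ _ _)
  · intro h
    simp [start, activate, reveal, ofSet, h]

/-- The outcome of an exploration of the bits `r`. -/
structure Explored (n : ℕ) (L : List (List ℕ)) (r : Finset ℕ) (t₀ : ℕ) (σ : Known) : Prop where
  consistent : Consistent r t₀ σ
  justified : Justified n L r t₀ σ
  complete : ∀ t, n ≤ t → σ.K t = 3 → ∀ l ∈ L, Complete n r σ t l
  root_known : σ.K t₀ ≠ 0
  root_active : t₀ ∈ r → σ.K t₀ = 3

theorem explored_explore (hL : LinearEdges n k Δ L) (hn : n ≤ t₀ + 1) :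
    Explored n L r t₀ (explore (ofSet r) n L t₀) := by
  obtain ⟨h1, h2, h3, h4⟩ := start_spec (n := n) (L := L) (r := r) (t₀ := t₀)
  have hge := sweep_ge (n := n) (L := L) (ofSet r) (t₀ + 1 - n) (start (ofSet r) t₀)
  obtain ⟨h5, h6, h7⟩ := sweep_spec hL (t₀ + 1 - n) (by omega) h1 h2 fun t ht h3 => by
    have := h1.le t (by omega)
    omega
  exact ⟨h5, h6, h7, (hge _).1 h3, fun h => (hge _).2 (h4 h)⟩

/-- The active times. -/
def activeTimes (t₀ : ℕ) (σ : Known) : Finset ℕ := (Finset.range (t₀ + 1)).filter (σ.K · = 3)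

/-- The times whose bit is known to be `1`. -/
def knownOnes (t₀ : ℕ) (σ : Known) : Finset ℕ := (Finset.range (t₀ + 1)).filter (2 ≤ σ.K ·)

theorem Explored.mem_activeTimes {σ : Known} (h : Explored n L r t₀ σ) {t : ℕ} :
    t ∈ activeTimes t₀ σ ↔ σ.K t = 3 := by
  simp only [activeTimes, Finset.mem_filter, Finset.mem_range, and_iff_right_iff_imp]
  intro h3
  have := h.consistent.le t (by omega)
  omega

theorem Explored.mem_knownOnes {σ : Known} (h : Explored n L r t₀ σ) {t : ℕ} :
    t ∈ knownOnes t₀ σ ↔ 2 ≤ σ.K t := by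
  simp only [knownOnes, Finset.mem_filter, Finset.mem_range, and_iff_right_iff_imp]
  intro h3
  have := h.consistent.le t (by omega)
  omega

end Exploration

/-! ### Short explorations determine the update, long ones are rare, and few bits suffice. -/

namespace Exploration

open Percolation Glauber

variable {n k Δ : ℕ} {L : List (List ℕ)} {r : Finset ℕ} {t₀ : ℕ} {σ : Known}

theorem Explored.card_activeTimes_le (h : Explored n L r t₀ σ) :
    (activeTimes t₀ σ).card ≤ σ.ord.length := by
  rw [← List.toFinset_card_of_nodup h.consistent.nodup]
  refine Finset.card_le_card fun t ht => ?_
  rw [h.mem_activeTimes] at ht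
  rw [List.mem_toFinset, h.consistent.mem_ord]
  omega

/-- An exploration that reveals few times stays away from the initial times. -/
theorem Explored.le_of_active (h : Explored n L r t₀ σ) (hL : LinearEdges n k Δ L) (hn : 0 < n)
    {s : ℕ} (hs : σ.ord.length ≤ s) (ht₀ : (s + 1) * n ≤ t₀) {t : ℕ} (ht : σ.K t = 3) :
    n ≤ t := by
  -- Each active time other than `t₀` was activated by a later active time less than `n` steps away.
  -- Passing to it raises the quotient by `n` by at most one, and the quotient of `t₀` is at least
  -- `s + 1`; an active time in the first round would thus require more than `s` active times.
  have key : ∀ d t, t₀ - t = d → σ.K t = 3 →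
      s + 1 ≤ t / n + ((activeTimes t₀ σ).filter (t < ·)).card := by
    intro d
    induction d using Nat.strong_induction_on with
    | _ d ih =>
      intro t hd ht
      rcases h.justified.active t ht with rfl | ⟨t', l, htouch, htt', -⟩
      · have := (Nat.le_div_iff_mul_le hn).2 ht₀
        omega
      · have ht'0 := h.consistent.le t' (by have := htouch.active; omega)
        have h1 := ih (t₀ - t') (by omega) t' rfl htouch.active
        have h2 := ((hL.mem_window (a := (l, t')) htouch.mem htouch.le).1 htouch.mem_window).2.2
        have h3 : t' / n ≤ t / n + 1 := by
          rw [← Nat.add_div_right _ hn]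
          exact Nat.div_le_div_right (by simpa using h2.le)
        have h4 : ((activeTimes t₀ σ).filter (t' < ·)).card + 1 ≤
            ((activeTimes t₀ σ).filter (t < ·)).card := by
          rw [← Finset.card_insert_of_notMem (a := t') (by simp)]
          refine Finset.card_le_card (Finset.insert_subset ?_ fun x hx => ?_)
          · simp [h.mem_activeTimes, htouch.active, htt']
          · rw [Finset.mem_filter] at hx ⊢
            exact ⟨hx.1, htt'.trans hx.2⟩
        omega
  by_contra hlt
  have h1 := key _ t rfl ht
  rw [Nat.div_eq_of_lt (by omega)] at h1
  have h2 : ((activeTimes t₀ σ).filter (t < ·)).card + 1 ≤ (activeTimes t₀ σ).card := by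
    rw [← Finset.card_insert_of_notMem (a := t) (by simp)]
    refine Finset.card_le_card (Finset.insert_subset ?_ (Finset.filter_subset _ _))
    rwa [h.mem_activeTimes]
  have h3 := h.card_activeTimes_le
  omega

/-- If the exploration reveals few times, then the final update is determined by the revealed
bits. -/
theorem Explored.mem_conf_iff (h : Explored n L r t₀ σ) (hL : LinearEdges n k Δ L) (hn : 0 < n)
    {s : ℕ} (hs : σ.ord.length ≤ s) (ht₀ : (s + 1) * n ≤ t₀) {X Y : Finset ℕ}
    (hX : Indep L X) (hY : Indep L Y) :
    t₀ % n ∈ conf n L X r (t₀ + 1) ↔ t₀ % n ∈ conf n L Y (knownOnes t₀ σ) (t₀ + 1) := by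
  by_cases hr : t₀ ∈ r
  · refine mem_conf_congr hL (act := activeTimes t₀ σ) hX hY ?_ ?_ ?_
    · intro t ht
      rw [h.mem_activeTimes] at ht
      rw [h.mem_knownOnes]
      exact ⟨h.le_of_active hL hn hs ht₀ ht, (h.consistent.bit t (by omega)).1 (by omega), by omega⟩
    · intro t ht l hl htl
      rw [h.mem_activeTimes] at ht
      obtain ⟨h1, h2⟩ := h.complete t (h.le_of_active hL hn hs ht₀ ht) ht l hl htl
      -- A closed window at an active time is entirely known, so its zero bit is also zero among the
      -- known ones. Masking the unknown bits by zero is therefore consistent.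
      by_cases hw : window n (l, t) ⊆ r
      · exact .inl fun x hx => by rw [h.mem_activeTimes]; exact h2 hw x hx
      · obtain ⟨x, hx, hxr⟩ := Finset.not_subset.1 hw
        refine .inr ⟨x, hx, hxr, ?_⟩
        rwa [h.mem_knownOnes, h.consistent.bit x (h1 x hx)]
    · rw [h.mem_activeTimes]
      exact h.root_active hr
  · rw [mem_conf_succ_self, mem_conf_succ_self, h.mem_knownOnes,
      h.consistent.bit _ h.root_known]
    simp [hr]

/-- The timed hyperedges at active times with an open window. -/
def openEdges (n : ℕ) (L : List (List ℕ)) (r : Finset ℕ) (t₀ : ℕ) (σ : Known) :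
    Finset (List ℕ × ℕ) :=
  (timedEdges n L (t₀ + 1)).filter fun a => σ.K a.2 = 3 ∧ window n a ⊆ r

theorem Touches.mem_timedEdges {t x : ℕ} {l : List ℕ} (h : Explored n L r t₀ σ)
    (ht : Touches n L σ t l x) : (l, t) ∈ timedEdges n L (t₀ + 1) := by
  have := h.consistent.le t (by have := ht.active; omega)
  exact Percolation.mem_timedEdges.2 ⟨ht.mem, by simpa using by omega, ht.le, ht.mem_edge⟩

/-- Every active time except the root lies in the open window that activated it, and a window has at
most `k` times. -/
theorem Explored.card_active_le (h : Explored n L r t₀ σ) (hL : LinearEdges n k Δ L) :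
    (activeTimes t₀ σ).card ≤ 1 + (openEdges n L r t₀ σ).card * k := by
  have hsub : activeTimes t₀ σ ⊆ insert t₀ ((openEdges n L r t₀ σ).biUnion (window n)) := by
    intro t ht
    rw [h.mem_activeTimes] at ht
    rw [Finset.mem_insert]
    refine (h.justified.active t ht).imp_right fun ⟨t', l, h1, h2, h3⟩ => ?_
    exact Finset.mem_biUnion.2 ⟨(l, t'), Finset.mem_filter.2
      ⟨h1.mem_timedEdges h, h1.active, h3⟩, h1.mem_window⟩
  refine (Finset.card_le_card hsub).trans ((Finset.card_insert_le _ _).trans ?_)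
  rw [add_comm]
  gcongr
  refine Finset.card_biUnion_le_card_mul _ _ _ fun a ha => card_window_le (hL.length _ ?_)
  exact (Percolation.mem_timedEdges.1 (Finset.mem_filter.1 ha).1).1

theorem Explored.card_known_le (h : Explored n L r t₀ σ) (hL : LinearEdges n k Δ L) :
    σ.ord.length ≤ 1 + (activeTimes t₀ σ).card * (Δ * k) := by
  rw [← List.toFinset_card_of_nodup h.consistent.nodup]
  have hsub : σ.ord.toFinset ⊆ insert t₀ ((activeTimes t₀ σ).biUnion fun t =>
      (L.toFinset.filter (t % n ∈ ·)).biUnion fun l => window n (l, t)) := by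
    intro x hx
    rw [List.mem_toFinset, h.consistent.mem_ord] at hx
    rw [Finset.mem_insert]
    refine (h.justified.known x hx).imp_right fun ⟨t, l, h1⟩ => ?_
    refine Finset.mem_biUnion.2 ⟨t, h.mem_activeTimes.2 h1.active, Finset.mem_biUnion.2
      ⟨l, by simp [h1.mem, h1.mem_edge], h1.mem_window⟩⟩
  refine (Finset.card_le_card hsub).trans ((Finset.card_insert_le _ _).trans ?_)
  rw [add_comm]
  gcongr
  refine Finset.card_biUnion_le_card_mul _ _ _ fun t _ => ?_
  refine (Finset.card_biUnion_le_card_mul _ _ k fun l hl => ?_).trans ?_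
  · exact card_window_le (hL.length _ (by simpa using (Finset.mem_filter.1 hl).1))
  · gcongr
    exact hL.degree _

/-- A pair at a time before `t₀` overlaps the pair that activated its time, and that pair is later.
Following these ancestors leads to time `t₀`, where any two pairs overlap in `t₀` itself. Thus all
open pairs form one connected set with a root at time `t₀`. -/
theorem Explored.exists_isCluster (h : Explored n L r t₀ σ) (hL : LinearEdges n k Δ L)
    (hne : (openEdges n L r t₀ σ).Nonempty) :
    ∃ a, a.2 = t₀ ∧ IsCluster n L (t₀ + 1) r a (openEdges n L r t₀ σ) := by
  have hmem : ∀ {a}, a ∈ openEdges n L r t₀ σ → a ∈ timedEdges n L (t₀ + 1) :=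
    fun ha => (Finset.mem_filter.1 ha).1
  have hself : ∀ {a}, a ∈ openEdges n L r t₀ σ → a.2 ∈ window n a := by
    intro a ha
    have ha' := Percolation.mem_timedEdges.1 (hmem ha)
    exact (hL.mem_window ha'.1 ha'.2.2.1).2
      ⟨ha'.2.2.2, le_rfl, by have := hL.lt _ ha'.1 _ ha'.2.2.2; omega⟩
  have hparent : ∀ a ∈ openEdges n L r t₀ σ, a.2 = t₀ ∨
      ∃ b ∈ openEdges n L r t₀ σ, a.2 < b.2 ∧ Overlap n b a := by
    intro a ha
    refine (h.justified.active a.2 (Finset.mem_filter.1 ha).2.1).imp_right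
      fun ⟨t, l, h1, h2, h3⟩ => ?_
    exact ⟨(l, t), Finset.mem_filter.2 ⟨h1.mem_timedEdges h, h1.active, h3⟩, h2,
      a.2, h1.mem_window, hself ha⟩
  obtain ⟨a, ha, hmax⟩ := Finset.exists_max_image _ Prod.snd hne
  have hat : a.2 = t₀ := by
    rcases hparent a ha with h1 | ⟨b, hb, h1, -⟩
    · exact h1
    · exact absurd (hmax b hb) (by omega)
  refine ⟨a, hat, Finset.filter_subset _ _, ha, fun c hc => (Finset.mem_filter.1 hc).2.2, ?_⟩
  have key : ∀ d, ∀ c ∈ openEdges n L r t₀ σ, t₀ - c.2 = d →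
      Relation.ReflTransGen (fun u v => Overlap n u v ∧ v ∈ openEdges n L r t₀ σ) a c := by
    intro d
    induction d using Nat.strong_induction_on with
    | _ d ih =>
      intro c hc hd
      rcases hparent c hc with h1 | ⟨b, hb, h1, h2⟩
      · exact .single ⟨⟨t₀, hat ▸ hself ha, h1 ▸ hself hc⟩, hc⟩
      · have := (Percolation.mem_timedEdges.1 (hmem hb)).2.1
        exact (ih (t₀ - b.2) (by omega) b hb rfl).tail ⟨h2, hc⟩
  exact fun c hc => key _ c hc rfl

/-- The number of revealed times that forces a cluster in which `l` blocks can be found. -/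
def budget (k Δ θ l : ℕ) : ℕ :=
  1 + (1 + k ^ 2 * ((1 + k ^ 6 * Δ * θ) * (1 + l * θ * (k ^ 6 * Δ + 1))) * k) * (Δ * k)

/-- Long explorations are unlikely. -/
theorem card_long_explorations (hL : LinearEdges n k Δ L) (hn : n ≤ t₀ + 1) {θ : ℕ} (hθ : 0 < θ)
    (l : ℕ) (bad : Finset (Finset ℕ)) (hbad : ∀ r ∈ bad, r ⊆ Finset.range (t₀ + 1) ∧
      budget k Δ θ l < (explore (ofSet r) n L t₀).ord.length) :
    bad.card * 2 ^ (l * (θ * (k - θ))) ≤ Δ * ((3 * (k ^ 6 * Δ + 1)) ^ (l * (θ + 1) + 1) *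
      2 ^ (l * (θ + 1) + 1) * 2 ^ (t₀ + 1)) := by
  refine hL.card_cluster hθ l t₀ bad fun r hr => ?_
  obtain ⟨h1, h2⟩ := hbad r hr
  refine ⟨h1, ?_⟩
  have h := explored_explore (r := r) (t₀ := t₀) hL hn
  set σ := explore (ofSet r) n L t₀
  have h3 := h.card_active_le hL
  have h4 := h.card_known_le hL
  have h5 : k ^ 2 * ((1 + k ^ 6 * Δ * θ) * (1 + l * θ * (k ^ 6 * Δ + 1))) <
      (openEdges n L r t₀ σ).card := by
    by_contra! hle
    have h6 : σ.ord.length ≤ budget k Δ θ l := by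
      refine h4.trans ?_
      unfold budget
      gcongr
      exact h3.trans (by gcongr)
    omega
  obtain ⟨a, ha, hC⟩ := h.exists_isCluster hL (Finset.card_pos.1 (by omega))
  exact ⟨a, _, ha, hC, h5⟩

/-! ### Bits in the order of discovery -/

/-- The oracle that answers the queries by the binary digits of `j` in their order. -/
def ofNat (j : ℕ) : Oracle := fun ord _ => j.testBit ord.length

/-- Reveal all times up to `t₀` after the exploration. -/
def exploreAll (f : Oracle) (n : ℕ) (L : List (List ℕ)) (t₀ : ℕ) : Known :=
  (List.range (t₀ + 1)).foldl (reveal f) (explore f n L t₀)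

theorem exploreAll_spec (hL : LinearEdges n k Δ L) (hn : n ≤ t₀ + 1) (r : Finset ℕ) :
    Consistent r t₀ (exploreAll (ofSet r) n L t₀) ∧
      ∀ x ≤ t₀, (exploreAll (ofSet r) n L t₀).K x ≠ 0 :=
  ⟨(explored_explore hL hn).consistent.foldl_reveal _ fun x hx => by
      rw [List.mem_range] at hx; omega,
    fun x hx => foldl_reveal_K_ne_zero _ _ _ (by rw [List.mem_range]; omega)⟩

theorem exists_testBit (T : ℕ) (g : ℕ → Bool) : ∃ j < 2 ^ T, ∀ i < T, j.testBit i = g i := by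
  refine ⟨Nat.ofBits fun i : Fin T => g i, Nat.ofBits_lt_two_pow _, fun i hi => ?_⟩
  rw [Nat.testBit_ofBits_lt _ _ hi]

/-- The bits assigned to the times by the digits of `j` in the order of discovery. -/
def bitsOf (n : ℕ) (L : List (List ℕ)) (t₀ j : ℕ) : Finset ℕ :=
  knownOnes t₀ (exploreAll (ofNat j) n L t₀)

/-- Explore with the bits `r`, go on until every time is revealed, and write down the answers in the
order of the queries. The number with these digits reproduces the entire process, since each query
depends only on the previous answers. -/
theorem exists_digits (hL : LinearEdges n k Δ L) (hn : n ≤ t₀ + 1) (r : Finset ℕ)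
    (hr : r ⊆ Finset.range (t₀ + 1)) : ∃ j < 2 ^ (t₀ + 1), bitsOf n L t₀ j = r ∧
      explore (ofNat j) n L t₀ = explore (ofSet r) n L t₀ := by
  obtain ⟨h1, h2⟩ := exploreAll_spec hL hn r
  set σ := exploreAll (ofSet r) n L t₀ with hσ
  have hlen : σ.ord.length ≤ t₀ + 1 := by
    rw [← List.toFinset_card_of_nodup h1.nodup, ← Finset.card_range (t₀ + 1)]
    refine Finset.card_le_card fun x hx => ?_
    rw [List.mem_toFinset, h1.mem_ord] at hx
    have := h1.le x hx
    rw [Finset.mem_range]; omega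
  obtain ⟨j, hj, hbits⟩ := exists_testBit (t₀ + 1) fun i => decide (σ.ord.reverse.getD i 0 ∈ r)
  -- The list `ord` has the last query first, so a query made after those in `rest` stands at
  -- position `rest.length` of the reversed list.
  have hagree : Agree (ofSet r) (ofNat j) σ.ord := by
    rintro x rest ⟨pre, hpre⟩
    have h3 : rest.length < t₀ + 1 := by
      have := congrArg List.length hpre
      simp only [List.length_append, List.length_cons] at this
      omega
    rw [ofNat, hbits _ h3, ofSet, ← hpre]
    simp
  have hfaith : Faithful fun f σ => (List.range (t₀ + 1)).foldl (reveal f)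
      (sweep f n L (t₀ + 1 - n) (activate [t₀] (reveal f σ t₀))) :=
    (faithful_explore n L t₀).comp
      (Faithful.foldl (O := fun x f σ => reveal f σ x) faithful_reveal _)
  have hall : exploreAll (ofNat j) n L t₀ = σ := hfaith.congr _ _ _ hagree
  refine ⟨j, hj, ?_, explore_congr (hagree.mono
    ((Faithful.foldl (O := fun x f σ => reveal f σ x) faithful_reveal _).suffix _ _))⟩
  rw [bitsOf, hall]
  ext x
  simp only [knownOnes, Finset.mem_filter, Finset.mem_range]
  constructor
  · rintro ⟨h3, h4⟩
    exact (h1.bit x (by omega)).1 h4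
  · intro hx
    have h3 := Finset.mem_range.1 (hr hx)
    exact ⟨h3, (h1.bit x (h2 x (by omega))).2 hx⟩

/-- Bits in the order of discovery are as good as bits attached to the times. -/
theorem card_filter_digits (hL : LinearEdges n k Δ L) (hn : n ≤ t₀ + 1) (Q : Known → Prop)
    [DecidablePred Q] :
    ((Finset.range (2 ^ (t₀ + 1))).filter fun j => Q (explore (ofNat j) n L t₀)).card =
      ((Finset.range (t₀ + 1)).powerset.filter fun r => Q (explore (ofSet r) n L t₀)).card := by
  have hsurj : ∀ r ∈ (Finset.range (t₀ + 1)).powerset, ∃ j ∈ Finset.range (2 ^ (t₀ + 1)),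
      bitsOf n L t₀ j = r ∧ explore (ofNat j) n L t₀ = explore (ofSet r) n L t₀ := by
    intro r hr
    obtain ⟨j, hj, h⟩ := exists_digits hL hn r (Finset.mem_powerset.1 hr)
    exact ⟨j, Finset.mem_range.2 hj, h⟩
  choose! J hJ hJ1 hJ2 using hsurj
  have hinj : Set.InjOn J ((Finset.range (t₀ + 1)).powerset : Finset (Finset ℕ)) := by
    intro r hr r' hr' h
    rw [← hJ1 r hr, ← hJ1 r' hr', h]
  -- The map `J` is injective because `bitsOf` recovers `r`, and both sides have `2 ^ (t₀ + 1)`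
  -- elements, so it is a bijection.
  have himage : ((Finset.range (t₀ + 1)).powerset).image J = Finset.range (2 ^ (t₀ + 1)) := by
    refine Finset.eq_of_subset_of_card_le (Finset.image_subset_iff.2 hJ) ?_
    rw [Finset.card_image_of_injOn hinj, Finset.card_powerset]
    simp
  rw [← himage, Finset.filter_image, Finset.card_image_of_injOn
    (hinj.mono fun r hr => (Finset.mem_filter.1 hr).1)]
  congr 1
  refine Finset.filter_congr fun r hr => ?_
  rw [hJ2 r hr]

theorem card_filter_mod (p : ℕ → Prop) [DecidablePred p] (M c : ℕ) :
    ((Finset.range (M * c)).filter fun j => p (j % M)).card =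
      c * ((Finset.range M).filter p).card := by
  simp only [Finset.card_filter]
  induction c with
  | zero => simp
  | succ c ih =>
    rw [mul_add, mul_one, Finset.sum_range_add, ih, add_mul, one_mul]
    congr 1
    refine Finset.sum_congr rfl fun j hj => ?_
    rw [Nat.mul_add_mod_self_left, Nat.mod_eq_of_lt (Finset.mem_range.1 hj)]

/-- An exploration with at most `s` queries reads only the `s` lowest digits. -/
theorem explore_mod {s j : ℕ} (h : (explore (ofNat j) n L t₀).ord.length ≤ s) :
    explore (ofNat (j % 2 ^ s)) n L t₀ = explore (ofNat j) n L t₀ := by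
  refine explore_congr ?_
  rintro x rest ⟨pre, hpre⟩
  have := congrArg List.length hpre
  simp only [List.length_append, List.length_cons] at this
  simp only [ofNat, Nat.testBit_mod_two_pow]
  rw [decide_eq_true (by omega), Bool.true_and]

/-- The vertex updated last is unoccupied in the run computed from the digits of `j`. -/
def Vacant (n : ℕ) (L : List (List ℕ)) (t₀ j : ℕ) : Prop :=
  t₀ % n ∉ conf n L ∅ (knownOnes t₀ (explore (ofNat j) n L t₀)) (t₀ + 1)

instance (n : ℕ) (L : List (List ℕ)) (t₀ j : ℕ) : Decidable (Vacant n L t₀ j) := by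
  unfold Vacant; infer_instance

/-- The fraction of vacant runs approximates the marginal probability of being unoccupied. -/
theorem abs_vacant_sub_marginal (hL : LinearEdges n k Δ L) (hn : 0 < n) (hk : 0 < k) {s : ℕ}
    (ht₀ : (s + 1) * n ≤ t₀) :
    |(((Finset.range (2 ^ s)).filter (Vacant n L t₀)).card : ℝ) / 2 ^ s -
      ((indepSets n L).filter (t₀ % n ∉ ·)).card / (indepSets n L).card| ≤
    2 * (((Finset.range (t₀ + 1)).powerset.filter fun r =>
      s < (explore (ofSet r) n L t₀).ord.length).card / 2 ^ (t₀ + 1)) := by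
  set bad := (Finset.range (t₀ + 1)).powerset.filter fun r =>
      s < (explore (ofSet r) n L t₀).ord.length with hbad
  have hnt : n ≤ t₀ + 1 := by nlinarith
  have hst : s ≤ t₀ + 1 := by nlinarith
  have hempty : Indep L ∅ := fun l hl => by
    obtain ⟨w, hw⟩ := List.exists_mem_of_length_pos
        (by rw [hL.length l hl]; exact hk : 0 < l.length)
    exact ⟨w, hw, by simp⟩
  have hz : 0 < (indepSets n L).card :=
    Finset.card_pos.2 ⟨∅, mem_indepSets.2 ⟨by simp, hempty⟩⟩
  -- First error: the stationary initial state is replaced by the empty set and the unrevealed bits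
  -- by zero. Both matter only if the exploration is long.
  have h1 := abs_sub_le_of_agree (L := L) hn (t₀ % n) (t₀ + 1) bad
    (fun r => knownOnes t₀ (explore (ofSet r) n L t₀)) (by
      intro r hr hrb X hX
      have hlen : (explore (ofSet r) n L t₀).ord.length ≤ s := by
        by_contra! hlt
        exact hrb (Finset.mem_filter.2 ⟨hr, hlt⟩)
      exact (explored_explore hL hnt).mem_conf_iff hL hn hlen ht₀ (mem_indepSets.1 hX).2 hempty)
  set A := (Finset.range (t₀ + 1)).powerset.filter fun r =>
    t₀ % n ∉ conf n L ∅ (knownOnes t₀ (explore (ofSet r) n L t₀)) (t₀ + 1) with hA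
  have hA' : ((Finset.range (2 ^ (t₀ + 1))).filter (Vacant n L t₀)).card = A.card :=
    card_filter_digits hL hnt fun σ => t₀ % n ∉ conf n L ∅ (knownOnes t₀ σ) (t₀ + 1)
  have hbad' : ((Finset.range (2 ^ (t₀ + 1))).filter fun j =>
      s < (explore (ofNat j) n L t₀).ord.length).card = bad.card :=
    card_filter_digits hL hnt fun σ => s < σ.ord.length
  -- Second error: only the lowest `s` digits are kept, each string occurring equally often. Again
  -- only long explorations are affected, whence the factor `2` in the bound.
  have hmod := card_filter_mod (Vacant n L t₀) (2 ^ s) (2 ^ (t₀ + 1 - s))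
  rw [← pow_add, Nat.add_sub_cancel' hst] at hmod
  set B := (Finset.range (2 ^ (t₀ + 1))).filter fun j => Vacant n L t₀ (j % 2 ^ s) with hB
  have hiff : ∀ j, ¬ s < (explore (ofNat j) n L t₀).ord.length →
      (Vacant n L t₀ (j % 2 ^ s) ↔ Vacant n L t₀ j) := by
    intro j hj
    rw [Vacant, Vacant, explore_mod (by omega)]
  have hle1 : B.card ≤ A.card + bad.card := by
    rw [← hA', ← hbad']
    refine (Finset.card_le_card fun j hj => ?_).trans (Finset.card_union_le _ _)
    rw [Finset.mem_union, Finset.mem_filter, Finset.mem_filter]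
    rw [hB, Finset.mem_filter] at hj
    by_cases hs : s < (explore (ofNat j) n L t₀).ord.length
    · exact .inr ⟨hj.1, hs⟩
    · exact .inl ⟨hj.1, (hiff j hs).1 hj.2⟩
  have hle2 : A.card ≤ B.card + bad.card := by
    rw [← hA', ← hbad']
    refine (Finset.card_le_card fun j hj => ?_).trans (Finset.card_union_le _ _)
    rw [Finset.mem_union, hB, Finset.mem_filter, Finset.mem_filter]
    rw [Finset.mem_filter] at hj
    by_cases hs : s < (explore (ofNat j) n L t₀).ord.length
    · exact .inr ⟨hj.1, hs⟩
    · exact .inl ⟨hj.1, (hiff j hs).2 hj.2⟩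
  set c := ((Finset.range (2 ^ s)).filter (Vacant n L t₀)).card
  set z := (indepSets n L).card
  set z₀ := ((indepSets n L).filter (t₀ % n ∉ ·)).card
  have hzR : (0 : ℝ) < z := by exact_mod_cast hz
  have hTpos : (0 : ℝ) < 2 ^ (t₀ + 1) := by positivity
  have h2 : (c : ℝ) / 2 ^ s = B.card / 2 ^ (t₀ + 1) := by
    rw [hmod, div_eq_div_iff (by positivity) (by positivity)]
    push_cast
    have : (2 : ℝ) ^ (t₀ + 1) = 2 ^ (t₀ + 1 - s) * 2 ^ s := by
      rw [← pow_add, Nat.sub_add_cancel hst]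
    rw [this]; ring
  have h3 : |(B.card : ℝ) - A.card| ≤ bad.card := by
    rw [abs_le]
    have h4 : (B.card : ℝ) ≤ A.card + bad.card := by exact_mod_cast hle1
    have h5 : (A.card : ℝ) ≤ B.card + bad.card := by exact_mod_cast hle2
    constructor <;> linarith
  have h4 : |(A.card : ℝ) / 2 ^ (t₀ + 1) - z₀ / z| ≤ bad.card / 2 ^ (t₀ + 1) := by
    have : (A.card : ℝ) / 2 ^ (t₀ + 1) - z₀ / z =
        -((2 : ℝ) ^ (t₀ + 1) * z₀ - z * A.card) / (2 ^ (t₀ + 1) * z) := by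
      field_simp; ring
    rw [this, abs_div, abs_neg, abs_of_pos (mul_pos hTpos hzR),
      div_le_div_iff₀ (mul_pos hTpos hzR) hTpos]
    calc _ ≤ (z * bad.card : ℝ) * 2 ^ (t₀ + 1) := by gcongr
      _ = _ := by ring
  rw [h2]
  calc |(B.card : ℝ) / 2 ^ (t₀ + 1) - z₀ / z|
      = |((B.card : ℝ) - A.card) / 2 ^ (t₀ + 1) + (A.card / 2 ^ (t₀ + 1) - z₀ / z)| := by
        congr 1; ring
    _ ≤ |((B.card : ℝ) - A.card) / 2 ^ (t₀ + 1)| + |A.card / 2 ^ (t₀ + 1) - (z₀ : ℝ) / z| :=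
        abs_add_le _ _
    _ ≤ bad.card / 2 ^ (t₀ + 1) + bad.card / 2 ^ (t₀ + 1) := by
        gcongr
        rw [abs_div, abs_of_pos hTpos]
        gcongr
    _ = _ := by ring

end Exploration

/-! ### Choice of the parameters and reduction of counting to marginals. -/

namespace Exploration

open Percolation Glauber

/-! ### Arithmetic of the parameters -/

theorem sq_succ_le_two_pow {m : ℕ} (hm : 6 ≤ m) : (m + 1) ^ 2 ≤ 2 ^ m := by
  induction m, hm using Nat.le_induction with
  | base => norm_num
  | succ m hm ih => rw [pow_succ 2 m]; nlinarith

/-- The hypothesis on the degree in the form in which it is used. -/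
structure Sparse (k Δ : ℕ) : Prop where
  bound : 100 * k ^ 3 * Δ * 2 ^ (5 * Nat.sqrt k) ≤ 2 ^ k
  six_le : 6 ≤ Nat.sqrt k
  pos : 0 < Δ

/-- The lower bound on `k` says that `√k * δ / (1 + δ) ≥ 5`, so `k / (1 + δ) + 5 * √k ≤ k`. This is
where the factor `2 ^ (5 * Nat.sqrt k)` in `Sparse` comes from. -/
theorem sparse_of_le {δ : ℝ} (hδ : 0 < δ) {k Δ : ℕ} (hk : 25 * (1 + δ) ^ 2 / δ ^ 2 ≤ (k : ℝ))
    (hΔ : 2 ≤ Δ) (hkΔ : (Δ : ℝ) ≤ 1 / (100 * (k : ℝ) ^ 3) * (2 : ℝ) ^ ((k : ℝ) / (1 + δ))) :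
    Sparse k Δ := by
  set θ := Nat.sqrt k with hθ
  have h25 : (25 : ℝ) < k := by
    refine lt_of_lt_of_le ?_ hk
    rw [lt_div_iff₀ (by positivity)]
    nlinarith
  have h26 : 26 ≤ k := by
    have : (25 : ℕ) < k := by exact_mod_cast h25
    omega
  have hk0 : (0 : ℝ) < k := by linarith
  have hθsq : (θ : ℝ) ^ 2 ≤ k := by
    have := Nat.sqrt_le' k
    exact_mod_cast this
  have h5 : 5 * (θ : ℝ) ≤ k * (δ / (1 + δ)) := by
    set x := δ / (1 + δ) with hx
    have hx0 : 0 < x := by positivity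
    have hkx : 25 ≤ (k : ℝ) * x ^ 2 := by
      rw [div_le_iff₀ (by positivity)] at hk
      rw [hx, div_pow, ← mul_div_assoc, le_div_iff₀ (by positivity)]
      exact hk
    refine (pow_le_pow_iff_left₀ (by positivity) (by positivity) two_ne_zero).1 ?_
    · calc (5 * (θ : ℝ)) ^ 2 = 25 * (θ : ℝ) ^ 2 := by ring
        _ ≤ (k * x ^ 2) * k := by gcongr
        _ = (k * x) ^ 2 := by ring
  have hexp : (k : ℝ) / (1 + δ) + (5 * θ : ℕ) ≤ k := by
    have : (k : ℝ) / (1 + δ) = k - k * (δ / (1 + δ)) := by field_simp; ring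
    push_cast
    rw [this]; linarith
  have hbound : 100 * k ^ 3 * Δ * 2 ^ (5 * θ) ≤ 2 ^ k := by
    have h1 : 100 * (k : ℝ) ^ 3 * Δ ≤ (2 : ℝ) ^ ((k : ℝ) / (1 + δ)) := by
      rw [one_div_mul_eq_div, le_div_iff₀ (by positivity)] at hkΔ
      linarith
    have h2 : 100 * (k : ℝ) ^ 3 * Δ * 2 ^ (5 * θ) ≤ 2 ^ k := by
      calc 100 * (k : ℝ) ^ 3 * Δ * 2 ^ (5 * θ)
          ≤ (2 : ℝ) ^ ((k : ℝ) / (1 + δ)) * 2 ^ (5 * θ) := by gcongr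
        _ = (2 : ℝ) ^ ((k : ℝ) / (1 + δ) + (5 * θ : ℕ)) := by
            rw [Real.rpow_add (by norm_num), Real.rpow_natCast]
        _ ≤ (2 : ℝ) ^ (k : ℝ) := Real.rpow_le_rpow_of_exponent_le (by norm_num) hexp
        _ = 2 ^ k := Real.rpow_natCast _ _
    exact_mod_cast h2
  refine ⟨hbound, ?_, by omega⟩
  -- Otherwise `26 ≤ k ≤ 35`, and `hbound` with `Δ ≥ 2` fails numerically.
  by_contra! hlt
  have h5θ : 5 ≤ θ := Nat.le_sqrt'.2 (by omega)
  have hk35 : k < 36 := by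
    have := Nat.sqrt_lt'.1 (show Nat.sqrt k < 6 from hlt)
    omega
  have h1 : 100 * 26 ^ 3 * 2 * 2 ^ (5 * 5) ≤ 2 ^ 35 := by
    calc 100 * 26 ^ 3 * 2 * 2 ^ (5 * 5) ≤ 100 * k ^ 3 * Δ * 2 ^ (5 * θ) := by gcongr; norm_num
      _ ≤ 2 ^ k := hbound
      _ ≤ 2 ^ 35 := Nat.pow_le_pow_right (by norm_num) (by omega)
  norm_num at h1

theorem Sparse.pos_k {k Δ : ℕ} (h : Sparse k Δ) : 0 < k := by
  have h1 := h.six_le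
  rcases Nat.eq_zero_or_pos k with rfl | hk
  · simp at h1
  · exact hk

/-- From `k < (θ + 1) ^ 2 ≤ 2 ^ θ` follows `k ^ 3 ≤ 2 ^ (3 * θ)`. Three of the five factors `2 ^ θ`
in `Sparse` thus pay for replacing `k ^ 3` by `k ^ 6`. The remaining slack `2 ^ (2 * θ + 3)`, raised
to the power `θ + 1`, outweighs the `θ ^ 2` times lost inside a block and the `k` lost because a
block of `θ` costs `θ + 1` vertices. -/
theorem Sparse.block {k Δ : ℕ} (h : Sparse k Δ) :
    (7 * k ^ 6 * Δ) ^ (Nat.sqrt k + 1) * 2 ≤ 2 ^ (Nat.sqrt k * (k - Nat.sqrt k)) := by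
  have h0 := h.six_le
  have hb := h.bound
  have h1 : Nat.sqrt k ^ 2 ≤ k := Nat.sqrt_le' k
  have h2 : k < (Nat.sqrt k + 1) ^ 2 := Nat.lt_succ_sqrt' k
  set θ := Nat.sqrt k
  have h3 : k ^ 3 ≤ 2 ^ (3 * θ) := by
    rw [mul_comm 3 θ, pow_mul]
    gcongr
    exact h2.le.trans (sq_succ_le_two_pow h0)
  have h4 : 7 * k ^ 6 * Δ * 2 ^ (2 * θ + 3) ≤ 2 ^ k := by
    calc 7 * k ^ 6 * Δ * 2 ^ (2 * θ + 3) = 56 * k ^ 3 * Δ * 2 ^ (2 * θ) * k ^ 3 := by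
          rw [pow_add]; ring
      _ ≤ 100 * k ^ 3 * Δ * 2 ^ (2 * θ) * 2 ^ (3 * θ) := by gcongr; norm_num
      _ = 100 * k ^ 3 * Δ * 2 ^ (5 * θ) := by rw [mul_assoc, ← pow_add]; congr 2; ring
      _ ≤ 2 ^ k := hb
  have h5 : ((7 * k ^ 6 * Δ) ^ (θ + 1) * 2) * 2 ^ ((2 * θ + 3) * (θ + 1)) ≤
      2 ^ (k * (θ + 1) + 1) := by
    rw [pow_mul, pow_succ 2 (k * (θ + 1)), pow_mul, mul_right_comm, ← mul_pow]
    gcongr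
  have h6 : k * (θ + 1) + 1 ≤ θ * (k - θ) + (2 * θ + 3) * (θ + 1) := by
    obtain ⟨d, hd⟩ : ∃ d, k = θ + d := Nat.exists_eq_add_of_le (by nlinarith)
    have : k - θ = d := by omega
    rw [this]
    nlinarith
  have h7 := h5.trans (Nat.pow_le_pow_right (by norm_num) h6)
  rw [pow_add 2 (θ * (k - θ))] at h7
  exact Nat.le_of_mul_le_mul_right h7 (by positivity)

/-! ### Marginals -/

variable {n k Δ : ℕ} {L : List (List ℕ)}

/-- Since `2 * 3 * (k ^ 6 * Δ + 1) ≤ 7 * k ^ 6 * Δ`, the union bound is a product over the blocks,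
and `Sparse.block` gives a factor `1/2` for each. What remains is the cost of the root. -/
theorem card_long_le (hL : LinearEdges n k Δ L) (h : Sparse k Δ) {t₀ : ℕ} (hn : n ≤ t₀ + 1)
    (l : ℕ) : ((Finset.range (t₀ + 1)).powerset.filter fun r =>
      budget k Δ (Nat.sqrt k) l < (explore (ofSet r) n L t₀).ord.length).card * 2 ^ l ≤
    7 * k ^ 6 * Δ ^ 2 * 2 ^ (t₀ + 1) := by
  set bad := (Finset.range (t₀ + 1)).powerset.filter fun r =>
      budget k Δ (Nat.sqrt k) l < (explore (ofSet r) n L t₀).ord.length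
  set θ := Nat.sqrt k
  have h0 := h.six_le
  have h1 := card_long_explorations hL hn (θ := θ) (by omega) l bad fun r hr =>
    ⟨Finset.mem_powerset.1 (Finset.mem_filter.1 hr).1, (Finset.mem_filter.1 hr).2⟩
  set D := 7 * k ^ 6 * Δ with hD
  have hk : 6 ≤ k := by
    have := Nat.sqrt_le_self k
    omega
  have hkΔ : 6 ≤ k ^ 6 * Δ := by
    calc 6 ≤ k := hk
      _ ≤ k ^ 6 := Nat.le_self_pow (by norm_num) k
      _ ≤ k ^ 6 * Δ := Nat.le_mul_of_pos_right _ h.pos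
  have h2 : (3 * (k ^ 6 * Δ + 1)) ^ (l * (θ + 1) + 1) * 2 ^ (l * (θ + 1) + 1) ≤
      D ^ (l * (θ + 1) + 1) := by
    rw [← mul_pow]
    refine Nat.pow_le_pow_left ?_ _
    rw [hD, mul_assoc 7]; omega
  have h3 : (D ^ (θ + 1) * 2) ^ l ≤ 2 ^ (l * (θ * (k - θ))) := by
    rw [mul_comm l, pow_mul]
    exact Nat.pow_le_pow_left h.block l
  have h4 : bad.card * 2 ^ l * 2 ^ (l * (θ * (k - θ))) ≤
      7 * k ^ 6 * Δ ^ 2 * 2 ^ (t₀ + 1) * 2 ^ (l * (θ * (k - θ))) := by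
    calc bad.card * 2 ^ l * 2 ^ (l * (θ * (k - θ)))
        = bad.card * 2 ^ (l * (θ * (k - θ))) * 2 ^ l := by ring
      _ ≤ (Δ * (D ^ (l * (θ + 1) + 1) * 2 ^ (t₀ + 1))) * 2 ^ l := by
          refine Nat.mul_le_mul_right _ (h1.trans ?_)
          gcongr
      _ = Δ * D * 2 ^ (t₀ + 1) * (D ^ (θ + 1) * 2) ^ l := by
          rw [mul_pow (D ^ (θ + 1)), ← pow_mul, pow_succ D, mul_comm l (θ + 1)]; ring
      _ ≤ Δ * D * 2 ^ (t₀ + 1) * 2 ^ (l * (θ * (k - θ))) := by gcongr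
      _ = _ := by rw [hD]; ring
  exact Nat.le_of_mul_le_mul_right h4 (by positivity)

theorem abs_vacant_sub_marginal_le (hL : LinearEdges n k Δ L) (h : Sparse k Δ) (hn : 0 < n)
    (l : ℕ) {t₀ : ℕ} (ht₀ : (budget k Δ (Nat.sqrt k) l + 1) * n ≤ t₀) :
    |(((Finset.range (2 ^ budget k Δ (Nat.sqrt k) l)).filter (Vacant n L t₀)).card : ℝ) /
        2 ^ budget k Δ (Nat.sqrt k) l -
      ((indepSets n L).filter (t₀ % n ∉ ·)).card / (indepSets n L).card| ≤
    14 * k ^ 6 * Δ ^ 2 / 2 ^ l := by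
  refine (abs_vacant_sub_marginal hL hn h.pos_k ht₀).trans ?_
  have h1 := card_long_le hL h (t₀ := t₀) (by nlinarith) l
  have h2 : ((((Finset.range (t₀ + 1)).powerset.filter fun r =>
      budget k Δ (Nat.sqrt k) l < (explore (ofSet r) n L t₀).ord.length).card : ℕ) : ℝ) * 2 ^ l ≤
    7 * k ^ 6 * Δ ^ 2 * 2 ^ (t₀ + 1) := by exact_mod_cast h1
  rw [← mul_div_assoc, div_le_div_iff₀ (by positivity) (by positivity)]
  linarith

/-! ### Self-reducibility -/

/-- The hyperedges all of whose vertices are at least `i`. -/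
def tailEdges (L : List (List ℕ)) (i : ℕ) : List (List ℕ) :=
  L.filter fun l => decide (∀ u ∈ l, i ≤ u)

theorem mem_tailEdges {i : ℕ} {l : List ℕ} : l ∈ tailEdges L i ↔ l ∈ L ∧ ∀ u ∈ l, i ≤ u := by
  simp [tailEdges]

theorem tailEdges_zero : tailEdges L 0 = L := by simp [tailEdges]

theorem _root_.Percolation.LinearEdges.tailEdges (hL : LinearEdges n k Δ L) (i : ℕ) :
    LinearEdges n k Δ (tailEdges L i) where
  edge_nodup l hl := hL.edge_nodup l (mem_tailEdges.1 hl).1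
  length l hl := hL.length l (mem_tailEdges.1 hl).1
  lt l hl := hL.lt l (mem_tailEdges.1 hl).1
  linear l hl l' hl' := hL.linear l (mem_tailEdges.1 hl).1 l' (mem_tailEdges.1 hl').1
  degree u := by
    refine (Finset.card_le_card fun l hl => ?_).trans (hL.degree u)
    rw [Finset.mem_filter, List.mem_toFinset] at hl ⊢
    exact ⟨(mem_tailEdges.1 hl.1).1, hl.2⟩

theorem indep_tailEdges_of_notMem {i : ℕ} {X : Finset ℕ} (hi : i ∉ X) :
    Indep (tailEdges L i) X ↔ Indep (tailEdges L (i + 1)) X := by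
  constructor
  · intro h l hl
    rw [mem_tailEdges] at hl
    exact h l (mem_tailEdges.2 ⟨hl.1, fun u hu => by have := hl.2 u hu; omega⟩)
  · intro h l hl
    rw [mem_tailEdges] at hl
    by_cases hil : i ∈ l
    · exact ⟨i, hil, hi⟩
    · refine h l (mem_tailEdges.2 ⟨hl.1, fun u hu => ?_⟩)
      have := hl.2 u hu
      rcases this.eq_or_lt with rfl | h
      · exact absurd hu hil
      · exact h

theorem indep_tailEdges_insert {i : ℕ} {X : Finset ℕ} :
    Indep (tailEdges L (i + 1)) (insert i X) ↔ Indep (tailEdges L (i + 1)) X := by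
  refine forall₂_congr fun l hl => exists_congr fun w => and_congr_right fun hw => ?_
  have := (mem_tailEdges.1 hl).2 w hw
  rw [Finset.mem_insert, not_or]
  exact and_iff_right (by omega)

/-- A set avoiding `i` violates no hyperedge through `i`, so these may be deleted. Afterwards `i` is
a free vertex, and exactly half of the independent sets avoid it. -/
theorem two_mul_card_vacant {i : ℕ} (hi : i < n) :
    2 * ((indepSets n (tailEdges L i)).filter (i ∉ ·)).card =
      (indepSets n (tailEdges L (i + 1))).card := by
  have h1 : (indepSets n (tailEdges L i)).filter (i ∉ ·) =
      (indepSets n (tailEdges L (i + 1))).filter (i ∉ ·) := by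
    ext X
    simp only [Finset.mem_filter, mem_indepSets]
    constructor
    · rintro ⟨⟨h1, h2⟩, h3⟩
      exact ⟨⟨h1, (indep_tailEdges_of_notMem h3).1 h2⟩, h3⟩
    · rintro ⟨⟨h1, h2⟩, h3⟩
      exact ⟨⟨h1, (indep_tailEdges_of_notMem h3).2 h2⟩, h3⟩
  have h2 : ((indepSets n (tailEdges L (i + 1))).filter (i ∈ ·)).card =
      ((indepSets n (tailEdges L (i + 1))).filter (i ∉ ·)).card := by
    refine Finset.card_nbij' (fun X => X.erase i) (fun X => insert i X) ?_ ?_ ?_ ?_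
    · intro X hX
      simp only [Finset.coe_filter, Set.mem_ofPred_eq, mem_indepSets] at hX ⊢
      exact ⟨⟨(Finset.erase_subset _ _).trans hX.1.1, hX.1.2.mono (Finset.erase_subset _ _)⟩,
        by simp⟩
    · intro X hX
      simp only [Finset.coe_filter, Set.mem_ofPred_eq, mem_indepSets] at hX ⊢
      exact ⟨⟨Finset.insert_subset (Finset.mem_range.2 hi) hX.1.1,
        indep_tailEdges_insert.2 hX.1.2⟩, by simp⟩
    · intro X hX
      simp only [Finset.coe_filter, Set.mem_ofPred_eq] at hX
      exact Finset.insert_erase hX.2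
    · intro X hX
      simp only [Finset.coe_filter, Set.mem_ofPred_eq] at hX
      exact Finset.erase_insert hX.2
  have h3 := Finset.card_filter_add_card_filter_not (s := indepSets n (tailEdges L (i + 1)))
    (fun X => i ∈ X)
  rw [h1]
  omega

theorem card_indepSets_tailEdges_le (i : ℕ) :
    (indepSets n (tailEdges L i)).card ≤ (indepSets n (tailEdges L (i + 1))).card := by
  refine Finset.card_le_card fun X hX => ?_
  rw [mem_indepSets] at hX ⊢
  refine ⟨hX.1, fun l hl => hX.2 l ?_⟩
  rw [mem_tailEdges] at hl ⊢
  exact ⟨hl.1, fun u hu => by have := hl.2 u hu; omega⟩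

theorem card_indepSets_tailEdges_self (hL : LinearEdges n k Δ L) (hk : 0 < k) :
    (indepSets n (tailEdges L n)).card = 2 ^ n := by
  have : tailEdges L n = [] := by
    rw [List.eq_nil_iff_forall_not_mem]
    intro l hl
    rw [mem_tailEdges] at hl
    obtain ⟨u, hu⟩ := List.exists_mem_of_length_pos
        (by rw [hL.length l hl.1]; exact hk : 0 < l.length)
    have := hL.lt l hl.1 u hu
    have := hl.2 u hu
    omega
  rw [this, indepSets, Finset.filter_true_of_mem]
  · simp
  · intro X _ l hl
    simp at hl

theorem card_indepSets_pos (hL : LinearEdges n k Δ L) (hk : 0 < k) : 0 < (indepSets n L).card := by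
  refine Finset.card_pos.2 ⟨∅, mem_indepSets.2 ⟨by simp, fun l hl => ?_⟩⟩
  obtain ⟨w, hw⟩ := List.exists_mem_of_length_pos (by rw [hL.length l hl]; exact hk : 0 < l.length)
  exact ⟨w, hw, by simp⟩

/-- The marginal probability that `i` is unoccupied when the smaller vertices are. -/
noncomputable def marginal (n : ℕ) (L : List (List ℕ)) (i : ℕ) : ℝ :=
  ((indepSets n (tailEdges L i)).filter (i ∉ ·)).card / (indepSets n (tailEdges L i)).card

theorem half_le_marginal (hL : LinearEdges n k Δ L) (hk : 0 < k) {i : ℕ} (hi : i < n) :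
    1 / 2 ≤ marginal n L i := by
  have h1 := card_indepSets_pos (hL.tailEdges i) hk
  have h2 := two_mul_card_vacant (L := L) hi
  have h3 := card_indepSets_tailEdges_le (n := n) (L := L) i
  rw [marginal, div_le_div_iff₀ (by norm_num) (by exact_mod_cast h1)]
  rw [← h2] at h3
  have : ((indepSets n (tailEdges L i)).card : ℝ) ≤
      2 * ((indepSets n (tailEdges L i)).filter (i ∉ ·)).card := by exact_mod_cast h3
  linarith

/-- By `two_mul_card_vacant` the factors telescope, each step leaving a factor `1/2`, and `2 ^ n`
sets remain when no hyperedge is left. -/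
theorem prod_marginal (hL : LinearEdges n k Δ L) (hk : 0 < k) :
    ∏ i ∈ Finset.range n, marginal n L i = 1 / (indepSets n L).card := by
  have key : ∀ m ≤ n, ∏ i ∈ Finset.range m, marginal n L i =
      (indepSets n (tailEdges L m)).card / (2 ^ m * (indepSets n L).card) := by
    intro m
    have h0 : ((indepSets n L).card : ℝ) ≠ 0 := by exact_mod_cast (card_indepSets_pos hL hk).ne'
    induction m with
    | zero => intro _; simp [tailEdges_zero, h0]
    | succ m ih =>
      intro hm
      have h1 : ((indepSets n (tailEdges L m)).card : ℝ) ≠ 0 := by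
        exact_mod_cast (card_indepSets_pos (hL.tailEdges m) hk).ne'
      rw [Finset.prod_range_succ, ih (by omega), marginal, ← two_mul_card_vacant (by omega : m < n)]
      push_cast
      field_simp
      ring
  rw [key n le_rfl, card_indepSets_tailEdges_self hL hk]
  have h0 : ((indepSets n L).card : ℝ) ≠ 0 := by exact_mod_cast (card_indepSets_pos hL hk).ne'
  push_cast
  field_simp

/-- As `b i ≥ 1/4`, each ratio differs from `1` by at most `4 * η`. The product then differs from
`1` by at most `exp x - 1 ≤ 2 * x`, where `x ≤ 1` is the sum of the deviations. The bound `η ≤ 1/4`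
is required only below `n`, so that `n = 0` is covered. -/
theorem abs_prod_div_sub_one_le {n : ℕ} {a b : ℕ → ℝ} {η : ℝ}
    (ha : ∀ i < n, 1 / 2 ≤ a i) (hη : ∀ i < n, η ≤ 1 / 4) (hη0 : 0 ≤ η) (hn : 4 * η * n ≤ 1)
    (hab : ∀ i < n, |b i - a i| ≤ η) :
    |(∏ i ∈ Finset.range n, a i / b i) - 1| ≤ 8 * η * n := by
  have hb : ∀ i < n, 1 / 4 ≤ b i := by
    intro i hi
    have := (abs_le.1 (hab i hi)).1
    linarith [ha i hi, hη i hi]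
  have hx : ∀ i ∈ Finset.range n, ‖a i / b i - 1‖ ≤ 4 * η := by
    intro i hi
    rw [Finset.mem_range] at hi
    have hbi := hb i hi
    rw [Real.norm_eq_abs, div_sub_one (by linarith), abs_div, abs_sub_comm,
      abs_of_pos (by linarith : 0 < b i), div_le_iff₀ (by linarith)]
    have := hab i hi
    nlinarith
  have h1 := Finset.norm_prod_one_add_sub_one_le (Finset.range n) fun i => a i / b i - 1
  simp only [add_sub_cancel] at h1
  have h2 : ∑ i ∈ Finset.range n, ‖a i / b i - 1‖ ≤ 4 * η * n := by
    have := Finset.sum_le_card_nsmul _ _ _ hx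
    rw [Finset.card_range, nsmul_eq_mul] at this
    linarith
  have h0 : 0 ≤ ∑ i ∈ Finset.range n, ‖a i / b i - 1‖ := Finset.sum_nonneg fun _ _ => norm_nonneg _
  have h3 := Real.abs_exp_sub_one_le (x := ∑ i ∈ Finset.range n, ‖a i / b i - 1‖)
    (by rw [abs_of_nonneg h0]; linarith)
  rw [abs_of_nonneg h0] at h3
  calc _ ≤ Real.exp (∑ i ∈ Finset.range n, ‖a i / b i - 1‖) - 1 := h1
    _ ≤ _ := le_abs_self _
    _ ≤ _ := h3
    _ ≤ _ := by linarith

/-- The number of vacant runs for the vertex `i`. -/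
def vacantCount (n : ℕ) (L : List (List ℕ)) (s i : ℕ) : ℕ :=
  ((Finset.range (2 ^ s)).filter (Vacant n (tailEdges L i) ((s + 1) * n + i))).card

/-- The product of the estimated marginals approximates the number of independent sets. -/
theorem abs_estimate_sub_le (hL : LinearEdges n k Δ L) (h : Sparse k Δ) (l p q : ℕ) (hp : 0 < p)
    (hq : 0 < q) (hl : 112 * k ^ 6 * Δ ^ 2 * n ≤ 2 ^ l)
    (hl' : 112 * k ^ 6 * Δ ^ 2 * n * q ≤ 2 ^ l * p) :
    (∏ i ∈ Finset.range n, vacantCount n L (budget k Δ (Nat.sqrt k) l) i) ≠ 0 ∧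
    |(((2 ^ budget k Δ (Nat.sqrt k) l) ^ n : ℕ) : ℝ) /
        (∏ i ∈ Finset.range n, vacantCount n L (budget k Δ (Nat.sqrt k) l) i : ℕ) -
      (indepSets n L).card| ≤ (p : ℝ) / q * (indepSets n L).card := by
  set s := budget k Δ (Nat.sqrt k) l
  have hk := h.pos_k
  have hpR : (0 : ℝ) < p := by exact_mod_cast hp
  have hqR : (0 : ℝ) < q := by exact_mod_cast hq
  -- The constant in `hl` and `hl'` is `112 = 8 * 14`, so that `8 * η * n` is at most both `1` and
  -- `p / q`.
  set η : ℝ := 14 * k ^ 6 * Δ ^ 2 / 2 ^ l with hη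
  have hη0 : 0 ≤ η := by positivity
  have hηn : 8 * η * n ≤ 1 := by
    have : (112 * (k : ℝ) ^ 6 * Δ ^ 2 * n) ≤ 2 ^ l := by exact_mod_cast hl
    rw [hη, mul_div_assoc', div_mul_eq_mul_div, div_le_one (by positivity)]
    linarith
  have hηε : 8 * η * n ≤ p / q := by
    have : (112 * (k : ℝ) ^ 6 * Δ ^ 2 * n) * q ≤ 2 ^ l * p := by exact_mod_cast hl'
    rw [hη, mul_div_assoc', div_mul_eq_mul_div, div_le_div_iff₀ (by positivity) hqR]
    linarith
  have hη4 : ∀ i < n, η ≤ 1 / 4 := by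
    intro i hi
    have : (1 : ℝ) ≤ n := by exact_mod_cast (show 1 ≤ n by omega)
    nlinarith
  have hab : ∀ i < n, |(vacantCount n L s i : ℝ) / 2 ^ s - marginal n L i| ≤ η := by
    intro i hi
    -- The final time is chosen such that the last update concerns `i` and at least `s + 1` full
    -- rounds precede it.
    have hmod : ((s + 1) * n + i) % n = i := by
      rw [add_comm, Nat.add_mul_mod_self_right, Nat.mod_eq_of_lt hi]
    have h1 := abs_vacant_sub_marginal_le (hL.tailEdges i) h (by omega : 0 < n) l
      (t₀ := (s + 1) * n + i) (Nat.le_add_right _ _)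
    rw [hmod] at h1
    exact h1
  have hhalf : ∀ i < n, 1 / 2 ≤ marginal n L i := fun i hi => half_le_marginal hL hk hi
  have hpos : ∀ i ∈ Finset.range n, vacantCount n L s i ≠ 0 := by
    intro i hi h0
    rw [Finset.mem_range] at hi
    have h1 := hab i hi
    rw [h0, Nat.cast_zero, zero_div, zero_sub, abs_neg, abs_le] at h1
    linarith [hhalf i hi, hη4 i hi, h1.2]
  refine ⟨Finset.prod_ne_zero_iff.2 hpos, ?_⟩
  have h1 := abs_prod_div_sub_one_le hhalf hη4 hη0 (by nlinarith) hab
  rw [Finset.prod_div_distrib, prod_marginal hL hk, Finset.prod_div_distrib, Finset.prod_const,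
    Finset.card_range] at h1
  have hz : (0 : ℝ) < (indepSets n L).card := by exact_mod_cast card_indepSets_pos hL hk
  have hden : (∏ i ∈ Finset.range n, (vacantCount n L s i : ℝ)) ≠ 0 := by
    rw [Finset.prod_ne_zero_iff]
    intro i hi
    exact_mod_cast hpos i hi
  have h2 : (((2 ^ s) ^ n : ℕ) : ℝ) / (∏ i ∈ Finset.range n, vacantCount n L s i : ℕ) -
      (indepSets n L).card = (1 / (indepSets n L).card /
        ((∏ i ∈ Finset.range n, (vacantCount n L s i : ℝ)) / (2 ^ s) ^ n) - 1) *
          (indepSets n L).card := by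
    push_cast
    field_simp
  rw [h2, abs_mul, abs_of_pos hz]
  gcongr
  exact h1.trans hηε

end Exploration

/-! ### A program logic with time bounds, and the layout of the memory. -/

namespace RAM

infixr:67 " ;; " => Prog.seq

/-- Started in `s`, the program `P` halts after at most `T` steps in a state satisfying `Q`. -/
def Runs (P : Prog) (s : State) (T : ℕ) (Q : State → Prop) : Prop :=
  ∃ t s', Exec P s t s' ∧ t ≤ T ∧ Q s'

@[simp] theorem State.setReg_reg (s : State) (a x b : ℕ) :
    (s.setReg a x).reg b = if b = a then x else s.reg b := by
  simp [State.setReg, Function.update_apply]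

@[simp] theorem State.setReg_mem (s : State) (a x : ℕ) : (s.setReg a x).mem = s.mem := rfl

@[simp] theorem State.setMem_reg (s : State) (a x : ℕ) : (s.setMem a x).reg = s.reg := rfl

@[simp] theorem State.setMem_mem (s : State) (a x : ℕ) :
    (s.setMem a x).mem = Function.update s.mem a x := rfl

theorem Runs.mono {P : Prog} {s : State} {T T' : ℕ} {Q Q' : State → Prop} (h : Runs P s T Q)
    (hT : T ≤ T') (hQ : ∀ s', Q s' → Q' s') : Runs P s T' Q' := by
  obtain ⟨t, s', h1, h2, h3⟩ := h
  exact ⟨t, s', h1, h2.trans hT, hQ s' h3⟩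

theorem Runs.le {P : Prog} {s : State} {T T' : ℕ} {Q : State → Prop} (h : Runs P s T Q)
    (hT : T ≤ T') : Runs P s T' Q := h.mono hT fun _ => id

theorem Runs.seq {P P' : Prog} {s : State} {T T' : ℕ} {Q R : State → Prop} (h : Runs P s T Q)
    (h' : ∀ s', Q s' → Runs P' s' T' R) : Runs (P ;; P') s (T + T') R := by
  obtain ⟨t, s', h1, h2, h3⟩ := h
  obtain ⟨t', s'', h4, h5, h6⟩ := h' s' h3
  exact ⟨t + t', s'', .seq h1 h4, by omega, h6⟩

theorem Runs.skip {s : State} {Q : State → Prop} (h : Q s) : Runs .skip s 1 Q :=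
  ⟨1, s, .skip s, le_rfl, h⟩

theorem Runs.const {a c : ℕ} {s : State} {Q : State → Prop} (h : Q (s.setReg a c)) :
    Runs (.const a c) s 1 Q := ⟨1, _, .const a c s, le_rfl, h⟩

theorem Runs.plus {a b c : ℕ} {s : State} {Q : State → Prop}
    (h : Q (s.setReg a (s.reg b + s.reg c))) : Runs (.plus a b c) s 1 Q :=
  ⟨1, _, .plus a b c s, le_rfl, h⟩

theorem Runs.minus {a b c : ℕ} {s : State} {Q : State → Prop}
    (h : Q (s.setReg a (s.reg b - s.reg c))) : Runs (.minus a b c) s 1 Q :=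
  ⟨1, _, .minus a b c s, le_rfl, h⟩

theorem Runs.load {a b : ℕ} {s : State} {Q : State → Prop}
    (h : Q (s.setReg a (s.mem (s.reg b)))) : Runs (.load a b) s 1 Q :=
  ⟨1, _, .load a b s, le_rfl, h⟩

theorem Runs.store {a b : ℕ} {s : State} {Q : State → Prop}
    (h : Q (s.setMem (s.reg a) (s.reg b))) : Runs (.store a b) s 1 Q :=
  ⟨1, _, .store a b s, le_rfl, h⟩

section

variable {P : Prog} {s : State} {T : ℕ} {R : State → Prop}

theorem Runs.const_seq {a c : ℕ} (h : Runs P (s.setReg a c) T R) :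
    Runs (.const a c ;; P) s (1 + T) R :=
  (Runs.const (Q := (· = s.setReg a c)) rfl).seq fun _ h' => h' ▸ h

theorem Runs.plus_seq {a b c : ℕ} (h : Runs P (s.setReg a (s.reg b + s.reg c)) T R) :
    Runs (.plus a b c ;; P) s (1 + T) R :=
  (Runs.plus (Q := (· = s.setReg a (s.reg b + s.reg c))) rfl).seq fun _ h' => h' ▸ h

theorem Runs.minus_seq {a b c : ℕ} (h : Runs P (s.setReg a (s.reg b - s.reg c)) T R) :
    Runs (.minus a b c ;; P) s (1 + T) R :=
  (Runs.minus (Q := (· = s.setReg a (s.reg b - s.reg c))) rfl).seq fun _ h' => h' ▸ h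

theorem Runs.load_seq {a b : ℕ} (h : Runs P (s.setReg a (s.mem (s.reg b))) T R) :
    Runs (.load a b ;; P) s (1 + T) R :=
  (Runs.load (Q := (· = s.setReg a (s.mem (s.reg b)))) rfl).seq fun _ h' => h' ▸ h

theorem Runs.store_seq {a b : ℕ} (h : Runs P (s.setMem (s.reg a) (s.reg b)) T R) :
    Runs (.store a b ;; P) s (1 + T) R :=
  (Runs.store (Q := (· = s.setMem (s.reg a) (s.reg b))) rfl).seq fun _ h' => h' ▸ h

theorem Runs.ite {a : ℕ} {P' : Prog} {T' : ℕ} (h : s.reg a ≠ 0 → Runs P s T R)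
    (h' : s.reg a = 0 → Runs P' s T' R) : Runs (.ite a P P') s (T + T' + 1) R := by
  by_cases ha : s.reg a = 0
  · obtain ⟨t, s', h1, h2, h3⟩ := h' ha
    exact ⟨t + 1, s', .iteElse ha h1, by omega, h3⟩
  · obtain ⟨t, s', h1, h2, h3⟩ := h ha
    exact ⟨t + 1, s', .iteThen ha h1, by omega, h3⟩

/-- A loop whose remaining iterations are indexed by the elements of a list. -/
theorem Runs.loop_list {α : Type*} {a τ : ℕ} (I : List α → State → Prop)
    (h0 : ∀ s, I [] s → s.reg a = 0)
    (hs : ∀ x xs s, I (x :: xs) s → s.reg a ≠ 0 ∧ Runs P s τ (I xs)) {xs : List α}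
    (h : I xs s) : Runs (.loop a P) s (xs.length * (τ + 1) + 1) (I []) := by
  induction xs generalizing s with
  | nil => exact ⟨1, s, .loopStop (h0 s h), by simp, h⟩
  | cons x xs ih =>
    obtain ⟨h1, t, s', h2, h3, h4⟩ := hs x xs s h
    obtain ⟨t', s'', h5, h6, h7⟩ := ih h4
    refine ⟨t + t' + 1, s'', .loopStep h1 h2 h5, ?_, h7⟩
    rw [List.length_cons, add_mul, one_mul]
    omega

/-- A loop with a known number of iterations. -/
theorem Runs.loop {a τ : ℕ} (I : ℕ → State → Prop) (h0 : ∀ s, I 0 s → s.reg a = 0)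
    (hs : ∀ m s, I (m + 1) s → s.reg a ≠ 0 ∧ Runs P s τ (I m)) {m : ℕ} (h : I m s) :
    Runs (.loop a P) s (m * (τ + 1) + 1) (I 0) := by
  have := Runs.loop_list (a := a) (P := P) (s := s) (τ := τ) (xs := List.replicate m ())
    (fun xs => I xs.length) h0 (fun x xs s h => by simpa using hs xs.length s (by simpa using h))
    (by simpa using h)
  simpa using this

end

/-- The registers below `b` have not changed. -/
def Frame (b : ℕ) (s s' : State) : Prop := ∀ r < b, s'.reg r = s.reg r

theorem Frame.refl (b : ℕ) (s : State) : Frame b s s := fun _ _ => rfl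

theorem Frame.trans {b : ℕ} {s s' s'' : State} (h : Frame b s s') (h' : Frame b s' s'') :
    Frame b s s'' := fun r hr => (h' r hr).trans (h r hr)

theorem Frame.mono {b c : ℕ} {s s' : State} (h : Frame c s s') (hbc : b ≤ c) : Frame b s s' :=
  fun r hr => h r (by omega)

theorem Frame.setReg {b a x : ℕ} {s s' : State} (h : Frame b s s') (ha : b ≤ a) :
    Frame b s (s'.setReg a x) := fun r hr => by
  rw [State.setReg_reg, if_neg (by omega), h r hr]

theorem Frame.setMem {b a x : ℕ} {s s' : State} (h : Frame b s s') :
    Frame b s (s'.setMem a x) := fun r hr => h r hr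

/-- Below `B` the memory holds `inp`; from there on it interleaves `K` and `X`. -/
def layout (B : ℕ) (inp K X : ℕ → ℕ) (a : ℕ) : ℕ :=
  if a < B then inp a else if (a - B) % 2 = 0 then K ((a - B) / 2) else X ((a - B) / 2)

section

variable {B : ℕ} {inp K X : ℕ → ℕ}

theorem layout_inp {a : ℕ} (h : a < B) : layout B inp K X a = inp a := if_pos h

-- Addresses are written as iterated sums because the machine has no multiplication.
@[simp] theorem layout_K (x : ℕ) : layout B inp K X (B + x + x) = K x := by
  rw [layout, if_neg (by omega), if_pos (by omega)]
  congr 1; omega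

@[simp] theorem layout_X (u : ℕ) : layout B inp K X (B + u + u + 1) = X u := by
  rw [layout, if_neg (by omega), if_neg (by omega)]
  congr 1; omega

@[simp] theorem update_layout_K (x v : ℕ) : Function.update (layout B inp K X) (B + x + x) v =
    layout B inp (Function.update K x v) X := by
  ext a
  simp only [Function.update_apply, layout]
  split_ifs <;> first | rfl | omega

@[simp] theorem update_layout_X (u v : ℕ) :
    Function.update (layout B inp K X) (B + u + u + 1) v =
    layout B inp K (Function.update X u v) := by
  ext a
  simp only [Function.update_apply, layout]
  split_ifs <;> first | rfl | omega

theorem update_layout_inp {a : ℕ} (v : ℕ) (h : a < B) : Function.update (layout B inp K X) a v =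
    layout B (Function.update inp a v) K X := by
  ext b
  simp only [Function.update_apply, layout]
  split_ifs <;> first | rfl | omega

end

/-- The list is stored in the memory from address `a` on, below the address `B`. -/
def ListAt (mem : ℕ → ℕ) (B a : ℕ) : List ℕ → Prop
  | [] => True
  | x :: l => a < B ∧ mem a = x ∧ ListAt mem B (a + 1) l

theorem ListAt.congr {mem mem' : ℕ → ℕ} {B a : ℕ} {l : List ℕ} (h : ListAt mem B a l)
    (hmem : ∀ b < B, a ≤ b → b < a + l.length → mem' b = mem b) : ListAt mem' B a l := by
  induction l generalizing a with
  | nil => trivial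
  | cons x l ih =>
    refine ⟨h.1, (hmem a h.1 le_rfl (by simp)).trans h.2.1, ih h.2.2 fun b hb h1 h2 => ?_⟩
    exact hmem b hb (by omega) (by rw [List.length_cons]; omega)

/-- The hyperedges are stored in the memory from address `a` on, below the address `B`, each as a
flag that tells whether all its vertices are at least `i`, followed by its vertices. -/
def EdgesAt (mem : ℕ → ℕ) (B i a : ℕ) : List (List ℕ) → Prop
  | [] => True
  | l :: L => a < B ∧ (mem a ≠ 0 ↔ ∀ u ∈ l, i ≤ u) ∧ ListAt mem B (a + 1) l ∧
      EdgesAt mem B i (a + 1 + l.length) L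

theorem EdgesAt.congr {mem mem' : ℕ → ℕ} {B i a k : ℕ} {L : List (List ℕ)}
    (hk : ∀ l ∈ L, l.length = k) (h : EdgesAt mem B i a L)
    (hmem : ∀ b < B, a ≤ b → b < a + L.length * (k + 1) → mem' b = mem b) :
    EdgesAt mem' B i a L := by
  induction L generalizing a with
  | nil => trivial
  | cons l L ih =>
    have hl := hk l (by simp)
    have hlen : (l :: L).length * (k + 1) = L.length * (k + 1) + (k + 1) := by
      rw [List.length_cons, add_mul, one_mul]
    refine ⟨h.1, ?_, h.2.2.1.congr fun b hb h1 h2 => hmem b hb (by omega) (by omega),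
      ih (fun l' hl' => hk l' (by simp [hl'])) h.2.2.2 fun b hb h1 h2 =>
        hmem b hb (by omega) (by omega)⟩
    rw [hmem a h.1 le_rfl (by omega)]
    exact h.2.1

/-- Global constants: register 2 holds `1`, register 15 holds `0`, and the registers 3, 4, 5, 13
hold the number of vertices, the number of hyperedges, the end of the input and the length of the
description of a hyperedge. -/
structure Env (n m B k : ℕ) (s : State) : Prop where
  one : s.reg 2 = 1
  n : s.reg 3 = n
  m : s.reg 4 = m
  base : s.reg 5 = B
  stride : s.reg 13 = k + 1
  zero : s.reg 15 = 0

theorem Env.frame {n m B k b : ℕ} {s s' : State} (h : Env n m B k s) (hf : Frame b s s')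
    (hb : 16 ≤ b) : Env n m B k s' where
  one := (hf 2 (by omega)).trans h.one
  n := (hf 3 (by omega)).trans h.n
  m := (hf 4 (by omega)).trans h.m
  base := (hf 5 (by omega)).trans h.base
  stride := (hf 13 (by omega)).trans h.stride
  zero := (hf 15 (by omega)).trans h.zero

/-- Run `body` for the words stored from the address in register 26 on, as many as register 25
says, with the current word in register 28. -/
def forWords (body : Prog) : Prog :=
  .loop 25 (.load 28 26 ;; body ;; .plus 26 26 2 ;; .minus 25 25 2)

/-- The invariant `J` refers to the words still to be treated. By `hJ` it ignores the registers of
the loop; the body in turn must leave the loop counter, the address and the memory below `B` alone.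
-/
theorem runs_forWords {body : Prog} {τ B : ℕ} (J : List ℕ → State → Prop)
    (hJ : ∀ l s s', J l s → (∀ r, r ≠ 25 → r ≠ 26 → r ≠ 28 → s'.reg r = s.reg r) →
      s'.mem = s.mem → J l s')
    (hbody : ∀ w l s, J (w :: l) s → s.reg 28 = w → s.reg 2 = 1 → Runs body s τ fun s' =>
      J l s' ∧ s'.reg 25 = s.reg 25 ∧ s'.reg 26 = s.reg 26 ∧ s'.reg 2 = 1 ∧
        ∀ a < B, s'.mem a = s.mem a)
    {l : List ℕ} {a : ℕ} {s : State} (h : J l s) (h25 : s.reg 25 = l.length) (h26 : s.reg 26 = a)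
    (h2 : s.reg 2 = 1) (hl : ListAt s.mem B a l) :
    Runs (forWords body) s (l.length * (τ + 4) + 1) fun s' =>
      J [] s' ∧ ∀ a < B, s'.mem a = s.mem a := by
  refine (Runs.loop_list (xs := l) (τ := τ + 3) (fun l s' => J l s' ∧ s'.reg 25 = l.length ∧
    s'.reg 2 = 1 ∧ ListAt s'.mem B (s'.reg 26) l ∧ ∀ a < B, s'.mem a = s.mem a) ?_ ?_
    ⟨h, h25, h2, by rwa [h26], fun _ _ => rfl⟩).mono le_rfl fun s' hs' => ⟨hs'.1, hs'.2.2.2.2⟩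
  · rintro s' ⟨-, h, -⟩
    simpa using h
  · rintro w l s' ⟨h3, h4, h5, h6, h7⟩
    refine ⟨by rw [h4]; simp, ?_⟩
    have hw : s'.mem (s'.reg 26) = w := h6.2.1
    refine Runs.le (T := 1 + (τ + (1 + 1))) ?_ (by omega)
    refine Runs.load_seq (Runs.seq (hbody w l _ (hJ _ _ _ h3 ?_ rfl) (by simpa using hw)
      (by simpa using h5)) ?_)
    · intro r h25 h26 h28
      simp [h28]
    · rintro s1 ⟨h8, h9, h10, h11, h12⟩
      simp only [State.setReg_reg, State.setReg_mem] at h9 h10 h12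
      refine Runs.plus_seq (Runs.minus ⟨hJ _ _ _ h8 ?_ rfl, ?_, ?_, ?_, ?_⟩)
      · intro r h25 h26 h28
        simp [h25, h26]
      · simp [h9, h4, h11]
      · simp [h11]
      · simp only [State.setReg_reg, State.setReg_mem]
        norm_num
        rw [h10, h11]
        exact h6.2.2.congr fun b hb _ _ => by simpa using h12 b hb
      · intro b hb
        simpa using (h12 b hb).trans (h7 b hb)

/-- Run `body` for all hyperedges whose flag is set, with the address of the flag in
register 22. -/
def forEdges (body : Prog) : Prog :=
  .const 22 4 ;; .plus 23 4 15 ;;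
  .loop 23 (.load 24 22 ;; .ite 24 body .skip ;; .plus 22 22 13 ;; .minus 23 23 2)

-- Here `J` refers to the remaining hyperedges whose flag is set. `Frame 24` protects the address
-- and the counter of the loop from the body, and fixing the memory below `B` protects the stored
-- hyperedges.
open Exploration in
theorem runs_forEdges {body : Prog} {τ B i n k : ℕ} {L : List (List ℕ)}
    (J : List (List ℕ) → State → Prop)
    (hJ : ∀ M s s', J M s → (∀ r, r ≠ 22 → r ≠ 23 → r ≠ 24 → s'.reg r = s.reg r) →
      s'.mem = s.mem → J M s')
    (hbody : ∀ l M s, l ∈ tailEdges L i → J (l :: M) s → Env n L.length B k s →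
      ListAt s.mem B (s.reg 22 + 1) l →
      Runs body s τ fun s' => J M s' ∧ Frame 24 s s' ∧ ∀ a < B, s'.mem a = s.mem a)
    (hk : ∀ l ∈ L, l.length = k) {s : State} (h : J (tailEdges L i) s) (henv : Env n L.length B k s)
    (hL : EdgesAt s.mem B i 4 L) :
    Runs (forEdges body) s (L.length * (τ + 6) + 3) fun s' =>
      J [] s' ∧ Frame 22 s s' ∧ ∀ a < B, s'.mem a = s.mem a := by
  refine Runs.le (T := 1 + (1 + (L.length * (τ + 5 + 1) + 1))) (.const_seq (.plus_seq ?_))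
      (by ring_nf; omega)
  refine (Runs.loop_list (xs := L) (τ := τ + 5) (fun M s' => J (tailEdges M i) s' ∧ Frame 22 s s' ∧
    s'.reg 23 = M.length ∧ EdgesAt s'.mem B i (s'.reg 22) M ∧ (∀ l ∈ M, l ∈ L) ∧
    ∀ a < B, s'.mem a = s.mem a) ?_ ?_ ?_).mono le_rfl fun s' hs' =>
      ⟨hs'.1, hs'.2.1, hs'.2.2.2.2.2⟩
  · rintro s' ⟨-, -, h, -⟩
    simpa using h
  · rintro l M s' ⟨h1, h2, h3, h4, h5, h6⟩
    refine ⟨by rw [h3]; simp, ?_⟩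
    have henv' := henv.frame h2 (by norm_num)
    have hlL := h5 l (by simp)
    have hlen := hk l hlL
    refine Runs.le (T := 1 + ((τ + 1 + 1) + (1 + 1))) ?_ (by omega)
    refine Runs.load_seq (Runs.seq (Q := fun s1 => J (tailEdges M i) s1 ∧ Frame 24 s' s1 ∧
      ∀ a < B, s1.mem a = s.mem a) (Runs.ite ?_ ?_) ?_)
    · intro hflag
      simp only [State.setReg_reg, if_true] at hflag
      have hact := h4.2.1.1 hflag
      have htail : tailEdges (l :: M) i = l :: tailEdges M i := by
        simp only [tailEdges, List.filter_cons]
        rw [if_pos (by simpa using hact)]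
      rw [htail] at h1
      refine (hbody l (tailEdges M i) (s'.setReg 24 (s'.mem (s'.reg 22))) (mem_tailEdges.2 ⟨hlL,
          hact⟩) (hJ _ _ _ h1 ?_ rfl)
        (henv'.frame (b := 24) (Frame.setReg (Frame.refl 24 s') le_rfl) (by norm_num))
            ?_).mono le_rfl ?_
      · intro r _ _ h24
        simp [h24]
      · simpa using h4.2.2.1
      · rintro s1 ⟨h7, h8, h9⟩
        exact ⟨h7, (Frame.setReg (Frame.refl _ _) le_rfl).trans h8, fun a ha => (h9 a ha).trans
            (h6 a ha)⟩
    · intro hflag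
      simp only [State.setReg_reg, if_true] at hflag
      have htail : tailEdges (l :: M) i = tailEdges M i := by
        simp only [tailEdges, List.filter_cons]
        rw [if_neg]
        intro hact
        exact h4.2.1.2 (by simpa using hact) hflag
      rw [htail] at h1
      refine Runs.skip ⟨hJ _ _ _ h1 ?_ rfl, Frame.setReg (Frame.refl _ _) le_rfl, h6⟩
      intro r _ _ h24
      simp [h24]
    · rintro s1 ⟨h7, h8, h9⟩
      have henv1 := henv'.frame h8 (by norm_num)
      refine Runs.plus_seq (Runs.minus ⟨hJ _ _ _ h7 ?_ rfl, ?_, ?_, ?_, ?_, ?_⟩)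
      · intro r h22 h23 _
        simp [h22, h23]
      · exact ((h2.trans (h8.mono (by norm_num))).setReg (by norm_num)).setReg (by norm_num)
      · simp [h8 23 (by norm_num), h3, henv1.one]
      · simp only [State.setReg_reg, State.setReg_mem]
        norm_num
        rw [h8 22 (by norm_num), henv1.stride]
        have h10 := h4.2.2.2
        rw [hlen] at h10
        rw [show s'.reg 22 + (k + 1) = s'.reg 22 + 1 + k by omega]
        exact h10.congr (fun l' hl' => hk l' (h5 l' (by simp [hl']))) fun b hb _ _ => by
          rw [h9 b hb, h6 b hb]
      · intro l' hl'
        exact h5 l' (by simp [hl'])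
      · simpa using h9
  · refine ⟨hJ _ _ _ h ?_ rfl, ?_, ?_, ?_, fun _ => id, fun _ _ => rfl⟩
    · intro r h22 h23 _
      simp [h22, h23]
    · exact ((Frame.refl _ _).setReg (by norm_num)).setReg (by norm_num)
    · simp [henv.m, henv.zero]
    · simpa using hL

end RAM

/-! ### Programs for the exploration. -/

namespace RAM

open Exploration Percolation Glauber

/-- Replace the number in register 40 by its half and put its last digit into register 41. -/
def halve : Prog :=
  .const 42 0 ;; .minus 43 40 2 ;;
  .loop 43 (.minus 40 40 2 ;; .minus 40 40 2 ;; .plus 42 42 2 ;; .minus 43 40 2) ;;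
  .plus 41 40 15 ;; .plus 40 42 15

/-- Halving by repeated subtraction takes time linear in `y`, which is affordable because `y` never
exceeds the polynomially bounded number of strings. The loop register is `reg 40 - 1`, nonzero
exactly while at least `2` remains. -/
theorem runs_halve {s : State} {y : ℕ} (h2 : s.reg 2 = 1) (h15 : s.reg 15 = 0)
    (hy : s.reg 40 = y) : Runs halve s (3 * y + 5) fun s' =>
      s'.reg 40 = y / 2 ∧ s'.reg 41 = y % 2 ∧ s'.mem = s.mem ∧ Frame 40 s s' := by
  refine Runs.le (T := 1 + (1 + (y / 2 * (4 + 1) + 1 + (1 + 1)))) ?_ (by omega)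
  refine .const_seq (.minus_seq (Runs.seq (Runs.loop (m := y / 2) (τ := 4) (fun m s' =>
    s'.reg 40 + 2 * s'.reg 42 = y ∧ s'.reg 40 / 2 = m ∧ s'.reg 43 = s'.reg 40 - 1 ∧
      s'.mem = s.mem ∧ Frame 40 s s') ?_ ?_ ?_) ?_))
  · rintro s' ⟨-, h, h', -⟩
    omega
  · rintro m s' ⟨h3, h4, h5, h6, h7⟩
    have h8 : s'.reg 2 = 1 := (h7 2 (by norm_num)).trans h2
    refine ⟨by omega, .minus_seq (.minus_seq (.plus_seq (.minus ⟨?_, ?_, ?_, ?_, ?_⟩)))⟩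
    · simp [h8]; omega
    · simp [h8]; omega
    · simp [h8]
    · simpa using h6
    · exact (((h7.setReg (by norm_num)).setReg (by norm_num)).setReg (by norm_num)).setReg
          (by norm_num)
  · refine ⟨by simp [hy], by simp [hy], by simp [h2], rfl, ?_⟩
    exact ((Frame.refl _ _).setReg (by norm_num)).setReg (by norm_num)
  · rintro s' ⟨h3, h4, -, h6, h7⟩
    have h8 : s'.reg 15 = 0 := (h7 15 (by norm_num)).trans h15
    refine .plus_seq (.plus ⟨?_, ?_, ?_, ?_⟩)
    · simp [h8]; omega
    · simp [h8]; omega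
    · simpa using h6
    · exact (h7.setReg (by norm_num)).setReg (by norm_num)

/-- The machine holds the exploration state `σ` whose bits are the digits of `j`. -/
structure Holds (B : ℕ) (inp X : ℕ → ℕ) (j : ℕ) (σ : Known) (s : State) : Prop where
  mem : s.mem = layout B inp σ.K X
  digits : s.reg 40 = j / 2 ^ σ.ord.length

theorem Holds.congr {B : ℕ} {inp X : ℕ → ℕ} {j : ℕ} {σ : Known} {s s' : State}
    (h : Holds B inp X j σ s) (hm : s'.mem = s.mem) (hr : s'.reg 40 = s.reg 40) :
    Holds B inp X j σ s' := ⟨hm.trans h.mem, hr.trans h.digits⟩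

theorem Holds.inp {B : ℕ} {inp X : ℕ → ℕ} {j : ℕ} {σ : Known} {s : State}
    (h : Holds B inp X j σ s) {a : ℕ} (ha : a < B) : s.mem a = inp a := by
  rw [h.mem, layout_inp ha]

/-- Reveal the time in register 30, with the result in register 31 and its address in
register 32. -/
def revealAt : Prog :=
  .plus 32 5 30 ;; .plus 32 32 30 ;; .load 31 32 ;;
  .ite 31 .skip (halve ;; .plus 31 41 2 ;; .store 32 31)

section

variable {n m B k M j : ℕ} {inp X : ℕ → ℕ} {σ : Known} {s : State}

theorem runs_revealAt (henv : Env n m B k s) (hσ : Holds B inp X j σ s) (hj : j < M) :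
    Runs revealAt s (3 * M + 12) fun s' =>
      Holds B inp X j (reveal (ofNat j) σ (s.reg 30)) s' ∧
      s'.reg 31 = (reveal (ofNat j) σ (s.reg 30)).K (s.reg 30) ∧
      s'.reg 32 = B + s.reg 30 + s.reg 30 ∧ Frame 31 s s' := by
  set x := s.reg 30 with hx
  set y := s.reg 40 with hy
  have hyM : y ≤ M := by
    rw [show y = _ from hσ.digits]
    exact (Nat.div_le_self _ _).trans hj.le
  refine Runs.le (T := 1 + (1 + (1 + (1 + (3 * y + 5 + (1 + 1)) + 1)))) ?_ (by omega)
  refine .plus_seq (.plus_seq (.load_seq (.ite ?_ ?_)))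
  · intro h
    have h0 : σ.K x ≠ 0 := by simpa [henv.base, ← hx, hσ.mem] using h
    have hrev : reveal (ofNat j) σ x = σ := by rw [reveal, if_neg h0]
    rw [hrev]
    refine .skip ⟨hσ.congr (by simp) (by simp), ?_, ?_, ?_⟩
    · simp [henv.base, ← hx, hσ.mem]
    · simp [henv.base, ← hx]
    · exact ((((Frame.refl _ _).setReg (by norm_num)).setReg (by norm_num)).setReg (by norm_num))
  · intro h
    have h0 : σ.K x = 0 := by simpa [henv.base, ← hx, hσ.mem] using h
    have hbit : (ofNat j σ.ord x).toNat = y % 2 := by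
      rw [ofNat, Nat.testBit_eq_decide_div_mod_eq, hy, hσ.digits]
      rcases Nat.mod_two_eq_zero_or_one (j / 2 ^ σ.ord.length) with h1 | h1 <;> simp [h1]
    have hrev : reveal (ofNat j) σ x = ⟨Function.update σ.K x (y % 2 + 1), x :: σ.ord⟩ := by
      rw [reveal, if_pos h0, hbit]
    rw [hrev]
    refine Runs.seq (runs_halve (y := y) (by simp [henv.one]) (by simp [henv.zero])
        (by simp [hy])) ?_
    rintro s1 ⟨h1, h3, h4, h5⟩
    have h6 : s1.reg 32 = B + x + x := by
      rw [h5 32 (by norm_num)]; simp [henv.base, ← hx]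
    have h7 : s1.reg 2 = 1 := by rw [h5 2 (by norm_num)]; simp [henv.one]
    refine .plus_seq (.store ⟨⟨?_, ?_⟩, ?_, ?_, ?_⟩)
    · simp [h6, h3, h7, h4, hσ.mem]
    · simp only [State.setMem_reg, State.setReg_reg]
      norm_num
      rw [h1, hy, hσ.digits, Nat.div_div_eq_div_mul, pow_succ]
    · simp [h3, h7]
    · simp [h6]
    · refine Frame.setMem (Frame.setReg (Frame.trans ?_ (h5.mono (by norm_num))) (by norm_num))
      exact ((((Frame.refl _ _).setReg (by norm_num)).setReg (by norm_num)).setReg (by norm_num))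

/-- Put the last update of the vertex in register 28 up to the time in register 20 into
register 30; register 21 holds the vertex updated at that time. -/
def locate : Prog :=
  .minus 30 20 21 ;; .plus 30 30 28 ;; .minus 29 28 21 ;; .ite 29 (.minus 30 30 3) .skip

/-- A form without division: `t - t % n` is the beginning of the current round, in which `w` has
already been updated if and only if `w ≤ t % n`; otherwise its last update was in the previous
round. -/
theorem lastUpdate_eq {t w : ℕ} (hw : w < n) (ht : n ≤ t) :
    lastUpdate n t w = if w - t % n = 0 then t - t % n + w else t - t % n + w - n := by
  have hn : 0 < n := by omega
  have h1 := Nat.mod_lt t hn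
  have h2 := Nat.div_add_mod t n
  have h3 : n ≤ n * (t / n) := Nat.le_mul_of_pos_right _ ((Nat.one_le_div_iff hn).2 ht)
  split_ifs with h
  · refine (congrArg (lastUpdate n t) ?_).trans (eq_lastUpdate (x := t - t % n + w) hn ht
        (by omega) (by omega))
    rw [show t - t % n + w = w + n * (t / n) by omega, Nat.add_mul_mod_self_left,
        Nat.mod_eq_of_lt hw]
  · refine (congrArg (lastUpdate n t) ?_).trans
      (eq_lastUpdate (x := t - t % n + w - n) hn ht (by omega) (by omega))
    rw [← Nat.add_mod_right, show t - t % n + w - n + n = w + n * (t / n) by omega,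
      Nat.add_mul_mod_self_left, Nat.mod_eq_of_lt hw]

theorem runs_locate {t w : ℕ} (henv : Env n m B k s) (h20 : s.reg 20 = t) (h21 : s.reg 21 = t % n)
    (h28 : s.reg 28 = w) (hw : w < n) (ht : n ≤ t) : Runs locate s 6 fun s' =>
      s'.reg 30 = lastUpdate n t w ∧ s'.mem = s.mem ∧
        ∀ r, r ≠ 29 → r ≠ 30 → s'.reg r = s.reg r := by
  refine Runs.le (T := 1 + (1 + (1 + (1 + 1 + 1)))) ?_ (by omega)
  refine .minus_seq (.plus_seq (.minus_seq (.ite ?_ ?_)))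
  · intro h
    have h : w - t % n ≠ 0 := by simpa [h20, h21, h28] using h
    refine .minus ⟨?_, rfl, fun r h29 h30 => by simp [h29, h30]⟩
    rw [lastUpdate_eq hw ht, if_neg h]
    simp [h20, h21, h28, henv.n]
  · intro h
    have h : w - t % n = 0 := by simpa [h20, h21, h28] using h
    refine .skip ⟨?_, rfl, fun r h29 h30 => by simp [h29, h30]⟩
    rw [lastUpdate_eq hw ht, if_pos h]
    simp [h20, h21, h28]

/-- Set register 27 if the vertex in register 21 belongs to the hyperedge whose flag is stored at
the address in register 22. -/
def memberTest (k : ℕ) : Prog :=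
  .const 25 k ;; .plus 26 22 2 ;; .const 27 0 ;;
  forWords (.minus 29 28 21 ;; .minus 30 21 28 ;; .plus 29 29 30 ;; .ite 29 .skip (.const 27 1))

/-- Equality of two numbers is tested by adding the truncated differences in both directions, whose
sum vanishes only for equal numbers. -/
theorem runs_memberTest {l : List ℕ} (henv : Env n m B k s) (hlen : l.length = k)
    (hl : ListAt s.mem B (s.reg 22 + 1) l) : Runs (memberTest k) s (k * 10 + 4) fun s' =>
      (s'.reg 27 ≠ 0 ↔ s.reg 21 ∈ l) ∧ Frame 25 s s' ∧ s'.mem = s.mem ∧ s'.reg 40 = s.reg 40 := by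
  refine Runs.le (T := 1 + (1 + (1 + (l.length * (6 + 4) + 1)))) ?_ (by rw [hlen]; omega)
  refine .const_seq (.plus_seq (.const_seq ((runs_forWords (B := B) (l := l)
    (a := s.reg 22 + 1) (fun rest s' =>
    (s'.reg 27 ≠ 0 ∨ s.reg 21 ∈ rest ↔ s.reg 21 ∈ l) ∧ Frame 25 s s' ∧ s'.mem = s.mem ∧
      s'.reg 40 = s.reg 40) ?_ ?_ ?_ ?_ ?_ ?_ ?_).mono le_rfl ?_)))
  · rintro rest s1 s2 ⟨h1, h2, h3, h4⟩ hr hm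
    refine ⟨by rwa [hr 27 (by norm_num) (by norm_num) (by norm_num)], fun r hr' => ?_,
        hm.trans h3, ?_⟩
    · rw [hr r (by omega) (by omega) (by omega), h2 r hr']
    · rw [hr 40 (by norm_num) (by norm_num) (by norm_num), h4]
  · rintro w rest s1 ⟨h1, h2, h3, h4⟩ h28 h2'
    have h21 := h2 21 (by norm_num)
    refine Runs.le (T := 1 + (1 + (1 + (1 + 1 + 1)))) ?_ (by omega)
    refine .minus_seq (.minus_seq (.plus_seq (.ite ?_ ?_)))
    · intro h
      have hne : s.reg 21 ≠ w := by
        rintro hw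
        simp [h28, h21, hw] at h
      refine .skip ⟨⟨?_, ?_, by simpa using h3, by simpa using h4⟩, by simp, by simp, by simp [h2'],
        by simp⟩
      · simpa [hne] using h1
      · exact ((h2.setReg (by norm_num)).setReg (by norm_num)).setReg (by norm_num)
    · intro h
      have heq : s.reg 21 = w := by
        simp [h28, h21] at h
        omega
      refine .const ⟨⟨?_, ?_, by simpa using h3, by simpa using h4⟩, by simp, by simp,
          by simp [h2'],
        by simp⟩
      · simpa [heq] using h1
      · exact (((h2.setReg (by norm_num)).setReg (by norm_num)).setReg (by norm_num)).setReg
          (by norm_num)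
  · refine ⟨by simp, ?_, rfl, by simp⟩
    exact ((Frame.refl _ _).setReg (by norm_num)).setReg (by norm_num) |>.setReg (by norm_num)
  · simp [hlen]
  · simp [henv.one]
  · simp [henv.one]
  · simpa using hl
  · rintro s' ⟨⟨h1, h2, h3, h4⟩, -⟩
    exact ⟨by simpa using h1, h2, h3, h4⟩

theorem reveal_K_of_ne_zero (f : Oracle) (σ : Known) (x : ℕ) {y : ℕ} (h : σ.K y ≠ 0) :
    (reveal f σ x).K y = σ.K y := by
  by_cases hxy : y = x
  · subst hxy
    rw [reveal, if_neg h]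
  · exact reveal_K_of_ne f σ hxy

theorem foldl_reveal_K_of_ne_zero (f : Oracle) (xs : List ℕ) (σ : Known) {y : ℕ} (h : σ.K y ≠ 0) :
    (xs.foldl (reveal f) σ).K y = σ.K y := by
  induction xs generalizing σ with
  | nil => rfl
  | cons x xs ih =>
    rw [List.foldl_cons, ih _ ((reveal_K_of_ne_zero f σ x h).trans_ne h),
        reveal_K_of_ne_zero f σ x h]

/-- Reveal the window of a hyperedge and set register 27 if all its bits are `1`. -/
def revealEdge (k : ℕ) : Prog :=
  .const 25 k ;; .plus 26 22 2 ;; .const 27 1 ;;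
  forWords (locate ;; revealAt ;; .minus 29 31 2 ;; .ite 29 .skip (.const 27 0))

theorem runs_revealEdge {l : List ℕ} {t : ℕ} (henv : Env n m B k s) (hσ : Holds B inp X j σ s)
    (hj : j < M) (h20 : s.reg 20 = t) (h21 : s.reg 21 = t % n) (ht : n ≤ t) (hlen : l.length = k)
    (hln : ∀ w ∈ l, w < n) (hl : ListAt s.mem B (s.reg 22 + 1) l) :
    Runs (revealEdge k) s (k * (3 * M + 26) + 4) fun s' =>
      Holds B inp X j ((l.map (lastUpdate n t)).foldl (reveal (ofNat j)) σ) s' ∧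
      (s'.reg 27 ≠ 0 ↔ ∀ x ∈ l.map (lastUpdate n t),
        2 ≤ ((l.map (lastUpdate n t)).foldl (reveal (ofNat j)) σ).K x) ∧ Frame 25 s s' := by
  set σ' := (l.map (lastUpdate n t)).foldl (reveal (ofNat j)) σ with hσ'
  refine Runs.le (T := 1 + (1 + (1 + (l.length * ((3 * M + 22) + 4) + 1)))) ?_
    (by rw [hlen]; ring_nf; omega)
  refine .const_seq (.plus_seq (.const_seq ((runs_forWords (B := B) (l := l)
    (a := s.reg 22 + 1) (fun rest s' => ∃ τ, Holds B inp X j τ s' ∧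
      (rest.map (lastUpdate n t)).foldl (reveal (ofNat j)) τ = σ' ∧ (∀ w ∈ rest, w < n) ∧
      ((s'.reg 27 ≠ 0 ∧ ∀ x ∈ rest.map (lastUpdate n t), 2 ≤ σ'.K x) ↔
        ∀ x ∈ l.map (lastUpdate n t), 2 ≤ σ'.K x) ∧ Frame 25 s s') ?_ ?_ ?_ ?_ ?_ ?_ ?_).mono
        le_rfl ?_)))
  · rintro rest s1 s2 ⟨τ, h1, h2, h3, h4, h5⟩ hr hm
    refine ⟨τ, h1.congr hm (hr 40 (by norm_num) (by norm_num) (by norm_num)), h2, h3, ?_,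
      fun r hr' => ?_⟩
    · rwa [hr 27 (by norm_num) (by norm_num) (by norm_num)]
    · rw [hr r (by omega) (by omega) (by omega), h5 r hr']
  · rintro w rest s1 ⟨τ, h1, h2, h3, h4, h5⟩ h28 h2'
    have henv1 := henv.frame h5 (by norm_num)
    have ht1 := (h5 20 (by norm_num)).trans h20
    have hu1 := (h5 21 (by norm_num)).trans h21
    refine Runs.le (T := 6 + ((3 * M + 12) + (1 + (1 + 1 + 1)))) ?_ (by omega)
    refine Runs.seq (runs_locate henv1 ht1 hu1 h28 (h3 w (by simp)) ht) ?_
    rintro s2 ⟨h6, h7, h8⟩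
    have hf2 : Frame 25 s s2 := fun r hr => by rw [h8 r (by omega) (by omega), h5 r hr]
    refine Runs.seq (runs_revealAt (henv.frame hf2 (by norm_num))
      (h1.congr h7 (h8 40 (by norm_num) (by norm_num))) hj) ?_
    rw [h6]
    rintro s3 ⟨h9, h10, -, h11⟩
    have hf3 : Frame 25 s s3 := hf2.trans (h11.mono (by norm_num))
    have hone : s3.reg 2 = 1 := (hf3 2 (by norm_num)).trans henv.one
    -- A known bit is not changed by later revelations, so it may be tested at once although the
    -- condition concerns the final state `σ'`.
    have hK : (reveal (ofNat j) τ (lastUpdate n t w)).K (lastUpdate n t w) =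
        σ'.K (lastUpdate n t w) := by
      rw [← h2, List.map_cons, List.foldl_cons,
        foldl_reveal_K_of_ne_zero _ _ _ (reveal_K_ne_zero _ _ _)]
    have hregs : ∀ r, r = 25 ∨ r = 26 ∨ r = 27 → s3.reg r = s1.reg r := by
      intro r hr
      rw [h11 r (by omega), h8 r (by omega) (by omega)]
    have hmem : ∀ a < B, s3.mem a = s1.mem a := fun a ha => by rw [h9.inp ha, h1.inp ha]
    rw [List.map_cons, List.forall_mem_cons] at h4
    refine .minus_seq (.ite ?_ ?_)
    · intro h
      have h12 : 2 ≤ σ'.K (lastUpdate n t w) := by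
        simp [h10, hK, hone] at h
        omega
      refine .skip ⟨⟨_, h9.congr (by simp) (by simp), h2, fun w hw => h3 w (by simp [hw]), ?_,
        hf3.setReg (by norm_num)⟩, ?_, ?_, by simp [hone], by simpa using hmem⟩
      · simpa [h12, hregs 27] using h4
      · simp [hregs 25]
      · simp [hregs 26]
    · intro h
      have h12 : ¬ 2 ≤ σ'.K (lastUpdate n t w) := by
        simp [h10, hK, hone] at h
        omega
      refine .const ⟨⟨_, h9.congr (by simp) (by simp), h2, fun w hw => h3 w (by simp [hw]), ?_,
        (hf3.setReg (by norm_num)).setReg (by norm_num)⟩, ?_, ?_, by simp [hone],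
            by simpa using hmem⟩
      · simpa [h12] using h4
      · simp [hregs 25]
      · simp [hregs 26]
  · refine ⟨σ, hσ.congr (by simp) (by simp), rfl, hln, by simp, ?_⟩
    exact ((Frame.refl _ _).setReg (by norm_num)).setReg (by norm_num) |>.setReg (by norm_num)
  · simp [hlen]
  · simp [henv.one]
  · simp [henv.one]
  · simpa using hl
  · rintro s' ⟨⟨τ, h1, h2, -, h4, h5⟩, -⟩
    simp only [List.map_nil, List.foldl_nil] at h2
    subst h2
    exact ⟨h1, by simpa using h4, h5⟩

/-- Make the window of a hyperedge active. -/
def markEdge (k : ℕ) : Prog :=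
  .const 25 k ;; .plus 26 22 2 ;;
  forWords (locate ;; .plus 32 5 30 ;; .plus 32 32 30 ;; .const 29 3 ;; .store 32 29)

theorem runs_markEdge {l : List ℕ} {t : ℕ} {K : ℕ → ℕ} (henv : Env n m B k s)
    (hmem : s.mem = layout B inp K X)
    (h20 : s.reg 20 = t) (h21 : s.reg 21 = t % n) (ht : n ≤ t) (hlen : l.length = k)
    (hln : ∀ w ∈ l, w < n) (hl : ListAt s.mem B (s.reg 22 + 1) l) :
    Runs (markEdge k) s (k * 14 + 3) fun s' =>
      s'.mem = layout B inp (fun y => if y ∈ l.map (lastUpdate n t) then 3 else K y) X ∧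
      s'.reg 40 = s.reg 40 ∧ Frame 25 s s' := by
  refine Runs.le (T := 1 + (1 + (l.length * (10 + 4) + 1))) ?_ (by rw [hlen]; omega)
  refine .const_seq (.plus_seq ((runs_forWords (B := B) (l := l)
    (a := s.reg 22 + 1) (fun rest s' => ∃ K', s'.mem = layout B inp K' X ∧
      (∀ y, (if y ∈ rest.map (lastUpdate n t) then 3 else K' y) =
        if y ∈ l.map (lastUpdate n t) then 3 else K y) ∧ (∀ w ∈ rest, w < n) ∧
        s'.reg 40 = s.reg 40 ∧ Frame 25 s s') ?_ ?_ ?_ ?_ ?_ ?_ ?_).mono le_rfl ?_))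
  · rintro rest s1 s2 ⟨K', h1, h2, h3, h4, h5⟩ hr hm
    refine ⟨K', hm.trans h1, h2, h3, ?_, fun r hr' => ?_⟩
    · rw [hr 40 (by norm_num) (by norm_num) (by norm_num), h4]
    · rw [hr r (by omega) (by omega) (by omega), h5 r hr']
  · rintro w rest s1 ⟨K', h1, h2, h3, h4, h5⟩ h28 h2'
    have henv1 := henv.frame h5 (by norm_num)
    have ht1 := (h5 20 (by norm_num)).trans h20
    have hu1 := (h5 21 (by norm_num)).trans h21
    refine Runs.le (T := 6 + (1 + (1 + (1 + 1)))) ?_ (by omega)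
    refine Runs.seq (runs_locate henv1 ht1 hu1 h28 (h3 w (by simp)) ht) ?_
    rintro s2 ⟨h6, h7, h8⟩
    have hbase : s2.reg 5 = B := by rw [h8 5 (by norm_num) (by norm_num), henv1.base]
    refine .plus_seq (.plus_seq (.const_seq (.store ⟨⟨Function.update K' (lastUpdate n t w) 3,
        ?_, ?_,
      fun w hw => h3 w (by simp [hw]), ?_, ?_⟩, ?_, ?_, ?_, ?_⟩)))
    · simp [h6, hbase, h7, h1]
    · intro y
      rw [← h2 y]
      simp only [List.map_cons, List.mem_cons]
      by_cases hy : y = lastUpdate n t w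
      · simp [hy]
      · simp [hy]
    · simpa [h8 40] using h4
    · intro r hr
      simp only [State.setMem_reg, State.setReg_reg]
      rw [if_neg (by omega), if_neg (by omega), if_neg (by omega), h8 r (by omega) (by omega),
        h5 r hr]
    · simp [h8 25]
    · simp [h8 26]
    · simp [h8 2, h2']
    · intro a ha
      simp only [State.setMem_mem, State.setReg_mem, State.setReg_reg]
      norm_num
      rw [h6, hbase, h7, Function.update_of_ne (by omega)]
  · refine ⟨K, by simpa using hmem, fun _ => rfl, hln, by simp, ?_⟩
    exact ((Frame.refl _ _).setReg (by norm_num)).setReg (by norm_num)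
  · simp [hlen]
  · simp [henv.one]
  · simp [henv.one]
  · simpa using hl
  · rintro s' ⟨⟨K', h1, h2, -, h4, h5⟩, -⟩
    have : K' = fun y => if y ∈ l.map (lastUpdate n t) then 3 else K y := by
      ext y; simpa using h2 y
    exact ⟨by rw [h1, this], h4, h5⟩

/-- Explore the window of a hyperedge at the time in register 20. -/
def expandEdgeProg (k : ℕ) : Prog :=
  memberTest k ;; .ite 27 (revealEdge k ;; .ite 27 (markEdge k) .skip) .skip

theorem runs_expandEdgeProg {l : List ℕ} {t : ℕ} (henv : Env n m B k s)
    (hσ : Holds B inp X j σ s) (hj : j < M) (h20 : s.reg 20 = t) (h21 : s.reg 21 = t % n)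
    (ht : n ≤ t) (hlen : l.length = k) (hln : ∀ w ∈ l, w < n)
    (hl : ListAt s.mem B (s.reg 22 + 1) l) :
    Runs (expandEdgeProg k) s (k * (3 * M + 50) + 15) fun s' =>
      Holds B inp X j (expandEdge (ofNat j) n t σ l) s' ∧ Frame 25 s s' := by
  refine Runs.le (T := (k * 10 + 4) +
    ((k * (3 * M + 26) + 4) + ((k * 14 + 3) + 1 + 1) + 1 + 1)) ?_ (by ring_nf; omega)
  refine Runs.seq (runs_memberTest henv hlen hl) ?_
  rintro s1 ⟨h1, h2, h3, h4⟩
  rw [h21] at h1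
  refine .ite (T := (k * (3 * M + 26) + 4) + ((k * 14 + 3) + 1 + 1)) (T' := 1) ?_ ?_
  · intro h
    have htl := h1.1 h
    refine Runs.seq (runs_revealEdge (henv.frame h2 (by norm_num)) (hσ.congr h3 h4) hj
      ((h2 20 (by norm_num)).trans h20) ((h2 21 (by norm_num)).trans h21) ht hlen hln
      (by rw [h2 22 (by norm_num), h3]; exact hl)) ?_
    rintro s2 ⟨h5, h6, h7⟩
    have hf : Frame 25 s s2 := h2.trans h7
    rw [expandEdge, if_pos htl, activate]
    refine .ite (T := k * 14 + 3) (T' := 1) ?_ ?_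
    · intro h
      rw [if_pos (h6.1 h)]
      refine (runs_markEdge (henv.frame hf (by norm_num)) h5.mem
        ((hf 20 (by norm_num)).trans h20) ((hf 21 (by norm_num)).trans h21) ht hlen hln
        ?_).mono le_rfl ?_
      · rw [hf 22 (by norm_num)]
        exact hl.congr fun _ hb _ _ => by rw [h5.inp hb, hσ.inp hb]
      · rintro s3 ⟨h8, h9, h10⟩
        exact ⟨⟨h8, h9.trans h5.digits⟩, hf.trans h10⟩
    · intro h
      rw [if_neg fun h' => h6.2 h' h]
      exact .skip ⟨h5, hf⟩
  · intro h
    rw [expandEdge, if_neg fun h' => h1.2 h' h]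
    exact .skip ⟨hσ.congr h3 h4, h2⟩

/-- Clear register 26 if and only if the time in register 20 is active. -/
def activeTest : Prog :=
  .plus 24 5 20 ;; .plus 24 24 20 ;; .load 24 24 ;; .const 25 3 ;; .minus 26 24 25 ;;
  .minus 25 25 24 ;; .plus 26 26 25

theorem runs_activeTest {t : ℕ} {K : ℕ → ℕ} (henv : Env n m B k s)
    (hmem : s.mem = layout B inp K X) (h20 : s.reg 20 = t) :
    Runs activeTest s 7 fun s' => (s'.reg 26 = 0 ↔ K t = 3) ∧ s'.mem = s.mem ∧
      s'.reg 40 = s.reg 40 ∧ Frame 24 s s' := by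
  refine Runs.le (T := 1 + (1 + (1 + (1 + (1 + (1 + 1)))))) ?_ (by omega)
  refine .plus_seq (.plus_seq (.load_seq (.const_seq (.minus_seq (.minus_seq (.plus ⟨?_, rfl,
    by simp, ?_⟩))))))
  · simp [henv.base, h20, hmem]
    omega
  · intro r hr
    simp only [State.setReg_reg]
    repeat rw [if_neg (by omega)]

/-- Explore all windows at the time in register 20 if it is active. -/
def expandProg (k : ℕ) : Prog :=
  activeTest ;; .ite 26 .skip (forEdges (expandEdgeProg k))

end

section

variable {n B k M i j Δ t₀ : ℕ} {inp X : ℕ → ℕ} {σ : Known} {s : State} {L : List (List ℕ)}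

theorem Holds.edgesAt (hL : LinearEdges n k Δ L) (hinp : EdgesAt inp B i 4 L)
    (hσ : Holds B inp X j σ s) : EdgesAt s.mem B i 4 L :=
  hinp.congr hL.length fun _ hb _ _ => hσ.inp hb

theorem runs_expandProg {t : ℕ} (hL : LinearEdges n k Δ L) (hinp : EdgesAt inp B i 4 L)
    (henv : Env n L.length B k s) (hσ : Holds B inp X j σ s) (hj : j < M) (h20 : s.reg 20 = t)
    (h21 : s.reg 21 = t % n) (ht : n ≤ t) :
    Runs (expandProg k) s (L.length * (k * (3 * M + 50) + 21) + 12) fun s' =>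
      Holds B inp X j (expand (ofNat j) n (tailEdges L i) σ t) s' ∧ Frame 22 s s' := by
  refine Runs.le (T := 7 + (1 + (L.length * ((k * (3 * M + 50) + 15) + 6) + 3) + 1)) ?_
    (by ring_nf; omega)
  refine Runs.seq (runs_activeTest henv hσ.mem h20) ?_
  rintro s0 ⟨ha, hm, h40, hf⟩
  have hσ0 := hσ.congr hm h40
  refine .ite (T := 1) (T' := L.length * ((k * (3 * M + 50) + 15) + 6) + 3) ?_ ?_
  · intro h
    rw [expand, if_neg fun h' => h (ha.2 h')]
    exact .skip ⟨hσ0, hf.mono (by norm_num)⟩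
  · intro h
    rw [expand, if_pos (ha.1 h)]
    refine (runs_forEdges (n := n) (B := B) (k := k) (i := i) (L := L)
      (τ := k * (3 * M + 50) + 15) (fun rest s' => ∃ τ, Holds B inp X j τ s' ∧
        rest.foldl (expandEdge (ofNat j) n t) τ =
          (tailEdges L i).foldl (expandEdge (ofNat j) n t) σ ∧
        s'.reg 20 = t ∧ s'.reg 21 = t % n) ?_ ?_ hL.length ?_ (henv.frame hf (by norm_num))
        (hσ0.edgesAt hL hinp)).mono le_rfl ?_
    · rintro rest s1 s2 ⟨τ, h4, h5, h6, h7⟩ hr hm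
      refine ⟨τ, h4.congr hm (hr 40 (by norm_num) (by norm_num) (by norm_num)), h5, ?_, ?_⟩
      · rw [hr 20 (by norm_num) (by norm_num) (by norm_num), h6]
      · rw [hr 21 (by norm_num) (by norm_num) (by norm_num), h7]
    · rintro l rest s1 hl ⟨τ, h4, h5, h6, h7⟩ henv1 hlat
      have hlL := (mem_tailEdges.1 hl).1
      refine (runs_expandEdgeProg henv1 h4 hj h6 h7 ht (hL.length l hlL) (hL.lt l hlL)
        hlat).mono le_rfl ?_
      rintro s2 ⟨h8, h9⟩
      exact ⟨⟨_, h8, h5, (h9 20 (by norm_num)).trans h6, (h9 21 (by norm_num)).trans h7⟩,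
        h9.mono (by norm_num), fun a ha => by rw [h8.inp ha, h4.inp ha]⟩
    · exact ⟨σ, hσ0, rfl, (hf 20 (by norm_num)).trans h20, (hf 21 (by norm_num)).trans h21⟩
    · rintro s' ⟨⟨τ, h4, h5, -, -⟩, h6, -⟩
      simp only [List.foldl_nil] at h5
      rw [← h5]
      exact ⟨h4, (hf.mono (by norm_num)).trans h6⟩

/-- This lets register 21 keep track of `t % n` during the downward sweep without any division. -/
theorem pred_mod {t : ℕ} (hn : 0 < n) (ht : 0 < t) :
    (t - 1) % n = if t % n = 0 then n - 1 else t % n - 1 := by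
  have h1 := Nat.mod_lt t hn
  have h2 := Nat.div_add_mod t n
  split_ifs with h
  · have h3 : 0 < t / n := by
      rcases Nat.eq_zero_or_pos (t / n) with h0 | h0
      · rw [h0] at h2; omega
      · exact h0
    obtain ⟨q, hq⟩ : ∃ q, t / n = q + 1 := ⟨t / n - 1, by omega⟩
    rw [hq, mul_add, mul_one] at h2
    rw [show t - 1 = (n - 1) + n * q by omega, Nat.add_mul_mod_self_left, Nat.mod_eq_of_lt
        (by omega)]
  · rw [show t - 1 = (t % n - 1) + n * (t / n) by omega, Nat.add_mul_mod_self_left,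
      Nat.mod_eq_of_lt (by omega)]

/-- Expand all times from the one in register 9 down to the number of vertices. -/
def sweepProg (k : ℕ) : Prog :=
  .plus 20 9 15 ;; .plus 21 7 15 ;; .plus 19 9 2 ;; .minus 19 19 3 ;;
  .loop 19 (expandProg k ;; .ite 21 (.minus 21 21 2) (.minus 21 3 2) ;; .minus 20 20 2 ;;
    .minus 19 19 2)

theorem runs_sweepProg (hL : LinearEdges n k Δ L) (hinp : EdgesAt inp B i 4 L)
    (henv : Env n L.length B k s) (hσ : Holds B inp X j σ s) (hj : j < M) (h9 : s.reg 9 = t₀)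
    (h7 : s.reg 7 = t₀ % n) (hn : 0 < n) (ht : n ≤ t₀) :
    Runs (sweepProg k) s ((t₀ + 1) * (L.length * (k * (3 * M + 50) + 21) + 18) + 5) fun s' =>
      Holds B inp X j (sweep (ofNat j) n (tailEdges L i) (t₀ + 1 - n) σ) s' ∧ Frame 19 s s' := by
  set τ := L.length * (k * (3 * M + 50) + 21) + 17 with hτ
  refine Runs.le (T := 1 + (1 + (1 + (1 + ((t₀ + 1 - n) * (τ + 1) + 1))))) ?_ ?_
  swap
  · have : (t₀ + 1 - n) * (τ + 1) ≤ (t₀ + 1) * (τ + 1) := Nat.mul_le_mul_right _ (by omega)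
    have h : τ + 1 = L.length * (k * (3 * M + 50) + 21) + 18 := rfl
    rw [← h]
    omega
  refine .plus_seq (.plus_seq (.plus_seq (.minus_seq ((Runs.loop (m := t₀ + 1 - n) (τ := τ)
    (fun m s' => ∃ τ, Holds B inp X j τ s' ∧ sweep (ofNat j) n (tailEdges L i) m τ =
      sweep (ofNat j) n (tailEdges L i) (t₀ + 1 - n) σ ∧ s'.reg 19 = m ∧ s'.reg 20 + 1 = n + m ∧
      s'.reg 21 = s'.reg 20 % n ∧ Frame 19 s s') ?_ ?_ ?_).mono le_rfl ?_))))
  · rintro s' ⟨-, -, -, h, -⟩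
    exact h
  · rintro m s1 ⟨τ', h1, h2, h3, h4, h5, h6⟩
    refine ⟨by omega, ?_⟩
    have henv1 := henv.frame h6 (by norm_num)
    have h20 : s1.reg 20 = n + m := by omega
    refine Runs.le (T := (L.length * (k * (3 * M + 50) + 21) + 12) + ((1 + 1 + 1) + (1 + 1))) ?_
      (by omega)
    refine Runs.seq (runs_expandProg hL hinp henv1 h1 hj h20 (by rw [h5, h20]) (by omega)) ?_
    rintro s2 ⟨h8, h9⟩
    have henv2 := henv1.frame h9 (by norm_num)
    have hf2 : Frame 19 s s2 := h6.trans (h9.mono (by norm_num))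
    have h20' : s2.reg 20 = n + m := (h9 20 (by norm_num)).trans h20
    have h21' : s2.reg 21 = (n + m) % n := by rw [h9 21 (by norm_num), h5, h20]
    have h19' : s2.reg 19 = m + 1 := (h9 19 (by norm_num)).trans h3
    refine Runs.seq (Q := fun s3 => s3.mem = s2.mem ∧ s3.reg 21 = (n + m - 1) % n ∧
      ∀ r, r ≠ 21 → s3.reg r = s2.reg r) (.ite ?_ ?_) ?_
    · intro h
      rw [h21'] at h
      refine .minus ⟨rfl, ?_, fun r hr => by simp [hr]⟩
      rw [pred_mod hn (by omega), if_neg h]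
      simp [h21', henv2.one]
    · intro h
      rw [h21'] at h
      refine .minus ⟨rfl, ?_, fun r hr => by simp [hr]⟩
      rw [pred_mod hn (by omega), if_pos h]
      simp [henv2.n, henv2.one]
    · rintro s3 ⟨h10, h11, h12⟩
      refine .minus_seq (.minus ⟨_, h8.congr ?_ ?_, h2, ?_, ?_, ?_, ?_⟩)
      · simpa using h10
      · simp [h12 40]
      · simp [h12 19, h12 2, h19', henv2.one]
      · simp [h12 20, h12 2, h20', henv2.one]; omega
      · simp [h12 20, h12 2, h20', henv2.one, h11]
      · refine Frame.setReg (Frame.setReg ?_ (by norm_num)) (by norm_num)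
        intro r hr
        rw [h12 r (by omega), hf2 r hr]
  · refine ⟨σ, hσ.congr (by simp) (by simp), rfl, ?_, ?_, ?_, ?_⟩
    · simp [h9, henv.one, henv.n]
    · simp [h9, henv.zero]; omega
    · simp [h9, h7, henv.zero]
    · intro r hr
      simp only [State.setReg_reg]
      repeat rw [if_neg (by omega)]
  · rintro s' ⟨τ', h1, h2, -, -, -, h6⟩
    simp only [sweep] at h2
    exact ⟨h2 ▸ h1, h6⟩

/-- Reveal the time in register 9 and make it active if its bit is `1`. -/
def startProg : Prog :=
  .plus 30 9 15 ;; revealAt ;; .minus 29 31 2 ;; .ite 29 (.const 29 3 ;; .store 32 29) .skip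

theorem runs_startProg {m : ℕ} (henv : Env n m B k s) (hmem : s.mem = layout B inp (fun _ => 0) X)
    (h40 : s.reg 40 = j) (hj : j < M) (h9 : s.reg 9 = t₀) :
    Runs startProg s (3 * M + 18) fun s' =>
      Holds B inp X j (start (ofNat j) t₀) s' ∧ Frame 19 s s' := by
  refine Runs.le (T := 1 + ((3 * M + 12) + (1 + (1 + 1 + 1 + 1)))) ?_ (by omega)
  have h0 : Holds B inp X j ⟨fun _ => 0, []⟩ s := ⟨hmem, by simp [h40]⟩
  refine .plus_seq (Runs.seq (runs_revealAt (henv.frame (b := 19)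
    ((Frame.refl 19 s).setReg (by norm_num)) (by norm_num)) (h0.congr (by simp) (by simp)) hj) ?_)
  have h30 : (s.setReg 30 (s.reg 9 + s.reg 15)).reg 30 = t₀ := by simp [h9, henv.zero]
  rw [h30]
  rintro s1 ⟨h1, h2, h3, h4⟩
  have hf : Frame 19 s s1 := ((Frame.refl 19 s).setReg (by norm_num)).trans (h4.mono (by norm_num))
  have henv1 := henv.frame hf (by norm_num)
  rw [start, activate]
  set τ := reveal (ofNat j) ⟨fun _ => 0, []⟩ t₀
  refine .minus_seq (.ite (T := 1 + 1) (T' := 1) ?_ ?_)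
  · intro h
    have h5 : 2 ≤ τ.K t₀ := by
      simp [h2, henv1.one] at h
      omega
    rw [if_pos (by simpa using h5)]
    refine .const_seq (.store ⟨⟨?_, ?_⟩, ?_⟩)
    · simp only [State.setMem_mem, State.setReg_mem, State.setReg_reg]
      norm_num
      rw [h3, h1.mem, update_layout_K]
      congr 1
      ext y
      simp [Function.update_apply]
    · simpa using h1.digits
    · exact Frame.setMem ((hf.setReg (by norm_num)).setReg (by norm_num))
  · intro h
    have h5 : ¬ 2 ≤ τ.K t₀ := by
      simp [h2, henv1.one] at h
      omega
    rw [if_neg (by simpa using h5)]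
    exact .skip ⟨h1.congr (by simp) (by simp), hf.setReg (by norm_num)⟩

end

end RAM

/-! ### Programs for the forward scan and for one count. -/

namespace RAM

open Exploration Percolation Glauber

/-- The indicator function of a finite set. -/
def ind (C : Finset ℕ) (u : ℕ) : ℕ := if u ∈ C then 1 else 0

theorem ind_empty : ind ∅ = fun _ => 0 := by ext; simp [ind]

theorem update_ind_one (C : Finset ℕ) (u : ℕ) :
    Function.update (ind C) u 1 = ind (insert u C) := by
  ext w
  by_cases h : w = u <;> simp [ind, h]

theorem update_ind_zero (C : Finset ℕ) (u : ℕ) :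
    Function.update (ind C) u 0 = ind (C.erase u) := by
  ext w
  by_cases h : w = u <;> simp [ind, h]

/-- Remove the vertex whose cell has the address in register 33 if all vertices of the hyperedge at
the address in register 22 are present. -/
def fullTest (k : ℕ) : Prog :=
  .const 25 k ;; .plus 26 22 2 ;; .const 27 1 ;;
  forWords (.plus 29 5 28 ;; .plus 29 29 28 ;; .plus 29 29 2 ;; .load 29 29 ;;
    .ite 29 .skip (.const 27 0)) ;;
  .ite 27 (.store 33 15) .skip

section

variable {n m B k u : ℕ} {inp K : ℕ → ℕ} {C : Finset ℕ} {s : State}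

theorem runs_fullTest {l : List ℕ} (henv : Env n m B k s)
    (hmem : s.mem = layout B inp K (ind C)) (h33 : s.reg 33 = B + u + u + 1) (hlen : l.length = k)
    (hl : ListAt s.mem B (s.reg 22 + 1) l) : Runs (fullTest k) s (k * 11 + 7) fun s' =>
      s'.mem = layout B inp K (ind (if ∀ w ∈ l, w ∈ C then C.erase u else C)) ∧
        s'.reg 33 = B + u + u + 1 ∧ Frame 25 s s' := by
  refine Runs.le (T := 1 + (1 + (1 + ((l.length * (7 + 4) + 1) + (1 + 1 + 1))))) ?_
    (by rw [hlen]; omega)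
  refine .const_seq (.plus_seq (.const_seq (Runs.seq (runs_forWords (B := B) (l := l)
    (a := s.reg 22 + 1) (fun rest s' => ((s'.reg 27 ≠ 0 ∧ ∀ w ∈ rest, w ∈ C) ↔ ∀ w ∈ l, w ∈ C) ∧
      s'.mem = layout B inp K (ind C) ∧ s'.reg 33 = B + u + u + 1 ∧ Frame 25 s s')
      ?_ ?_ ?_ ?_ ?_ ?_ ?_) ?_)))
  · rintro rest s1 s2 ⟨h1, h2, h3, h4⟩ hr hm
    refine ⟨by rwa [hr 27 (by norm_num) (by norm_num) (by norm_num)], hm.trans h2, ?_,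
        fun r hr' => ?_⟩
    · rw [hr 33 (by norm_num) (by norm_num) (by norm_num), h3]
    · rw [hr r (by omega) (by omega) (by omega), h4 r hr']
  · rintro w rest s1 ⟨h1, h2, h3, h4⟩ h28 h2'
    have henv1 := henv.frame h4 (by norm_num)
    rw [List.forall_mem_cons] at h1
    refine Runs.le (T := 1 + (1 + (1 + (1 + (1 + 1 + 1))))) ?_ (by omega)
    refine .plus_seq (.plus_seq (.plus_seq (.load_seq (.ite ?_ ?_))))
    · intro h
      have hw : w ∈ C := by
        by_contra hw
        simp [h28, h2', henv1.base, h2, ind, hw] at h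
      refine .skip ⟨⟨?_, by simpa using h2, by simpa using h3, ?_⟩, by simp, by simp,
          by simpa using h2',
        by simp⟩
      · simpa [hw] using h1
      · refine h4.trans fun r hr => ?_
        simp only [State.setReg_reg]
        repeat rw [if_neg (by omega)]
    · intro h
      have hw : w ∉ C := by
        intro hw
        simp [h28, h2', henv1.base, h2, ind, hw] at h
      refine .const ⟨⟨?_, by simpa using h2, by simpa using h3, ?_⟩, by simp, by simp,
          by simpa using h2',
        by simp⟩
      · simpa [hw] using h1
      · refine h4.trans fun r hr => ?_
        simp only [State.setReg_reg]
        repeat rw [if_neg (by omega)]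
  · refine ⟨by simp, by simpa using hmem, by simpa using h33, ?_⟩
    exact ((Frame.refl _ _).setReg (by norm_num)).setReg (by norm_num) |>.setReg (by norm_num)
  · simp [hlen]
  · simp [henv.one]
  · simp [henv.one]
  · simpa using hl
  · rintro s1 ⟨⟨h1, h2, h3, h4⟩, -⟩
    refine .ite ?_ ?_
    · intro h
      rw [if_pos (h1.1 ⟨h, by simp⟩)]
      refine .store ⟨?_, h3, h4⟩
      rw [State.setMem_mem, h2, h3, (henv.frame h4 (by norm_num)).zero, update_layout_X,
        update_ind_zero]
    · intro h
      rw [if_neg fun h' => (h1.2 h').1 h]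
      exact .skip ⟨h2, h3, h4⟩

/-- Fetch and erase what is known about the time in register 20, and compute the address of the cell
of the vertex in register 21. -/
def fetch : Prog :=
  .plus 29 5 20 ;; .plus 29 29 20 ;; .load 30 29 ;; .store 29 15 ;; .minus 30 30 2 ;;
  .plus 33 5 21 ;; .plus 33 33 21 ;; .plus 33 33 2

theorem runs_fetch {X : ℕ → ℕ} {t : ℕ} (henv : Env n m B k s)
    (hmem : s.mem = layout B inp K X) (h20 : s.reg 20 = t) (h21 : s.reg 21 = u) :
    Runs fetch s 8 fun s' => s'.mem = layout B inp (Function.update K t 0) X ∧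
      s'.reg 30 = K t - 1 ∧ s'.reg 33 = B + u + u + 1 ∧ Frame 29 s s' := by
  refine Runs.le (T := 1 + (1 + (1 + (1 + (1 + (1 + (1 + 1))))))) ?_ (by omega)
  refine .plus_seq (.plus_seq (.load_seq (.store_seq (.minus_seq (.plus_seq (.plus_seq (.plus
    ⟨?_, ?_, ?_, ?_⟩)))))))
  · simp [henv.base, henv.zero, hmem, h20]
  · simp [henv.base, henv.one, hmem, h20]
  · simp [henv.base, henv.one, h21]
  · intro r hr
    simp only [State.setReg_reg, State.setMem_reg]
    repeat rw [if_neg (by omega)]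

/-- Perform the update at the time in register 20 of the vertex in register 21. -/
def updateProg (k : ℕ) : Prog :=
  fetch ;; .ite 30 (.store 33 2 ;; forEdges (fullTest k)) (.store 33 15)

end

section

variable {n B k M i j Δ t t₀ : ℕ} {inp K : ℕ → ℕ} {C : Finset ℕ} {σ : Known} {s : State}
  {L : List (List ℕ)}

theorem edgesAt_layout {X : ℕ → ℕ} (hL : LinearEdges n k Δ L) (hinp : EdgesAt inp B i 4 L) :
    EdgesAt (layout B inp K X) B i 4 L :=
  hinp.congr hL.length fun _ hb _ _ => layout_inp hb

theorem runs_updateProg {u : ℕ} (hL : LinearEdges n k Δ L) (hinp : EdgesAt inp B i 4 L)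
    (henv : Env n L.length B k s) (hmem : s.mem = layout B inp K (ind C)) (h20 : s.reg 20 = t)
    (h21 : s.reg 21 = u) :
    Runs (updateProg k) s (L.length * (k * 11 + 13) + 14) fun s' =>
      s'.mem = layout B inp (Function.update K t 0)
        (ind (step (tailEdges L i) C u (decide (2 ≤ K t)))) ∧ Frame 22 s s' := by
  refine Runs.le (T := 8 + (1 + (L.length * ((k * 11 + 7) + 6) + 3) + 1 + 1)) ?_ (by ring_nf; omega)
  refine Runs.seq (runs_fetch henv hmem h20 h21) ?_
  rintro s1 ⟨h1, h2, h3, h4⟩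
  have henv1 := henv.frame h4 (by norm_num)
  set K' := Function.update K t 0
  refine .ite (T := 1 + (L.length * ((k * 11 + 7) + 6) + 3)) (T' := 1) ?_ ?_
  · intro h
    have hK : 2 ≤ K t := by omega
    have h1' : (s1.setMem (s1.reg 33) (s1.reg 2)).mem = layout B inp K' (ind (insert u C)) := by
      rw [State.setMem_mem, h1, h3, henv1.one, update_layout_X, update_ind_one]
    -- The vertex `u` is inserted tentatively. Either no full hyperedge has been met and
    -- independence depends on the remaining ones only, or `u` has been removed, after which further
    -- removals have no effect.
    refine .store_seq ((runs_forEdges (n := n) (B := B) (k := k) (i := i) (L := L)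
      (τ := k * 11 + 7) (fun rest s' => s'.reg 33 = B + u + u + 1 ∧ ∃ C',
        s'.mem = layout B inp K' (ind C') ∧
        (C' = insert u C ∧
          (Indep rest (insert u C) ↔ Indep (tailEdges L i) (insert u C)) ∨
          C' = C.erase u ∧ ¬ Indep (tailEdges L i) (insert u C))) ?_ ?_ hL.length ?_ ?_
              ?_).mono le_rfl ?_)
    · rintro rest s2 s3 ⟨h5, C', h6, h7⟩ hr hm
      exact ⟨by rw [hr 33 (by norm_num) (by norm_num) (by norm_num), h5], C', hm.trans h6, h7⟩
    · rintro l rest s2 hl ⟨h5, C', h6, h7⟩ henv2 hlat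
      refine (runs_fullTest henv2 h6 h5 (hL.length l (mem_tailEdges.1 hl).1) hlat).mono le_rfl ?_
      rintro s3 ⟨h8, h9, h10⟩
      refine ⟨⟨h9, _, h8, ?_⟩, h10.mono (by norm_num), fun a ha => by
        rw [h8, h6, layout_inp ha, layout_inp ha]⟩
      rcases h7 with ⟨rfl, h7⟩ | ⟨rfl, h7⟩
      · split_ifs with hfull
        · refine .inr ⟨by simp, fun hind => ?_⟩
          obtain ⟨w, hw, hw'⟩ := hind l hl
          exact hw' (hfull w hw)
        · refine .inl ⟨rfl, ?_⟩
          rw [← h7]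
          push Not at hfull
          exact ⟨fun h l' hl' => (List.mem_cons.1 hl').elim (fun h' => h' ▸ hfull) (h l'),
            fun h l' hl' => h l' (by simp [hl'])⟩
      · refine .inr ⟨?_, h7⟩
        split_ifs <;> simp
    · exact ⟨h3, _, h1', .inl ⟨rfl, Iff.rfl⟩⟩
    · exact henv1.frame (b := 29) (Frame.setMem (Frame.refl _ _)) (by norm_num)
    · rw [h1']
      exact edgesAt_layout hL hinp
    · rintro s2 ⟨⟨-, C', h6, h7⟩, h8, -⟩
      refine ⟨?_, (h4.mono (by norm_num)).trans ((Frame.setMem (Frame.refl _ _)).trans h8)⟩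
      rw [h6]
      congr 2
      rcases h7 with ⟨rfl, h7⟩ | ⟨rfl, h7⟩
      · rw [step, if_pos ⟨by simpa using hK, h7.1 fun _ h => by simp at h⟩]
      · rw [step, if_neg fun h => h7 h.2]
  · intro h
    have hK : ¬ 2 ≤ K t := by omega
    refine .store ⟨?_, Frame.setMem (h4.mono (by norm_num))⟩
    rw [State.setMem_mem, h1, h3, henv1.zero, update_layout_X, update_ind_zero, step,
      if_neg fun h => hK (by simpa using h.1)]

/-- Run the systematic scan from the empty set up to the time in register 9. -/
def scanProg (k : ℕ) : Prog :=
  .plus 19 9 2 ;; .const 20 0 ;; .const 21 0 ;;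
  .loop 19 (updateProg k ;; .plus 20 20 2 ;; .plus 21 21 2 ;; .minus 22 3 21 ;;
    .ite 22 .skip (.const 21 0) ;; .minus 19 19 2)

theorem succ_mod {t : ℕ} (hn : 0 < n) :
    (t + 1) % n = if n - (t % n + 1) = 0 then 0 else t % n + 1 := by
  have h1 := Nat.mod_lt t hn
  rw [← Nat.mod_add_mod]
  split_ifs with h
  · rw [show t % n + 1 = n by omega, Nat.mod_self]
  · rw [Nat.mod_eq_of_lt (by omega)]

/-- Each time is needed once, so its cell is erased when read. By `hK` nothing is known beyond `t₀`,
and the table is blank for the next trial. Unknown bits count as zero, which is the masking by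
`knownOnes`. -/
theorem runs_scanProg (hL : LinearEdges n k Δ L) (hinp : EdgesAt inp B i 4 L)
    (henv : Env n L.length B k s) (hmem : s.mem = layout B inp K (ind ∅)) (h9 : s.reg 9 = t₀)
    (hn : 0 < n) (hK : ∀ x, K x ≠ 0 → x ≤ t₀) :
    Runs (scanProg k) s ((t₀ + 1) * (L.length * (k * 11 + 13) + 22) + 4) fun s' =>
      s'.mem = layout B inp (fun _ => 0)
        (ind (conf n (tailEdges L i) ∅ ((Finset.range (t₀ + 1)).filter (2 ≤ K ·)) (t₀ + 1))) ∧
      Frame 19 s s' := by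
  set r := (Finset.range (t₀ + 1)).filter (2 ≤ K ·)
  refine Runs.le (T := 1 + (1 + (1 + ((t₀ + 1) * ((L.length * (k * 11 + 13) + 21) + 1) + 1)))) ?_
    (by ring_nf; omega)
  refine .plus_seq (.const_seq (.const_seq ((Runs.loop (m := t₀ + 1)
    (τ := L.length * (k * 11 + 13) + 21)
    (fun m s' => ∃ t, m + t = t₀ + 1 ∧ s'.mem = layout B inp (fun x => if x < t then 0 else K x)
      (ind (conf n (tailEdges L i) ∅ r t)) ∧ s'.reg 19 = m ∧ s'.reg 20 = t ∧ s'.reg 21 = t % n ∧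
      Frame 19 s s') ?_ ?_ ?_).mono le_rfl ?_)))
  · rintro s' ⟨-, -, -, h, -⟩
    exact h
  · rintro m s1 ⟨t, h1, h2, h3, h4, h5, h6⟩
    refine ⟨by omega, ?_⟩
    refine Runs.le (T := (L.length * (k * 11 + 13) + 14) + (1 + (1 + (1 + (1 + 1 + 1 + 1))))) ?_
        (by omega)
    refine Runs.seq (runs_updateProg hL hinp (henv.frame h6 (by norm_num)) h2 h4 h5) ?_
    rintro s2 ⟨h7, h8⟩
    have hf2 : Frame 19 s s2 := h6.trans (h8.mono (by norm_num))
    have henv2 := henv.frame hf2 (by norm_num)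
    have h19 := (h8 19 (by norm_num)).trans h3
    have h20 := (h8 20 (by norm_num)).trans h4
    have h21 := (h8 21 (by norm_num)).trans h5
    refine .plus_seq (.plus_seq (.minus_seq (Runs.seq (T := 1 + 1 + 1) (Q := fun s3 =>
      s3.mem = s2.mem ∧ s3.reg 20 = t + 1 ∧ s3.reg 21 = (t + 1) % n ∧
        ∀ r < 20, s3.reg r = s2.reg r) (.ite ?_ ?_) ?_)))
    · intro h
      have h : n - (t % n + 1) ≠ 0 := by simpa [h21, henv2.one, henv2.n] using h
      refine .skip ⟨rfl, by simp [h20, henv2.one], ?_, ?_⟩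
      · rw [succ_mod hn, if_neg h]
        simp [h21, henv2.one]
      · intro r hr
        simp only [State.setReg_reg]
        repeat rw [if_neg (by omega)]
    · intro h
      have h : n - (t % n + 1) = 0 := by simpa [h21, henv2.one, henv2.n] using h
      refine .const ⟨rfl, by simp [h20, henv2.one], ?_, ?_⟩
      · rw [succ_mod hn, if_pos h]
        simp
      · intro r hr
        simp only [State.setReg_reg]
        repeat rw [if_neg (by omega)]
    · rintro s3 ⟨h9, h10, h11, h12⟩
      refine .minus ⟨t + 1, by omega, ?_, ?_, by simpa using h10, by simpa using h11, ?_⟩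
      · rw [State.setReg_mem, h9, h7, conf]
        congr 2
        · ext x
          rcases lt_trichotomy x t with h | h | h
          · simp [h.ne, h, (by omega : x < t + 1)]
          · simp [h]
          · rw [Function.update_of_ne h.ne', if_neg (by omega), if_neg (by omega)]
        · congr 1
          rw [if_neg (lt_irrefl t)]
          simp [r, (by omega : t < t₀ + 1)]
      · simp [h12 19, h12 2, h19, henv2.one]
      · exact (hf2.trans fun r hr => h12 r (by omega)).setReg (by norm_num)
  · refine ⟨0, rfl, by simpa [conf] using hmem, by simp [h9, henv.one], by simp, by simp, ?_⟩
    intro r hr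
    simp only [State.setReg_reg]
    repeat rw [if_neg (by omega)]
  · rintro s' ⟨t, h1, h2, -, -, -, h6⟩
    obtain rfl : t = t₀ + 1 := by omega
    refine ⟨?_, h6⟩
    rw [h2]
    congr 1
    ext x
    split_ifs with h
    · rfl
    · by_contra h0
      exact h (by have := hK x h0; omega)

/-- Count the run if the vertex in register 7 is vacant. -/
def tally : Prog :=
  .plus 20 5 7 ;; .plus 20 20 7 ;; .plus 20 20 2 ;; .load 20 20 ;; .ite 20 .skip (.plus 12 12 2)

theorem runs_tally (henv : Env n M B k s) (hmem : s.mem = layout B inp K (ind C))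
    (h7 : s.reg 7 = i) : Runs tally s 7 fun s' =>
      s'.reg 12 = s.reg 12 + (if i ∉ C then 1 else 0) ∧ s'.mem = s.mem ∧
        ∀ r < 19, r ≠ 12 → s'.reg r = s.reg r := by
  refine Runs.le (T := 1 + (1 + (1 + (1 + (1 + 1 + 1))))) ?_ (by omega)
  refine .plus_seq (.plus_seq (.plus_seq (.load_seq (.ite ?_ ?_))))
  · intro h
    have hi : i ∈ C := by
      by_contra hi
      simp [henv.base, henv.one, h7, hmem, ind, hi] at h
    refine .skip ⟨by simp [hi], by simp, fun r hr hr' => ?_⟩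
    simp only [State.setReg_reg]
    repeat rw [if_neg (by omega)]
  · intro h
    have hi : i ∉ C := by
      intro hi
      simp [henv.base, henv.one, h7, hmem, ind, hi] at h
    refine .plus ⟨by simp [hi, henv.one], by simp, fun r hr hr' => ?_⟩
    simp only [State.setReg_reg]
    repeat rw [if_neg (by omega)]

/-- Remove all vertices. -/
def clearProg : Prog :=
  .plus 20 5 2 ;; .plus 19 3 15 ;;
  .loop 19 (.store 20 15 ;; .plus 20 20 2 ;; .plus 20 20 2 ;; .minus 19 19 2)

theorem runs_clearProg (henv : Env n M B k s) (hmem : s.mem = layout B inp K (ind C))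
    (hC : C ⊆ Finset.range n) : Runs clearProg s (n * 5 + 3) fun s' =>
      s'.mem = layout B inp K (ind ∅) ∧ Frame 19 s s' := by
  refine Runs.le (T := 1 + (1 + (n * (4 + 1) + 1))) ?_ (by omega)
  refine .plus_seq (.plus_seq ((Runs.loop (m := n) (τ := 4) (fun m s' => s'.reg 19 = m ∧ ∃ u,
    u + m = n ∧ s'.reg 20 = B + u + u + 1 ∧
      s'.mem = layout B inp K (ind (C.filter (u ≤ ·))) ∧ Frame 19 s s') ?_ ?_ ?_).mono le_rfl ?_))
  · rintro s' ⟨h, -⟩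
    exact h
  · rintro m s1 ⟨h1, u, h2, h3, h4, h5⟩
    have henv1 := henv.frame h5 (by norm_num)
    refine ⟨by omega, Runs.le (T := 1 + (1 + (1 + 1))) ?_ (by omega)⟩
    refine .store_seq (.plus_seq (.plus_seq (.minus ⟨?_, u + 1, by omega, ?_, ?_, ?_⟩)))
    · simp [h1, henv1.one]
    · simp [h3, henv1.one]; omega
    · simp only [State.setReg_mem, State.setMem_mem]
      rw [h3, henv1.zero, h4, update_layout_X, update_ind_zero]
      congr 2
      ext w
      simp only [Finset.mem_erase, Finset.mem_filter]
      constructor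
      · rintro ⟨h, h', h''⟩
        exact ⟨h', by omega⟩
      · rintro ⟨h', h''⟩
        exact ⟨by omega, h', by omega⟩
    · refine h5.trans fun r hr => ?_
      simp only [State.setReg_reg, State.setMem_reg]
      repeat rw [if_neg (by omega)]
  · refine ⟨by simp [henv.n, henv.zero], 0, by omega, by simp [henv.base, henv.one],
      by simpa using hmem, ?_⟩
    exact ((Frame.refl _ _).setReg (by norm_num)).setReg (by norm_num)
  · rintro s' ⟨-, u, h2, -, h4, h5⟩
    refine ⟨?_, h5⟩
    rw [h4]
    congr 2
    ext w
    simp only [Finset.mem_filter, Finset.notMem_empty, iff_false, not_and]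
    intro hw h
    have := Finset.mem_range.1 (hC hw)
    omega

end

end RAM

/-! ### Known times stay below the root, for an arbitrary oracle. -/

namespace Exploration

open Percolation Glauber

variable {n t t₀ : ℕ} {L : List (List ℕ)} {σ : Known}

theorem reveal_le (f : Oracle) (h : ∀ x, σ.K x ≠ 0 → x ≤ t₀) {x : ℕ} (hx : x ≤ t₀) :
    ∀ y, (reveal f σ x).K y ≠ 0 → y ≤ t₀ := by
  intro y hy
  by_cases hxy : y = x
  · exact hxy ▸ hx
  · exact h y (by rwa [reveal_K_of_ne f σ hxy] at hy)

theorem foldl_reveal_le (f : Oracle) (xs : List ℕ) (h : ∀ x, σ.K x ≠ 0 → x ≤ t₀)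
    (hxs : ∀ x ∈ xs, x ≤ t₀) : ∀ y, (xs.foldl (reveal f) σ).K y ≠ 0 → y ≤ t₀ := by
  induction xs generalizing σ with
  | nil => exact h
  | cons x xs ih => exact ih (reveal_le f h (hxs x (by simp))) fun y hy => hxs y (by simp [hy])

theorem activate_le (xs : List ℕ) (h : ∀ x, σ.K x ≠ 0 → x ≤ t₀) :
    ∀ y, (activate xs σ).K y ≠ 0 → y ≤ t₀ := by
  intro y hy
  unfold activate at hy
  split_ifs at hy with h1
  · by_cases hyx : y ∈ xs
    · exact h y (by have := h1 y hyx; omega)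
    · exact h y (by simpa [hyx] using hy)
  · exact h y hy

theorem expand_le (f : Oracle) (h : ∀ x, σ.K x ≠ 0 → x ≤ t₀) (ht : t ≤ t₀) :
    ∀ y, (expand f n L σ t).K y ≠ 0 → y ≤ t₀ := by
  unfold expand
  split_ifs with h3
  · clear h3
    induction L generalizing σ with
    | nil => exact h
    | cons l L ih =>
      refine ih ?_
      unfold expandEdge
      split_ifs
      · refine activate_le _ (foldl_reveal_le f _ h fun x hx => ?_)
        obtain ⟨u, -, rfl⟩ := List.mem_map.1 hx
        exact (Nat.sub_le _ _).trans ht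
      · exact h
  · exact h

theorem sweep_le (f : Oracle) {m : ℕ} (h : ∀ x, σ.K x ≠ 0 → x ≤ t₀) (hm : n + m ≤ t₀ + 1) :
    ∀ y, (sweep f n L m σ).K y ≠ 0 → y ≤ t₀ := by
  induction m generalizing σ with
  | zero => exact h
  | succ m ih => exact ih (expand_le f h (by omega)) (by omega)

theorem explore_le (f : Oracle) (hn : n ≤ t₀ + 1) :
    ∀ y, (explore f n L t₀).K y ≠ 0 → y ≤ t₀ :=
  sweep_le f (activate_le _ (reveal_le f (fun _ h => (h rfl).elim) le_rfl)) (by omega)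

theorem _root_.Glauber.conf_subset_range {X r : Finset ℕ} (hn : 0 < n)
    (hX : X ⊆ Finset.range n) (t : ℕ) : conf n L X r t ⊆ Finset.range n := by
  induction t with
  | zero => exact hX
  | succ t ih =>
    rw [conf, step]
    split_ifs
    · exact Finset.insert_subset (Finset.mem_range.2 (Nat.mod_lt _ hn)) ih
    · exact (Finset.erase_subset _ _).trans ih

end Exploration

/-! ### Programs for the trials, the products and the passage to the next vertex. -/

namespace RAM

open Exploration Percolation Glauber

/-- Perform the run with the number in register 11 and count it if it is vacant. -/
def trialProg (k : ℕ) : Prog :=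
  .plus 40 11 15 ;; startProg ;; sweepProg k ;; scanProg k ;; tally ;; clearProg ;;
  .plus 11 11 2 ;; .minus 10 10 2

/-- A bound for the running time of `trialProg`. -/
def trialTime (n m k M t₀ : ℕ) : ℕ :=
  (t₀ + 1) * (m * (k * (3 * M + 50) + 21) + 18) + (t₀ + 1) * (m * (k * 11 + 13) + 22) + 3 * M +
    5 * n + 40

section

variable {n B k M i j Δ t₀ : ℕ} {inp : ℕ → ℕ} {s : State} {L : List (List ℕ)}

theorem runs_trialProg (hL : LinearEdges n k Δ L) (hinp : EdgesAt inp B i 4 L)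
    (henv : Env n L.length B k s) (hmem : s.mem = layout B inp (fun _ => 0) (ind ∅))
    (h11 : s.reg 11 = j) (hj : j < M) (h9 : s.reg 9 = t₀) (h7 : s.reg 7 = i) (hi : t₀ % n = i)
    (hn : 0 < n) (ht : n ≤ t₀) :
    Runs (trialProg k) s (trialTime n L.length k M t₀) fun s' =>
      s'.mem = s.mem ∧ s'.reg 10 = s.reg 10 - 1 ∧ s'.reg 11 = j + 1 ∧
      s'.reg 12 = s.reg 12 + (if Vacant n (tailEdges L i) t₀ j then 1 else 0) ∧
      ∀ r < 19, r ≠ 10 → r ≠ 11 → r ≠ 12 → s'.reg r = s.reg r := by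
  refine Runs.le (T := 1 + ((3 * M + 18) +
    (((t₀ + 1) * (L.length * (k * (3 * M + 50) + 21) + 18) + 5) +
    (((t₀ + 1) * (L.length * (k * 11 + 13) + 22) + 4) + (7 + ((n * 5 + 3) + (1 + 1))))))) ?_
    (by unfold trialTime; omega)
  have hf0 : Frame 19 s (s.setReg 40 (s.reg 11 + s.reg 15)) := (Frame.refl _ _).setReg (by norm_num)
  refine .plus_seq (Runs.seq (runs_startProg (j := j) (X := ind ∅) (inp := inp)
    (henv.frame hf0 (by norm_num)) hmem (by simp [h11, henv.zero]) hj (by simpa using h9)) ?_)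
  rintro s1 ⟨h1, hf1⟩
  replace hf1 := hf0.trans hf1
  refine Runs.seq (runs_sweepProg (t₀ := t₀) hL hinp (henv.frame hf1 (by norm_num)) h1 hj
    ((hf1 9 (by norm_num)).trans h9) (by rw [hf1 7 (by norm_num), h7, hi]) hn ht) ?_
  rw [show sweep (ofNat j) n (tailEdges L i) (t₀ + 1 - n) (start (ofNat j) t₀) =
    explore (ofNat j) n (tailEdges L i) t₀ from rfl]
  rintro s2 ⟨h2, hf2⟩
  replace hf2 := hf1.trans hf2
  refine Runs.seq (runs_scanProg hL hinp (henv.frame hf2 (by norm_num)) h2.mem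
    ((hf2 9 (by norm_num)).trans h9) hn (explore_le _ (by omega))) ?_
  rintro s3 ⟨h3, hf3⟩
  replace hf3 := hf2.trans hf3
  refine Runs.seq (runs_tally (henv.frame hf3 (by norm_num)) h3
    ((hf3 7 (by norm_num)).trans h7)) ?_
  rintro s4 ⟨h4, h5, h6⟩
  have henv4 : Env n L.length B k s4 :=
    ⟨by rw [h6 2 (by norm_num) (by norm_num), hf3 2 (by norm_num), henv.one],
    by rw [h6 3 (by norm_num) (by norm_num), hf3 3 (by norm_num), henv.n],
    by rw [h6 4 (by norm_num) (by norm_num), hf3 4 (by norm_num), henv.m],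
    by rw [h6 5 (by norm_num) (by norm_num), hf3 5 (by norm_num), henv.base],
    by rw [h6 13 (by norm_num) (by norm_num), hf3 13 (by norm_num), henv.stride],
    by rw [h6 15 (by norm_num) (by norm_num), hf3 15 (by norm_num), henv.zero]⟩
  refine Runs.seq (runs_clearProg henv4 (h5.trans h3)
    (conf_subset_range hn (Finset.empty_subset _) _)) ?_
  rintro s5 ⟨h8, h10⟩
  have hr : ∀ r < 19, r ≠ 12 → s5.reg r = s.reg r := fun r hr hr' => by
    rw [h10 r hr, h6 r hr hr', hf3 r hr]
  refine .plus_seq (.minus ⟨?_, ?_, ?_, ?_, ?_⟩)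
  · simpa [hmem] using h8
  · simp [hr, henv.one]
  · simp [hr, henv.one, h11]
  · simp only [State.setReg_reg]
    norm_num
    rw [h10 12 (by norm_num), h4, hf3 12 (by norm_num)]
    simp only [Vacant, hi, knownOnes]
  · intro r hr1 hr2 hr3 hr4
    simp [hr2, hr3, hr r hr1 hr4]

/-- Count the vacant runs. -/
def countProg (k : ℕ) : Prog :=
  .plus 10 6 15 ;; .const 11 0 ;; .const 12 0 ;; .loop 10 (trialProg k)

theorem runs_countProg (hL : LinearEdges n k Δ L) (hinp : EdgesAt inp B i 4 L)
    (henv : Env n L.length B k s) (hmem : s.mem = layout B inp (fun _ => 0) (ind ∅))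
    (h6 : s.reg 6 = M) (h9 : s.reg 9 = t₀) (h7 : s.reg 7 = i) (hi : t₀ % n = i)
    (hn : 0 < n) (ht : n ≤ t₀) :
    Runs (countProg k) s (M * (trialTime n L.length k M t₀ + 1) + 4) fun s' =>
      s'.mem = s.mem ∧
      s'.reg 12 = ((Finset.range M).filter (Vacant n (tailEdges L i) t₀)).card ∧
      ∀ r < 19, r ≠ 10 → r ≠ 11 → r ≠ 12 → s'.reg r = s.reg r := by
  refine Runs.le (T := 1 + (1 + (1 + (M * (trialTime n L.length k M t₀ + 1) + 1)))) ?_ (by omega)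
  refine .plus_seq (.const_seq (.const_seq ((Runs.loop (m := M)
    (fun m s' => s'.reg 10 = m ∧ ∃ j, j + m = M ∧ s'.reg 11 = j ∧ s'.mem = s.mem ∧
      s'.reg 12 = ((Finset.range j).filter (Vacant n (tailEdges L i) t₀)).card ∧
      ∀ r < 19, r ≠ 10 → r ≠ 11 → r ≠ 12 → s'.reg r = s.reg r) ?_ ?_ ?_).mono le_rfl ?_)))
  · rintro s' ⟨h, -⟩
    exact h
  · rintro m s1 ⟨h1, j, h2, h3, h4, h5, hr⟩
    refine ⟨by omega, ?_⟩
    have henv1 : Env n L.length B k s1 :=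
      ⟨by rw [hr 2, henv.one] <;> norm_num, by rw [hr 3, henv.n] <;> norm_num,
      by rw [hr 4, henv.m] <;> norm_num, by rw [hr 5, henv.base] <;> norm_num,
      by rw [hr 13, henv.stride] <;> norm_num, by rw [hr 15, henv.zero] <;> norm_num⟩
    refine (runs_trialProg (j := j) (M := M) hL hinp henv1 (h4.trans hmem) h3 (by omega)
      (by rw [hr 9, h9] <;> norm_num) (by rw [hr 7, h7] <;> norm_num) hi hn ht).mono le_rfl ?_
    rintro s2 ⟨h8, h10, h11, h12, hr'⟩
    refine ⟨by omega, j + 1, by omega, h11, h8.trans h4, ?_, fun r a b c d => ?_⟩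
    · rw [h12, h5, Finset.range_add_one, Finset.filter_insert]
      split_ifs <;> simp
    · rw [hr' r a b c d, hr r a b c d]
  · refine ⟨by simp [h6, henv.zero], 0, by omega, by simp, by simp, by simp, ?_⟩
    intro r a b c d
    simp [b, c, d]
  · rintro s' ⟨-, j, h2, -, h4, h5, hr⟩
    obtain rfl : j = M := by omega
    exact ⟨h4, h5, hr⟩

/-- Multiply register `a` by register `b`. -/
def mulProg (a b : ℕ) : Prog :=
  .plus 20 b 15 ;; .plus 21 a 15 ;; .const a 0 ;; .loop 20 (.plus a a 21 ;; .minus 20 20 2)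

/-- The time depends on the factor in register `b` only. In the main loop this factor is at most the
number of strings, while register `a` may hold a number exponential in `n`. -/
theorem runs_mulProg {a b : ℕ} (h2 : s.reg 2 = 1) (h15 : s.reg 15 = 0) (ha : a < 20)
    (ha' : a ≠ 2) : Runs (mulProg a b) s (s.reg b * 3 + 4) fun s' =>
      s'.reg a = s.reg a * s.reg b ∧ s'.mem = s.mem ∧ ∀ r < 20, r ≠ a → s'.reg r = s.reg r := by
  have h21 : 21 ≠ a := by omega
  refine Runs.le (T := 1 + (1 + (1 + (s.reg b * (2 + 1) + 1)))) ?_ (by omega)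
  refine .plus_seq (.plus_seq (.const_seq ((Runs.loop (m := s.reg b) (τ := 2) (fun m s' =>
    s'.reg 20 = m ∧ s'.reg 21 = s.reg a ∧ s'.reg a + s.reg a * m = s.reg a * s.reg b ∧
      s'.mem = s.mem ∧ ∀ r < 20, r ≠ a → s'.reg r = s.reg r) ?_ ?_ ?_).mono le_rfl ?_)))
  · rintro s' ⟨h, -⟩
    exact h
  · rintro m s1 ⟨h1, h3, h4, h5, h6⟩
    have hone : s1.reg 2 = 1 := by rw [h6 2 (by norm_num) ha'.symm, h2]
    refine ⟨by omega, Runs.le (T := 1 + 1) (.plus_seq (.minus ⟨?_, ?_, ?_, by simpa using h5, ?_⟩))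
      (by omega)⟩
    · simp [ha.ne', ha'.symm, hone, h1]
    · simp [h3, h21]
    · simp [ha.ne, h3, ← h4]; ring
    · intro r hr hr'
      simp [hr', hr.ne, h6 r hr hr']
  · refine ⟨by simp [ha.ne', h15], ?_, by simp, by simp, ?_⟩
    · simp [h21, h15, ha.ne]
    · intro r hr hr'
      have hr21 : r ≠ 21 := by omega
      simp [hr', hr.ne, hr21]
  · rintro s' ⟨-, -, h4, h5, h6⟩
    exact ⟨by simpa using h4, h5, h6⟩

theorem EdgesAt.append {mem : ℕ → ℕ} {a : ℕ} {D D' : List (List ℕ)}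
    (hk : ∀ l ∈ D, l.length = k) (h : EdgesAt mem B i a D)
    (h' : EdgesAt mem B i (a + D.length * (k + 1)) D') : EdgesAt mem B i a (D ++ D') := by
  induction D generalizing a with
  | nil => simpa using h'
  | cons l D ih =>
    refine ⟨h.1, h.2.1, h.2.2.1, ih (fun l hl => hk l (by simp [hl])) h.2.2.2 ?_⟩
    rw [hk l (by simp)]
    convert h' using 1
    rw [List.length_cons]
    ring

/-- Clear the flags of all hyperedges that contain the vertex in register 7. -/
def disableProg (k : ℕ) : Prog :=
  .plus 21 7 15 ;; .const 22 4 ;; .plus 23 4 15 ;;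
  .loop 23 (memberTest k ;; .ite 27 (.store 22 15) .skip ;; .plus 22 22 13 ;; .minus 23 23 2)

/-- The invariant of the loop splits `L` into a processed part, whose flags are already correct for
`i + 1`, and a rest with flags for `i`. A flag changes only if the hyperedge contains `i`. -/
theorem runs_disableProg {K X : ℕ → ℕ} (hk : ∀ l ∈ L, l.length = k)
    (hinp : EdgesAt inp B i 4 L) (henv : Env n L.length B k s) (hmem : s.mem = layout B inp K X)
    (h7 : s.reg 7 = i) :
    Runs (disableProg k) s (L.length * (k * 10 + 10) + 4) fun s' =>
      (∃ inp', s'.mem = layout B inp' K X ∧ EdgesAt inp' B (i + 1) 4 L) ∧ Frame 19 s s' := by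
  refine Runs.le (T := 1 + (1 + (1 + (L.length * ((k * 10 + 9) + 1) + 1)))) ?_ (by ring_nf; omega)
  refine .plus_seq (.const_seq (.plus_seq ((Runs.loop_list (xs := L) (τ := k * 10 + 9)
    (fun M s' => s'.reg 23 = M.length ∧ (∃ inp' D, s'.mem = layout B inp' K X ∧ D ++ M = L ∧
      s'.reg 22 = 4 + D.length * (k + 1) ∧ EdgesAt inp' B (i + 1) 4 D ∧
      EdgesAt inp' B i (4 + D.length * (k + 1)) M) ∧ s'.reg 21 = i ∧ Frame 19 s s')
    ?_ ?_ ?_).mono le_rfl ?_)))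
  · rintro s' ⟨h, -⟩
    simpa using h
  · rintro l M s1 ⟨h1, ⟨inp', D, h2, h3, h4, h5, h6⟩, h8, h9⟩
    refine ⟨by simp [h1], ?_⟩
    have hlL : l ∈ L := by simp [← h3]
    have hlen := hk l hlL
    set a := 4 + D.length * (k + 1) with ha
    have hDk : ∀ l ∈ D, l.length = k := fun l hl => hk l (by simp [← h3, hl])
    have hMk : ∀ l ∈ M, l.length = k := fun l hl => hk l (by simp [← h3, hl])
    have henv1 := henv.frame h9
    refine Runs.le (T := (k * 10 + 4) + ((1 + 1 + 1) + (1 + 1))) ?_ (by omega)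
    refine Runs.seq (runs_memberTest (l := l) (henv1 (by norm_num)) hlen ?_) ?_
    · rw [h4, h2]
      exact h6.2.2.1.congr fun b hb _ _ => layout_inp hb
    rintro s2 ⟨h10, hf, h11, -⟩
    rw [h8] at h10
    have hf2 : Frame 19 s s2 := h9.trans (hf.mono (by norm_num))
    have henv2 := henv.frame hf2 (by norm_num)
    refine Runs.seq (Q := fun s3 => (∃ inp'', s3.mem = layout B inp'' K X ∧
      EdgesAt inp'' B (i + 1) 4 (D ++ [l]) ∧ EdgesAt inp'' B i (a + (k + 1)) M) ∧
      s3.reg = s2.reg) (.ite ?_ ?_) ?_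
    · intro h
      have hil := h10.1 h
      refine .store ⟨⟨Function.update inp' a 0, ?_, ?_, ?_⟩, rfl⟩
      · rw [State.setMem_mem, h11, h2, henv2.zero, hf 22 (by norm_num), h4,
          update_layout_inp _ h6.1]
      · refine EdgesAt.append hDk (h5.congr hDk fun b _ _ hb => ?_) ⟨h6.1, ?_, ?_, trivial⟩
        · exact Function.update_of_ne (by omega) _ _
        · simp only [← ha, Function.update_self, ne_eq, not_true_eq_false, false_iff]
          intro h'
          have := h' i hil
          omega
        · exact h6.2.2.1.congr fun b _ hb _ => Function.update_of_ne (by omega) _ _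
      · have := h6.2.2.2
        rw [hlen, add_assoc, add_comm 1 k] at this
        exact this.congr hMk fun b _ hb _ => Function.update_of_ne (by omega) _ _
    · intro h
      have hil : i ∉ l := fun hil => h10.2 hil h
      refine .skip ⟨⟨inp', h11.trans h2, ?_, ?_⟩, rfl⟩
      · refine EdgesAt.append hDk h5 ⟨h6.1, ?_, h6.2.2.1, trivial⟩
        rw [← ha, h6.2.1]
        refine ⟨fun h' u hu => ?_, fun h' u hu => (Nat.le_succ i).trans (h' u hu)⟩
        have h1 := h' u hu
        have h2 : i ≠ u := fun h2 => hil (h2 ▸ hu)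
        omega
      · have := h6.2.2.2
        rwa [hlen, add_assoc, add_comm 1 k] at this
    · rintro s3 ⟨⟨inp'', h12, h13, h14⟩, h15⟩
      refine .plus_seq (.minus ⟨?_, ⟨inp'', D ++ [l], by simpa using h12, by simp [h3], ?_, h13,
          ?_⟩,
        ?_, ?_⟩)
      · simp [h15, hf 23, h1, henv2.one]
      · simp [h15, hf 22, h4, henv2.stride, ha]
        ring
      · convert h14 using 1
        rw [List.length_append, List.length_singleton, ha]
        ring
      · simp [h15, hf 21, h8]
      · refine hf2.trans fun r hr => ?_
        simp only [State.setReg_reg]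
        rw [if_neg (by omega), if_neg (by omega), h15]
  · refine ⟨by simp [henv.m, henv.zero], ⟨inp, [], by simpa using hmem, rfl, by simp, trivial,
      by simpa using hinp⟩, by simp [h7, henv.zero], fun r hr => ?_⟩
    simp only [State.setReg_reg]
    repeat rw [if_neg (by omega)]
  · rintro s' ⟨-, ⟨inp', D, h2, h3, -, h5, -⟩, -, h9⟩
    rw [List.append_nil] at h3
    exact ⟨⟨inp', h2, h3 ▸ h5⟩, h9⟩

/-- Estimate the marginal of the vertex in register 7, and pass to the next vertex. -/
def stageProg (k : ℕ) : Prog :=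
  countProg k ;; mulProg 1 12 ;; mulProg 0 6 ;; disableProg k ;; .plus 7 7 2 ;; .plus 9 9 2 ;;
  .minus 8 8 2

/-- A bound for the running time of `stageProg`. -/
def stageTime (n m k M t₀ : ℕ) : ℕ :=
  M * (trialTime n m k M t₀ + 1) + 6 * M + m * (k * 10 + 10) + 19

theorem runs_stageProg (hL : LinearEdges n k Δ L) (hinp : EdgesAt inp B i 4 L)
    (henv : Env n L.length B k s) (hmem : s.mem = layout B inp (fun _ => 0) (ind ∅))
    (h6 : s.reg 6 = M) (h9 : s.reg 9 = t₀) (h7 : s.reg 7 = i) (hi : t₀ % n = i)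
    (hn : 0 < n) (ht : n ≤ t₀) :
    Runs (stageProg k) s (stageTime n L.length k M t₀) fun s' =>
      (∃ inp', s'.mem = layout B inp' (fun _ => 0) (ind ∅) ∧ EdgesAt inp' B (i + 1) 4 L) ∧
      Env n L.length B k s' ∧ s'.reg 0 = s.reg 0 * M ∧
      s'.reg 1 = s.reg 1 * ((Finset.range M).filter (Vacant n (tailEdges L i) t₀)).card ∧
      s'.reg 6 = M ∧ s'.reg 7 = i + 1 ∧ s'.reg 8 = s.reg 8 - 1 ∧ s'.reg 9 = t₀ + 1 := by
  set c := ((Finset.range M).filter (Vacant n (tailEdges L i) t₀)).card with hc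
  have hcM : c ≤ M := (Finset.card_filter_le _ _).trans (by simp)
  refine Runs.le (T := (M * (trialTime n L.length k M t₀ + 1) + 4) + ((c * 3 + 4) +
    ((M * 3 + 4) + ((L.length * (k * 10 + 10) + 4) + (1 + (1 + 1)))))) ?_
    (by unfold stageTime; omega)
  refine Runs.seq (runs_countProg hL hinp henv hmem h6 h9 h7 hi hn ht) ?_
  rintro s1 ⟨h1, h2, hr1⟩
  rw [← hc] at h2
  have h3 := runs_mulProg (s := s1) (a := 1) (b := 12) (by rw [hr1 2, henv.one] <;> norm_num)
    (by rw [hr1 15, henv.zero] <;> norm_num) (by norm_num) (by norm_num)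
  rw [h2] at h3
  refine Runs.seq h3 ?_
  rintro s2 ⟨h4, h5, hr2⟩
  replace hr2 : ∀ r < 19, r ≠ 1 → r ≠ 10 → r ≠ 11 → r ≠ 12 → s2.reg r = s.reg r :=
    fun r a b c d e => by rw [hr2 r (by omega) b, hr1 r a c d e]
  have h8 := runs_mulProg (s := s2) (a := 0) (b := 6) (by rw [hr2 2, henv.one] <;> norm_num)
    (by rw [hr2 15, henv.zero] <;> norm_num) (by norm_num) (by norm_num)
  rw [show s2.reg 6 = M by rw [hr2 6, h6] <;> norm_num] at h8
  refine Runs.seq h8 ?_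
  rintro s3 ⟨h10, h11, hr3⟩
  have hone : s3.reg 1 = s.reg 1 * c := by
    rw [hr3 1 (by norm_num) (by norm_num), h4, hr1 1] <;> norm_num
  replace hr3 : ∀ r < 19, r ≠ 0 → r ≠ 1 → r ≠ 10 → r ≠ 11 → r ≠ 12 → s3.reg r = s.reg r :=
    fun r a b c d e f => by rw [hr3 r (by omega) b, hr2 r a c d e f]
  have henv3 : Env n L.length B k s3 :=
    ⟨by rw [hr3 2, henv.one] <;> norm_num, by rw [hr3 3, henv.n] <;> norm_num,
    by rw [hr3 4, henv.m] <;> norm_num, by rw [hr3 5, henv.base] <;> norm_num,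
    by rw [hr3 13, henv.stride] <;> norm_num, by rw [hr3 15, henv.zero] <;> norm_num⟩
  refine Runs.seq (runs_disableProg hL.length hinp henv3 (by rw [h11, h5, h1, hmem])
    (by rw [hr3 7, h7] <;> norm_num)) ?_
  rintro s4 ⟨⟨inp', h12, h13⟩, hf⟩
  have henv4 := henv3.frame hf (by norm_num)
  refine .plus_seq (.plus_seq (.minus ⟨⟨inp', by simpa using h12, h13⟩, ⟨?_, ?_, ?_, ?_, ?_, ?_⟩,
    ?_, ?_, ?_, ?_, ?_, ?_⟩))
  · simpa using henv4.one
  · simpa using henv4.n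
  · simpa using henv4.m
  · simpa using henv4.base
  · simpa using henv4.stride
  · simpa using henv4.zero
  · simp [hf 0, h10, hr2]
  · simp [hf 1, hone]
  · simp [hf 6, hr3, h6]
  · simp [hf 7, hr3, h7, henv4.one]
  · simp [hf 8, hr3, henv4.one]
  · simp [hf 9, hr3, h9, henv4.one]

theorem trialTime_mono {n m k M t₀ t₁ : ℕ} (h : t₀ ≤ t₁) :
    trialTime n m k M t₀ ≤ trialTime n m k M t₁ := by
  unfold trialTime; gcongr

theorem stageTime_mono {n m k M t₀ t₁ : ℕ} (h : t₀ ≤ t₁) :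
    stageTime n m k M t₀ ≤ stageTime n m k M t₁ := by
  have := trialTime_mono (n := n) (m := m) (k := k) (M := M) h
  unfold stageTime; gcongr

theorem runs_loop_stageProg {S : ℕ} (hL : LinearEdges n k Δ L) (hinp : EdgesAt inp B 0 4 L)
    (henv : Env n L.length B k s) (hmem : s.mem = layout B inp (fun _ => 0) (ind ∅))
    (h0 : s.reg 0 = 1) (h1 : s.reg 1 = 1) (h6 : s.reg 6 = 2 ^ S) (h7 : s.reg 7 = 0)
    (h8 : s.reg 8 = n) (h9 : s.reg 9 = (S + 1) * n) :
    Runs (.loop 8 (stageProg k)) s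
      (n * (stageTime n L.length k (2 ^ S) ((S + 2) * n) + 1) + 1) fun s' =>
      s'.reg 0 = (2 ^ S) ^ n ∧ s'.reg 1 = ∏ i ∈ Finset.range n, vacantCount n L S i := by
  refine (Runs.loop (m := n) (fun m s' => s'.reg 8 = m ∧ Env n L.length B k s' ∧ ∃ i, i + m = n ∧
    s'.reg 0 = (2 ^ S) ^ i ∧ s'.reg 1 = ∏ i ∈ Finset.range i, vacantCount n L S i ∧
    s'.reg 6 = 2 ^ S ∧ s'.reg 7 = i ∧ s'.reg 9 = (S + 1) * n + i ∧
    ∃ inp', s'.mem = layout B inp' (fun _ => 0) (ind ∅) ∧ EdgesAt inp' B i 4 L)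
    ?_ ?_ ?_).mono le_rfl ?_
  · rintro s' ⟨h, -⟩
    exact h
  · rintro m s1 ⟨h2, henv1, i, h3, h4, h5, h10, h11, h12, inp', h13, h14⟩
    refine ⟨by omega, ?_⟩
    have hi : ((S + 1) * n + i) % n = i := by
      rw [add_comm, Nat.add_mul_mod_self_right, Nat.mod_eq_of_lt (by omega)]
    refine (runs_stageProg hL h14 henv1 h13 h10 h12 h11 hi (by omega)
      (by rw [add_mul]; omega)).mono (stageTime_mono (by ring_nf; omega)) ?_
    rintro s2 ⟨⟨inp'', h15, h16⟩, h17, h18, h19, h20, h21, h22, h23⟩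
    refine ⟨by omega, h17, i + 1, by omega, ?_, ?_, h20, h21, by omega, inp'', h15, h16⟩
    · rw [h18, h4, pow_succ]
    · rw [h19, h5, Finset.prod_range_succ, vacantCount]
  · exact ⟨h8, henv, 0, by omega, by simpa using h0, by simpa using h1, h6, h7, by simpa using h9,
      inp, hmem, hinp⟩
  · rintro s' ⟨-, -, i, h3, h4, h5, -⟩
    obtain rfl : i = n := by omega
    exact ⟨h4, h5⟩

end

end RAM

/-! ### Reading the input, choosing the string length, and the whole program. -/

namespace RAM

open Exploration Percolation Glauber

/-- Read the input `p, q, n, m, …` with `p` and `q` going to the registers 21 and 22, and set up the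
global constants. -/
def readProg (k : ℕ) : Prog :=
  .const 2 1 ;; .const 13 (k + 1) ;; .const 20 2 ;; .load 3 20 ;; .const 20 3 ;; .load 4 20 ;;
  -- Register 2 holds `1` and serves here as the address of `q`.
  .const 20 0 ;; .load 21 20 ;; .load 22 2 ;; .const 5 4 ;; .plus 23 4 15 ;;
  .loop 23 (.plus 5 5 13 ;; .minus 23 23 2)

theorem runs_readProg (k p q n m : ℕ) (w : List ℕ) :
    Runs (readProg k) (State.init (p :: q :: n :: m :: w)) (m * 3 + 12) fun s' =>
      Env n m (4 + m * (k + 1)) k s' ∧ s'.reg 7 = 0 ∧ s'.reg 21 = p ∧ s'.reg 22 = q ∧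
      s'.mem = (State.init (p :: q :: n :: m :: w)).mem := by
  set s := State.init (p :: q :: n :: m :: w) with hs
  have hm : s.mem 0 = p ∧ s.mem 1 = q ∧ s.mem 2 = n ∧ s.mem 3 = m := ⟨rfl, rfl, rfl, rfl⟩
  have hr : ∀ r, s.reg r = 0 := fun _ => rfl
  refine Runs.le (T := 1 + (1 + (1 + (1 + (1 + (1 + (1 + (1 + (1 + (1 + (1 +
    (m * (2 + 1) + 1))))))))))))
    ?_ (by omega)
  refine .const_seq (.const_seq (.const_seq (.load_seq (.const_seq (.load_seq (.const_seq (.load_seq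
    (.load_seq (.const_seq (.plus_seq ((Runs.loop (m := m) (τ := 2) (fun j s' => s'.reg 23 = j ∧
      (∃ d, d + j = m ∧ s'.reg 5 = 4 + d * (k + 1)) ∧
      (s'.reg 2 = 1 ∧ s'.reg 3 = n ∧ s'.reg 4 = m ∧ s'.reg 13 = k + 1 ∧ s'.reg 15 = 0) ∧
      s'.reg 7 = 0 ∧ s'.reg 21 = p ∧ s'.reg 22 = q ∧ s'.mem = s.mem) ?_ ?_ ?_).mono le_rfl
        ?_)))))))))))
  · rintro s' ⟨h, -⟩
    exact h
  · rintro j s1 ⟨h1, ⟨d, h2, h3⟩, ⟨h4, h5, h6, h7, h8⟩, h9, h10, h11, h12⟩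
    refine ⟨by omega, Runs.le (T := 1 + 1) (.plus_seq (.minus ⟨?_, ⟨d + 1, by omega, ?_⟩,
      ⟨?_, ?_, ?_, ?_, ?_⟩, ?_, ?_, ?_, ?_⟩)) (by omega)⟩
    · simp [h1, h4]
    · simp [h3, h7]; ring
    all_goals simpa
  · refine ⟨by simp [hr, hm], ⟨0, by omega, by simp⟩, ?_, ?_, ?_, ?_, ?_⟩ <;> simp [hr, hm]
  · rintro s' ⟨-, ⟨d, h2, h3⟩, ⟨h4, h5, h6, h7, h8⟩, h9, h10, h11, h12⟩
    obtain rfl : d = m := by omega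
    exact ⟨⟨h4, h5, h6, h3, h7, h8⟩, h9, h10, h11, h12⟩

/-- Double register 26 until it is at least register `t`, adding register 25 to register 24 each
time. -/
def growProg (t : ℕ) : Prog :=
  .minus 27 t 26 ;; .loop 27 (.plus 26 26 26 ;; .plus 24 24 25 ;; .minus 27 t 26)

/-- The hypotheses `ha` and `ha'` say that `a` is the least exponent that suffices, hence the number
of doublings. -/
theorem runs_growProg {s : State} {t x y a c : ℕ} (ht : t < 24) (hx : s.reg t = x)
    (hy : s.reg 26 = y) (hc : s.reg 25 = c) (ha : x ≤ y * 2 ^ a) (ha' : ∀ b < a, y * 2 ^ b < x) :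
    Runs (growProg t) s (a * 4 + 2) fun s' => s'.reg 24 = s.reg 24 + a * c ∧ s'.reg 25 = c ∧
      s'.mem = s.mem ∧ Frame 24 s s' := by
  refine Runs.le (T := 1 + (a * (3 + 1) + 1)) ?_ (by omega)
  refine .minus_seq ((Runs.loop (m := a) (τ := 3) (fun m s' => ∃ b, b + m = a ∧
    s'.reg 26 = y * 2 ^ b ∧ s'.reg 27 = x - y * 2 ^ b ∧ s'.reg 24 = s.reg 24 + b * c ∧
    s'.reg 25 = c ∧ s'.mem = s.mem ∧ Frame 24 s s') ?_ ?_ ?_).mono le_rfl ?_)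
  · rintro s' ⟨b, rfl, -, h, -⟩
    rw [h, add_zero] at *
    omega
  · rintro m s1 ⟨b, h1, h2, h3, h4, h5, h6, h7⟩
    refine ⟨by have := ha' b (by omega); omega, Runs.le (T := 1 + (1 + 1)) (.plus_seq (.plus_seq
      (.minus ⟨b + 1, by omega, ?_, ?_, ?_, ?_, ?_, ?_⟩))) (by omega)⟩
    · simp [h2]; ring
    · have h26 : t ≠ 26 := by omega
      have h24 : t ≠ 24 := by omega
      simp [h2, h24, h26, h7 t ht, hx, pow_succ, mul_two, mul_add]
    · simp [h4, h5]; ring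
    · simpa using h5
    · simpa using h6
    · exact ((h7.setReg (by norm_num)).setReg (by norm_num)).setReg (by norm_num)
  · exact ⟨0, by omega, by simp [hy], by simp [hx, hy], by simp, by simpa using hc, rfl,
      (Frame.refl _ _).setReg (by norm_num)⟩
  · rintro s' ⟨b, h1, -, -, h4, h5, h6, h7⟩
    obtain rfl : b = a := by omega
    exact ⟨h4, h5, h6, h7⟩

/-- Initialize the main loop; register 24 holds the length of the random strings. -/
def prepareProg : Prog :=
  .const 6 1 ;; .plus 27 24 15 ;; .loop 27 (.plus 6 6 6 ;; .minus 27 27 2) ;;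
  .plus 20 24 2 ;; .const 9 0 ;; .loop 20 (.plus 9 9 3 ;; .minus 20 20 2) ;;
  .plus 8 3 15 ;; .const 0 1 ;; .const 1 1

theorem runs_prepareProg {s : State} {n m B k S : ℕ} (henv : Env n m B k s) (h7 : s.reg 7 = 0)
    (h24 : s.reg 24 = S) : Runs prepareProg s (S * 6 + 12) fun s' =>
      Env n m B k s' ∧ s'.mem = s.mem ∧ s'.reg 0 = 1 ∧ s'.reg 1 = 1 ∧ s'.reg 6 = 2 ^ S ∧
      s'.reg 7 = 0 ∧ s'.reg 8 = n ∧ s'.reg 9 = (S + 1) * n := by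
  refine Runs.le (T := 1 + (1 + ((S * (2 + 1) + 1) + (1 + (1 + (((S + 1) * (2 + 1) + 1) +
    (1 + (1 + 1)))))))) ?_ (by omega)
  refine .const_seq (.plus_seq (Runs.seq (Runs.loop (m := S) (τ := 2) (fun m' s' =>
    s'.reg 27 = m' ∧ (∃ b, b + m' = S ∧ s'.reg 6 = 2 ^ b) ∧ Env n m B k s' ∧ s'.reg 7 = 0 ∧
    s'.reg 24 = S ∧ s'.mem = s.mem) ?_ ?_ ?_) ?_))
  · rintro s' ⟨h, -⟩
    exact h
  · rintro m' s1 ⟨h1, ⟨b, h2, h3⟩, h4, h5, h6, h8⟩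
    refine ⟨by omega, Runs.le (T := 1 + 1) (.plus_seq (.minus ⟨?_, ⟨b + 1, by omega, ?_⟩,
      ⟨?_, ?_, ?_, ?_, ?_, ?_⟩, ?_, ?_, ?_⟩)) (by omega)⟩
    · simp [h1, h4.one]
    · simp [h3]; ring
    · simpa using h4.one
    · simpa using h4.n
    · simpa using h4.m
    · simpa using h4.base
    · simpa using h4.stride
    · simpa using h4.zero
    all_goals simpa
  · refine ⟨by simp [h24, henv.zero], ⟨0, by omega, by simp⟩, ⟨?_, ?_, ?_, ?_, ?_, ?_⟩, ?_, ?_, rfl⟩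
    · simpa using henv.one
    · simpa using henv.n
    · simpa using henv.m
    · simpa using henv.base
    · simpa using henv.stride
    · simpa using henv.zero
    all_goals simpa
  · rintro s1 ⟨-, ⟨b, h2, h3⟩, h4, h5, h6, h8⟩
    obtain rfl : b = S := by omega
    refine .plus_seq (.const_seq (Runs.seq (Runs.loop (m := b + 1) (τ := 2) (fun m' s' =>
      s'.reg 20 = m' ∧ (∃ c, c + m' = b + 1 ∧ s'.reg 9 = c * n) ∧ Env n m B k s' ∧ s'.reg 7 = 0 ∧
      s'.reg 6 = 2 ^ b ∧ s'.mem = s.mem) ?_ ?_ ?_) ?_))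
    · rintro s' ⟨h, -⟩
      exact h
    · rintro m' s2 ⟨h9, ⟨c, h10, h11⟩, h12, h13, h14, h15⟩
      refine ⟨by omega, Runs.le (T := 1 + 1) (.plus_seq (.minus ⟨?_, ⟨c + 1, by omega, ?_⟩,
        ⟨?_, ?_, ?_, ?_, ?_, ?_⟩, ?_, ?_, ?_⟩)) (by omega)⟩
      · simp [h9, h12.one]
      · simp [h11, h12.n]; ring
      · simpa using h12.one
      · simpa using h12.n
      · simpa using h12.m
      · simpa using h12.base
      · simpa using h12.stride
      · simpa using h12.zero
      all_goals simpa
    · refine ⟨by simp [h6, h4.one], ⟨0, by omega, by simp⟩, ⟨?_, ?_, ?_, ?_, ?_, ?_⟩, ?_, ?_,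
        by simpa using h8⟩
      · simpa using h4.one
      · simpa using h4.n
      · simpa using h4.m
      · simpa using h4.base
      · simpa using h4.stride
      · simpa using h4.zero
      all_goals simpa
    · rintro s2 ⟨-, ⟨c, h10, h11⟩, h12, h13, h14, h15⟩
      obtain rfl : c = b + 1 := by omega
      refine .plus_seq (.const_seq (.const ⟨⟨?_, ?_, ?_, ?_, ?_, ?_⟩, by simpa using h15, by simp,
        by simp, by simpa using h14, by simpa using h13, ?_, by simpa using h11⟩))
      · simpa using h12.one
      · simpa using h12.n
      · simpa using h12.m
      · simpa using h12.base
      · simpa using h12.stride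
      · simpa using h12.zero
      · simp [h12.n, h12.zero]

theorem listAt_of_getD {mem : ℕ → ℕ} {B a : ℕ} {l : List ℕ}
    (h : ∀ j < l.length, mem (a + j) = l.getD j 0) (hB : a + l.length ≤ B) : ListAt mem B a l := by
  induction l generalizing a with
  | nil => trivial
  | cons x l ih =>
    rw [List.length_cons] at hB
    refine ⟨by omega, by simpa using h 0 (by simp), ih (fun j hj => ?_) (by omega)⟩
    have := h (j + 1) (by simpa using hj)
    rwa [List.getD_cons_succ, ← add_assoc, add_right_comm] at this

theorem length_flatMap_edges {k : ℕ} {L : List (List ℕ)} (hk : ∀ l ∈ L, l.length = k) :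
    (L.flatMap fun l => l.length :: l).length = L.length * (k + 1) := by
  induction L with
  | nil => simp
  | cons l L ih =>
    rw [List.flatMap_cons, List.length_append, ih fun l hl => hk l (by simp [hl]), List.length_cons,
      List.length_cons, hk l (by simp)]
    ring

/-- The length field of each hyperedge in the input is nonzero as `0 < k`, so it can be reused as
the flag; for `i = 0` all flags have to be set. -/
theorem edgesAt_of_getD {mem : ℕ → ℕ} {B a k : ℕ} {L : List (List ℕ)} (hk : 0 < k)
    (hL : ∀ l ∈ L, l.length = k)
    (h : ∀ j < L.length * (k + 1), mem (a + j) = (L.flatMap fun l => l.length :: l).getD j 0)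
    (hB : a + L.length * (k + 1) ≤ B) : EdgesAt mem B 0 a L := by
  induction L generalizing a with
  | nil => trivial
  | cons l L ih =>
    have hlen := hL l (by simp)
    rw [List.length_cons, add_mul, one_mul] at hB h
    simp only [List.flatMap_cons] at h
    refine ⟨by omega, ?_, listAt_of_getD (fun j hj => ?_) (by omega),
      ih (fun l hl => hL l (by simp [hl])) (fun j hj => ?_) (by omega)⟩
    · have := h 0 (by omega)
      have h0 : mem a = l.length := by simpa using this
      exact ⟨fun _ _ _ => Nat.zero_le _, fun _ => by omega⟩
    · have := h (1 + j) (by omega)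
      rw [← add_assoc] at this
      rw [this, List.getD_append _ _ _ _ (by simp; omega), add_comm 1 j, List.getD_cons_succ]
    · have := h (1 + l.length + j) (by omega)
      rw [← add_assoc, ← add_assoc] at this
      rw [this, List.getD_append_right _ _ _ _ (by simp; omega)]
      congr 1
      simp
      omega

/-- The approximation scheme; the random strings have length `A + c * (a + b)` where `2 ^ a` and
`2 ^ b` are at least the number of vertices and `1 / ε`. -/
def schemeProg (k A c : ℕ) : Prog :=
  readProg k ;; .const 24 A ;; .const 25 c ;; .const 26 1 ;; growProg 3 ;; .plus 26 21 15 ;;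
  growProg 22 ;; prepareProg ;; .loop 8 (stageProg k)

theorem runs_schemeProg {n k Δ : ℕ} {L : List (List ℕ)} (hL : LinearEdges n k Δ L) (hk : 0 < k)
    {A c a b p q : ℕ} (ha : n ≤ 2 ^ a) (ha' : ∀ i < a, 2 ^ i < n) (hb : q ≤ p * 2 ^ b)
    (hb' : ∀ i < b, p * 2 ^ i < q) :
    Runs (schemeProg k A c)
      (State.init (p :: q :: n :: L.length :: L.flatMap fun l => l.length :: l))
      (L.length * 3 + 4 * (a + b) + 6 * (A + (a + b) * c) + 33 +
        n * (stageTime n L.length k (2 ^ (A + (a + b) * c)) ((A +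
            (a + b) * c + 2) * n) + 1)) fun s =>
      s.reg 0 = (2 ^ (A + (a + b) * c)) ^ n ∧
      s.reg 1 = ∏ i ∈ Finset.range n, vacantCount n L (A + (a + b) * c) i := by
  set S := A + (a + b) * c with hS
  set w := p :: q :: n :: L.length :: L.flatMap fun l => l.length :: l with hw
  set B := 4 + L.length * (k + 1) with hB
  have hwlen : w.length = B := by
    simp only [hw, List.length_cons, length_flatMap_edges hL.length, hB]
    omega
  refine Runs.le (T := (L.length * 3 + 12) + (1 + (1 + (1 + ((a * 4 + 2) + (1 + ((b * 4 + 2) +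
    ((S * 6 + 12) +
      (n * (stageTime n L.length k (2 ^ S) ((S + 2) * n) + 1) + 1))))))))) ?_ (by omega)
  refine Runs.seq (runs_readProg _ _ _ _ _ _) ?_
  rintro s1 ⟨h1, h2, h3, h4, h5⟩
  refine .const_seq (.const_seq (.const_seq (Runs.seq (runs_growProg (x := n) (y := 1) (a := a)
    (c := c) (by norm_num) (by simp [h1.n]) (by simp) (by simp) (by simpa using ha)
    (by simpa using ha')) ?_)))
  rintro s2 ⟨h6, h7, h8, hf⟩
  have hf2 : Frame 24 s1 s2 := Frame.trans (fun r hr => by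
    simp only [State.setReg_reg]
    repeat rw [if_neg (by omega)]) hf
  replace h6 : s2.reg 24 = A + a * c := by simpa using h6
  replace h8 : s2.mem = s1.mem := by simpa using h8
  refine .plus_seq (Runs.seq (runs_growProg (x := q) (y := p) (a := b)
    (c := c) (by norm_num) (by simp [hf2 22, h4]) (by simp [hf2 21, hf2 15, h3, h1.zero])
    (by simpa using h7) hb hb') ?_)
  rintro s3 ⟨h9, -, h10, hf⟩
  have hf3 : Frame 24 s1 s3 := hf2.trans (Frame.trans ((Frame.refl _ _).setReg (by norm_num)) hf)
  replace h9 : s3.reg 24 = S := by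
    rw [h9]
    simp [h6, hS]
    ring
  replace h10 : s3.mem = s1.mem := h10.trans h8
  refine Runs.seq (runs_prepareProg (h1.frame hf3 (by norm_num)) ((hf3 7
      (by norm_num)).trans h2) h9) ?_
  rintro s4 ⟨h11, h12, h13, h14, h15, h16, h17, h18⟩
  have hinit : s4.mem = (State.init w).mem := h12.trans (h10.trans h5)
  refine runs_loop_stageProg (inp := (State.init w).mem) hL ?_ h11 ?_ h13 h14 h15 h16 h17 h18
  · refine edgesAt_of_getD hk hL.length (fun j _ => ?_) le_rfl
    simp only [State.init, hw]
    rw [add_comm]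
    rfl
  -- Beyond the input the memory is zero: no time is known and no vertex is present.
  · rw [hinit]
    ext x
    rw [layout]
    split_ifs with h h'
    · rfl
    · exact List.getD_eq_default _ _ (by omega)
    · rw [ind_empty]
      exact List.getD_eq_default _ _ (by omega)

end RAM

/-! ### Size of the exponents, of the running time and of the input. -/

namespace RAM

open Exploration Percolation Glauber

/-- Minimality gives `y * 2 ^ a ≤ 2 * x` unless `a = 0`; the summand `y` covers that case. -/
theorem exists_least_pow {x y : ℕ} (hy : 0 < y) :
    ∃ a, x ≤ y * 2 ^ a ∧ (∀ b < a, y * 2 ^ b < x) ∧ y * 2 ^ a ≤ 2 * x + y := by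
  classical
  have h : ∃ a, x ≤ y * 2 ^ a :=
    ⟨x, Nat.lt_two_pow_self.le.trans (Nat.le_mul_of_pos_left _ hy)⟩
  have hmin : ∀ b < Nat.find h, y * 2 ^ b < x := fun b hb => not_le.1 (Nat.find_min h hb)
  refine ⟨Nat.find h, Nat.find_spec h, hmin, ?_⟩
  rcases Nat.eq_zero_or_pos (Nat.find h) with h0 | h0
  · simp [h0]
  · have := hmin (Nat.find h - 1) (by omega)
    obtain ⟨a, ha⟩ : ∃ a, Nat.find h = a + 1 := ⟨Nat.find h - 1, by omega⟩
    rw [ha, Nat.add_sub_cancel] at this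
    rw [ha, pow_succ, ← mul_assoc]
    omega

/-- The number `N` bounds all parameters and `N * N` the final times. After this replacement every
monomial has degree at most `7`. -/
theorem scheme_time_le {n m k S d N : ℕ} (h : n + m + k + d + 2 ^ S + 1 ≤ N) :
    m * 3 + 4 * d + 6 * S + 33 + n * (stageTime n m k (2 ^ S)
        ((S + 2) * n) + 1) ≤ 1000 * N ^ 8 := by
  have hS : S < 2 ^ S := Nat.lt_two_pow_self
  have h1 : n ≤ N := by omega
  have h2 : m ≤ N := by omega
  have h3 : k ≤ N := by omega
  have h4 : d ≤ N := by omega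
  have h5 : 2 ^ S ≤ N := by omega
  have h6 : S + 2 ≤ N := by omega
  have h7 : S ≤ N := by omega
  calc _ ≤ N * 3 + 4 * N + 6 * N + 33 + N * (stageTime N N N N (N * N) + 1) := by
        unfold stageTime trialTime
        gcongr
    _ ≤ 1000 * N ^ 8 := by
        have hp : ∀ i ≤ 8, N ^ i ≤ N ^ 8 := fun i hi => Nat.pow_le_pow_right (by omega) hi
        have p0 := hp 0 (by norm_num)
        have p1 := hp 1 (by norm_num)
        have p2 := hp 2 (by norm_num)
        have p3 := hp 3 (by norm_num)
        have p4 := hp 4 (by norm_num)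
        have p5 := hp 5 (by norm_num)
        have p6 := hp 6 (by norm_num)
        have p7 := hp 7 (by norm_num)
        unfold stageTime trialTime
        ring_nf at *
        omega

end RAM

namespace Percolation

variable {n k Δ : ℕ} {L : List (List ℕ)}

/-- The time bound may involve only `n` and `1 / ε`, so the number of hyperedges has to be bounded
in terms of `n`. -/
theorem LinearEdges.length_le (hL : LinearEdges n k Δ L) (hk : 0 < k) (hnd : L.Nodup) :
    L.length ≤ n * Δ := by
  classical
  rw [← List.toFinset_card_of_nodup hnd]
  have hsub : L.toFinset ⊆ (Finset.range n).biUnion fun u => L.toFinset.filter (u ∈ ·) := by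
    intro l hl
    have hl' := List.mem_toFinset.1 hl
    obtain ⟨u, hu⟩ := List.exists_mem_of_length_pos (hk.trans_eq (hL.length l hl').symm)
    exact Finset.mem_biUnion.2 ⟨u, Finset.mem_range.2 (hL.lt l hl' u hu),
      Finset.mem_filter.2 ⟨hl, hu⟩⟩
  refine (Finset.card_le_card hsub).trans ((Finset.card_biUnion_le_card_mul _ _ Δ fun u _ =>
    hL.degree u).trans ?_)
  rw [Finset.card_range]

end Percolation

/-! ### From encodings of hypergraphs to the approximation scheme. -/

namespace Hypergraph

open Percolation Glauber Exploration RAM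

variable {H : Hypergraph ℕ} {n k Δ : ℕ} {L : List (List ℕ)}

/-- By `hset` different lists have different vertex sets, so linearity and the degree bound pass
from sets to lists. -/
theorem linearEdges_of_encoding (hu : H.IsUniform k) (hlin : H.IsLinear) (hdeg : H.MaxDegreeLE Δ)
    (hV : H.vertexSet = Set.Iio n) (hnd : ∀ l ∈ L, l.Nodup)
    (hset : (L.map fun l => {v | v ∈ l}).Nodup)
    (hE : ∀ e : Set ℕ, e ∈ H.edgeSet ↔ ∃ l ∈ L, {v | v ∈ l} = e) : LinearEdges n k Δ L := by
  have hedge : ∀ l ∈ L, {v | v ∈ l} ∈ H.edgeSet := fun l hl => (hE _).2 ⟨l, hl, rfl⟩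
  have hinj := List.inj_on_of_nodup_map hset
  have hlt : ∀ l ∈ L, ∀ u ∈ l, u < n := fun l hl u hul => by
    have := H.subset_vertexSet_of_mem_edgeSet' (hedge l hl) hul
    rwa [hV] at this
  refine ⟨hnd, fun l hl => ?_, hlt, fun l hl l' hl' hne u h1 h2 v h3 h4 => ?_, fun u => ?_⟩
  · have h1 := hu _ (hedge l hl)
    rw [← List.coe_toFinset, Set.encard_coe_eq_coe_finsetCard,
      List.toFinset_card_of_nodup (hnd l hl)] at h1
    exact_mod_cast h1
  · exact Set.encard_le_one_iff.1 (hlin _ (hedge l hl) _ (hedge l' hl')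
      fun h => hne (hinj hl hl' h)) u v ⟨h1, h2⟩ ⟨h3, h4⟩
  · by_cases hun : u < n
    · have h1 := hdeg u (by rw [hV]; exact hun)
      have h2 : ((fun l : List ℕ => {v | v ∈ l}) '' (L.toFinset.filter (u ∈ ·) : Finset (List ℕ))) ⊆
          {e | e ∈ H.edgeSet ∧ u ∈ e} := by
        rintro _ ⟨l, hl, rfl⟩
        have hl' := Finset.mem_filter.1 (Finset.mem_coe.1 hl)
        exact ⟨hedge l (List.mem_toFinset.1 hl'.1), hl'.2⟩
      have h3 := (Set.encard_le_encard h2).trans h1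
      rw [Set.InjOn.encard_image, Set.encard_coe_eq_coe_finsetCard] at h3
      · exact_mod_cast h3
      · intro l hl l' hl' h
        exact hinj (List.mem_toFinset.1 (Finset.mem_filter.1 (Finset.mem_coe.1 hl)).1)
          (List.mem_toFinset.1 (Finset.mem_filter.1 (Finset.mem_coe.1 hl')).1) h
    · rw [Finset.filter_eq_empty_iff.2, Finset.card_empty]
      · exact Nat.zero_le _
      · intro l hl hul
        exact hun (hlt l (List.mem_toFinset.1 hl) u hul)

theorem numIndepSets_eq_card (hV : H.vertexSet = Set.Iio n)
    (hE : ∀ e : Set ℕ, e ∈ H.edgeSet ↔ ∃ l ∈ L, {v | v ∈ l} = e) :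
    H.numIndepSets = (indepSets n L).card := by
  have himage : {S | H.IsIndepSet S} = (fun X : Finset ℕ => (X : Set ℕ)) '' (indepSets n L) := by
    ext S
    have hiff : (∀ e ∈ H.edgeSet, S ∩ e ≠ e) ↔ ∀ l ∈ L, ∃ w ∈ l, w ∉ S := by
      simp only [ne_eq, Set.inter_eq_right, hE]
      constructor
      · intro h l hl
        obtain ⟨w, hw, hwS⟩ := Set.not_subset.1 (h _ ⟨l, hl, rfl⟩)
        exact ⟨w, hw, hwS⟩
      · rintro h _ ⟨l, hl, rfl⟩ hsub
        obtain ⟨w, hw, hwS⟩ := h l hl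
        exact hwS (hsub hw)
    simp only [Set.mem_ofPred_eq, IsIndepSet, hV, hiff, Set.mem_image, Finset.mem_coe,
        mem_indepSets]
    constructor
    · rintro ⟨h1, h2⟩
      have hfin : S.Finite := (Set.finite_Iio n).subset h1
      refine ⟨hfin.toFinset, ⟨fun x hx => ?_, fun l hl => ?_⟩, by simp⟩
      · exact Finset.mem_range.2 (h1 (hfin.mem_toFinset.1 hx))
      · simpa using h2 l hl
    · rintro ⟨X, ⟨h1, h2⟩, rfl⟩
      exact ⟨fun x hx => Finset.mem_range.1 (h1 hx), h2⟩
  rw [numIndepSets, himage, Set.ncard_image_of_injective _ Finset.coe_injective,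
    Set.ncard_coe_finset]

/-- Independent sets of sparse linear hypergraphs can be counted approximately. -/
theorem hasFPTAS_of_sparse (hS : Sparse k Δ) :
    HasFPTAS {H : Hypergraph ℕ | H.IsUniform k ∧ H.IsLinear ∧ H.MaxDegreeLE Δ} numIndepSets := by
  have hk0 := hS.pos_k
  set θ := Nat.sqrt k
  -- With `l = l₀ + a + b` blocks, `2 ^ l` exceeds the product of the constant `l₀`, of `n ≤ 2 ^ a`
  -- and of `q / p ≤ 2 ^ b`, as required for the accuracy.
  set l₀ := 112 * k ^ 6 * Δ ^ 2
  set A := budget k Δ θ l₀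
  obtain ⟨c, hc⟩ : ∃ c, c = k ^ 2 * ((1 + k ^ 6 * Δ * θ) * (θ * (k ^ 6 * Δ + 1))) * k * (Δ * k) :=
    ⟨_, rfl⟩
  -- The budget is affine in the number of blocks, with slope `c` depending on `k` and `Δ` only. The
  -- number of strings is therefore `2 ^ A * (2 ^ a * 2 ^ b) ^ c`, polynomial in `n` and `1 / ε`.
  have hbudget : ∀ d, budget k Δ θ (l₀ + d) = A + d * c := fun d => by
    simp only [A, hc, budget]; ring
  -- The coefficients of the terms in `hN`: the number `6` accounts for `n`, for `a + b ≤ 4 * R` and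
  -- for the summand `1`. The constant chosen next is a sum so that it exceeds both the coefficient
  -- and the degree of the time bound.
  set G := Δ + k + 6 + 2 ^ A * 2 ^ (2 * c)
  refine ⟨schemeProg k A c, 1000 * G ^ 8 + 8 * (2 * c + 1), ?_⟩
  rintro H ⟨hu, hlin, hdeg⟩ n w ⟨hV, L, hnd, hset, hE, rfl⟩ p q hp hq
  have hL := linearEdges_of_encoding hu hlin hdeg hV hnd hset hE
  have hm := hL.length_le hk0 hset.of_map
  obtain ⟨a, ha, ha', ha''⟩ := exists_least_pow (x := n) one_pos
  obtain ⟨b, hb, hb', hb''⟩ := exists_least_pow (x := q) hp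
  rw [one_mul] at ha ha''
  simp only [one_mul] at ha'
  obtain ⟨t, s, hexec, ht, h0, h1⟩ := runs_schemeProg hL hk0 (A := A) (c := c) ha ha' hb hb'
  have hl₀ : l₀ ≤ 2 ^ l₀ := Nat.lt_two_pow_self.le
  have hest := abs_estimate_sub_le hL hS (l₀ + (a + b)) p q hp hq
    (by
      rw [pow_add, pow_add]
      exact Nat.mul_le_mul hl₀ (ha.trans (Nat.le_mul_of_pos_right _ (by positivity))))
    (by
      rw [pow_add, pow_add]
      calc l₀ * n * q ≤ 2 ^ l₀ * 2 ^ a * (p * 2 ^ b) := by gcongr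
        _ = _ := by ring)
  rw [hbudget (a + b)] at hest
  refine ⟨t, s, hexec, ?_, by rw [h1]; exact hest.1, ?_⟩
  swap
  · rw [h0, h1, numIndepSets_eq_card hV hE]
    exact hest.2
  have hT := ht.trans (scheme_time_le le_rfl)
  have hpR : (0 : ℝ) < p := by exact_mod_cast hp
  have hqR : (0 : ℝ) < q := by exact_mod_cast hq
  set R : ℝ := (n : ℝ) + 1 / ((p : ℝ) / q) + 1 with hR
  have hinv : 1 / ((p : ℝ) / q) = q / p := by rw [one_div_div]
  have hinv0 : 0 < (q : ℝ) / p := by positivity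
  have hn0 : (0 : ℝ) ≤ n := by positivity
  rw [hinv] at hR
  have hR1 : 1 ≤ R := by linarith
  have haR : (2 : ℝ) ^ a ≤ 2 * R := by
    have : (2 : ℝ) ^ a ≤ 2 * n + 1 := by exact_mod_cast ha''
    linarith
  have hbR : (2 : ℝ) ^ b ≤ 2 * R := by
    have h2 : (p : ℝ) * 2 ^ b ≤ 2 * q + p := by exact_mod_cast hb''
    have h3 : (2 : ℝ) ^ b ≤ (2 * q + p) / p := by
      rw [le_div_iff₀ hpR]; linarith
    have h4 : (2 * (q : ℝ) + p) / p = 2 * (q / p) + 1 := by field_simp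
    linarith
  have hab : ((a + b : ℕ) : ℝ) ≤ 4 * R := by
    have h2 : (a : ℝ) ≤ 2 ^ a := by exact_mod_cast Nat.lt_two_pow_self.le
    have h3 : (b : ℝ) ≤ 2 ^ b := by exact_mod_cast Nat.lt_two_pow_self.le
    push_cast
    linarith
  have hmR : (L.length : ℝ) ≤ Δ * R := by
    have h2 : (L.length : ℝ) ≤ n * Δ := by exact_mod_cast hm
    have h3 : (n : ℝ) * Δ ≤ R * Δ := by gcongr; linarith
    linarith
  have hSR : (2 : ℝ) ^ (A + (a + b) * c) ≤ 2 ^ A * 2 ^ (2 * c) * R ^ (2 * c) := by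
    calc (2 : ℝ) ^ (A + (a + b) * c) = 2 ^ A * ((2 ^ a) ^ c * (2 ^ b) ^ c) := by
          rw [pow_add, add_mul, pow_add, pow_mul, pow_mul]
      _ ≤ 2 ^ A * ((2 * R) ^ c * (2 * R) ^ c) := by gcongr
      _ = _ := by rw [← pow_add, ← two_mul, mul_pow]; ring
  have hRc : R ≤ R ^ (2 * c + 1) := le_self_pow₀ hR1 (by omega)
  have hRc' : R ^ (2 * c) ≤ R ^ (2 * c + 1) := pow_le_pow_right₀ hR1 (by omega)
  have hN : ((n + L.length + k + (a + b) + 2 ^ (A + (a + b) * c) + 1 : ℕ) : ℝ) ≤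
      G * R ^ (2 * c + 1) := by
    have h2 : (k : ℝ) ≤ k * R := le_mul_of_one_le_right (by positivity) hR1
    have h3 : ((Δ : ℝ) + k + 6) * R ≤ (Δ + k + 6) * R ^ (2 * c + 1) := by gcongr
    have h4 : (2 : ℝ) ^ A * 2 ^ (2 * c) * R ^ (2 * c) ≤ 2 ^ A * 2 ^ (2 * c) * R ^ (2 * c + 1) := by
      gcongr
    simp only [G]
    push_cast at hab ⊢
    linarith
  have hC : 8 * (2 * c + 1) ≤ 1000 * G ^ 8 + 8 * (2 * c + 1) := Nat.le_add_left _ _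
  calc (t : ℝ) ≤ 1000 * ((n + L.length + k + (a + b) + 2 ^ (A + (a + b) * c) + 1 : ℕ) : ℝ) ^ 8 := by
        exact_mod_cast hT
    _ ≤ 1000 * (G * R ^ (2 * c + 1)) ^ 8 := by gcongr
    _ = 1000 * G ^ 8 * R ^ (8 * (2 * c + 1)) := by rw [mul_pow, ← pow_mul]; ring
    _ ≤ (1000 * G ^ 8 + 8 * (2 * c + 1) : ℕ) * R ^ (1000 * G ^ 8 + 8 * (2 * c + 1)) := by
        refine mul_le_mul ?_ (pow_le_pow_right₀ hR1 hC) (by positivity) (by positivity)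
        push_cast
        have : (0 : ℝ) ≤ 8 * (2 * c + 1) := by positivity
        linarith

end Hypergraph

theorem theorem1p2 (δ : ℝ) (hδ : 0 < δ) (k Δ : ℕ)
    (hk : 25 * (1 + δ) ^ 2 / δ ^ 2 ≤ (k : ℝ)) (hΔ : 2 ≤ Δ)
    (hkΔ : (Δ : ℝ) ≤ 1 / (100 * (k : ℝ) ^ 3) * (2 : ℝ) ^ ((k : ℝ) / (1 + δ))) :
    Hypergraph.HasFPTAS
      {H : Hypergraph ℕ | H.IsUniform k ∧ H.IsLinear ∧ H.MaxDegreeLE Δ}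
      Hypergraph.numIndepSets :=
  Hypergraph.hasFPTAS_of_sparse (Exploration.sparse_of_le hδ hk hΔ hkΔ)
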